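/- Let $\{H_n\}_{n\ge 0}$ and $\{V_n\}_{n\ge 0}$ be two independent random walks on $\mathbb Z$ starting from the origin (each having i.i.d. jumps), the jumps of $V$ being symmetric. Then $$\mathbb P\big(H_{n+1}=0,\ V_nV_{n+1}\le 0\ \text{ for infinitely many } n\big)=1\iff \sum_{n=0}^\infty \mathbb P(H_{n+1}=0)\,\mathbb P(0\le V_n\le V_{n+1}-V_n)=\infty .$$ Furthermore, let $\varphi_H(t)=\mathbb E[e^{itH_1}]$ and $\varphi_V(s)=\mathbb E[e^{isV_1}]$ be the characteristic functions of the jumps, let $\mathcal T_V(n)=\mathbb P(|V_1|\ge n)$ be the two-sided tail of the jumps of $V$, and for $0<r<1$ let $$\Phi_V(r,s)=\sum_{n=0}^\infty r^n\,\mathcal T_V(n)\cos(ns).$$ If the two-dimensional random walk $\{(H_n,V_n)\}_{n\ge 0}$ is transient, i.e. $\|(H_n,V_n)\|\to\infty$ almost surely, then there is $\delta>0$ such that for every measurable neighbourhood $\mathcal V\subset(-\delta,\delta)$ of $0$ in $\mathbb R$ the function $(t,s)\mapsto\Re\big(\Phi_V(r,s)/(1-\varphi_H(t)\varphi_V(s))\big)$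 is integrable on $\mathcal V\times\mathcal V$ for all $0<r<1$, and the divergence of the above series (equivalently, the above probability being equal to $1$) is equivalent to $$\lim_{r\uparrow 1}\int_{\mathcal V}\int_{\mathcal V}\Re\left(\frac{\Phi_V(r,s)}{1-\varphi_H(t)\varphi_V(s)}\right)ds\,dt=\infty .$$ -/

import Mathlib

open MeasureTheory ProbabilityTheory Filter Topology

noncomputable section

/-- `S` is a random walk on `ℤ` starting from the origin: its jumps `S (n+1) - S n` are
independent and identically distributed. -/
structure IsRandomWalk {Ω : Type*} [MeasurableSpace Ω] (S : ℕ → Ω → ℤ) (μ : Measure Ω) :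
    Prop where
  measurable : ∀ n, Measurable (S n)
  start : ∀ᵐ ω ∂μ, S 0 ω = 0
  indep : iIndepFun (fun (n : ℕ) (ω : Ω) => S (n + 1) ω - S n ω) μ
  identDistrib : ∀ n, IdentDistrib (fun ω => S (n + 1) ω - S n ω)
    (fun ω => S 1 ω - S 0 ω) μ μ

/-- The jumps of the random walk `S` are symmetric: the first jump and its opposite have
the same law. -/
def HasSymmetricJumps {Ω : Type*} [MeasurableSpace Ω] (S : ℕ → Ω → ℤ) (μ : Measure Ω) : Prop :=
  IdentDistrib (fun ω => S 1 ω - S 0 ω) (fun ω => -(S 1 ω - S 0 ω)) μ μ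

/-- The two-dimensional process `(H, V)` is transient: almost surely its norm tends to
infinity. -/
def IsTransientPair {Ω : Type*} [MeasurableSpace Ω] (H V : ℕ → Ω → ℤ) (μ : Measure Ω) : Prop :=
  ∀ᵐ ω ∂μ, Tendsto (fun n => ‖((H n ω, V n ω) : ℤ × ℤ)‖) atTop atTop

/-- The characteristic function `t ↦ E[exp (i t X)]` of the jump `X` of the walk `S`. -/
def jumpCharFun {Ω : Type*} [MeasurableSpace Ω] (S : ℕ → Ω → ℤ) (μ : Measure Ω) (t : ℝ) : ℂ :=
  charFun (μ.map (fun ω => ((S 1 ω - S 0 ω : ℤ) : ℝ))) t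

/-- The two-sided tail `P(|X| ≥ n)` of the jump `X` of the walk `S`. -/
def jumpTail {Ω : Type*} [MeasurableSpace Ω] (S : ℕ → Ω → ℤ) (μ : Measure Ω) (n : ℕ) : ℝ :=
  μ.real {ω | (n : ℤ) ≤ |S 1 ω - S 0 ω|}

/-- The trigonometric series `∑ r ^ n P(|X| ≥ n) cos (n s)`, absolutely convergent for
`0 ≤ r < 1`. -/
def tailSeries {Ω : Type*} [MeasurableSpace Ω] (S : ℕ → Ω → ℤ) (μ : Measure Ω) (r s : ℝ) : ℝ :=
  ∑' n : ℕ, r ^ n * jumpTail S μ n * Real.cos (n * s)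

/-- The integrand of the Fourier criterion. -/
def fourierIntegrand {Ω : Type*} [MeasurableSpace Ω] (H V : ℕ → Ω → ℤ) (μ : Measure Ω)
    (r t s : ℝ) : ℝ :=
  ((tailSeries V μ r s : ℂ) / (1 - jumpCharFun H μ t * jumpCharFun V μ s)).re

end

/-!
The jumps `X` of `V` enter through `overlap ρ n = P(|V_n| ≤ |X|)`, with an independent jump `X` of
law `ρ`; let `ν` be the law of the jumps of `H`.

**The zero-one criterion.** By symmetry, both `P(0 ≤ V_n ≤ V_{n+1} - V_n)` and
`P(V_n V_{n+1} ≤ 0)` are comparable to `overlap ρ n`: the four reflections of the cone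
`0 ≤ x ≤ z` cover the set `|x| ≤ |z|`. Hence convergence of the series excludes infinitely many
crossings by Borel–Cantelli. In the other direction one needs that a crossing is not much more
likely when `V` starts at some `v ≠ 0`, or at a later time
(`exists_walkLaw_shift_le`, `exists_overlap_shift_le`). This holds because the law of a symmetric
walk at an even time is a convolution square, for which intervals centred at the origin carry, up
to a constant, the largest mass. Then `measure_frequently_ne_zero_of_renewal`, a Kochen–Stone
lemma, gives infinitely many crossings with positive probability, and the Hewitt–Savage law
`infinitePi_eq_zero_or_one_of_blockSwap` makes this probability one.

**The Fourier criterion.** Transience makes the expected number of visits of the pair to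
`{0} × [-y₀, y₀]` finite (`tsum_walkLaw_mul_window_ne_top`), so that `Re (1 / (1 - φ(t) ψ(s)))`,
which is nonnegative, is integrable (`integrable_resolventRe`). Expanding the geometric series and
using that `Φ(r, ·)` has Fourier coefficients `r ^ m P(|X| ≥ m)`, the integral against a kernel
`k(t)` over the full square of periods is `∑ u_n · 2 π w_n(r)`, with `u_n = ∫ k Re φ ^ n` and with
`w_n(r)` increasing, as `r ↑ 1`, to a limit comparable to `overlap ρ n`
(`tendsto_tsum_tailWeight_iff`). For the Fejér kernel of order `d` the numbers `u_n` are averages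
of the probabilities `P(H_n = j - l)` with `0 ≤ j, l < d`, which may be replaced by `P(H_n = 0)`
(`tsum_fejerWeight_mul_eq_top_iff`).

It remains to pass from `k` to the indicator function of `U × U`. In the variable `s` this costs a
bounded amount, as `|Φ(r, s)| ≤ π / |s|` by Abel summation. In the variable `t` the error
`k - 1_U` is `O(1 - cos (d t))` if `U` is contained in `(-1 / d, 1 / d)`, and this compensates the
inner integral, which is `O(1 / (1 - cos (d t)))` uniformly in `r` for a suitable `d`:
* if `ν` charges `a < b`, because `1 - |φ(t)|` is at least a multiple of `1 - cos ((b - a) t)`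
  (`ae_mul_abs_integral_lawIntegrand_le`);
* if `ν` is the point mass at `a ≠ 0`, with `d = 2 |a|`, because `1 / (1 - e ^ (i a t) ψ)` has an
  absolutely convergent Fourier series whose norm is controlled by splitting the atom at the origin
  off `ψ ^ 2` (`norm_integral_lawTailSeries_mul_inv_le`).

If `H` does not move then the integral in `t` is only a constant factor, and if `V` does not move
then `Φ = 1`, the integral does not depend on `r` and the series converges.
-/

open scoped ENNReal

/-! ### Laws of symmetric random walks on the integers -/

/-- The law of the position at time `n` of the random walk on `ℤ` with step law `ν`, that is, the
`n`-fold convolution power of `ν`. -/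
noncomputable def walkLaw (ν : Measure ℤ) : ℕ → Measure ℤ
  | 0 => Measure.dirac 0
  | n + 1 => (walkLaw ν n).conv ν

theorem walkLaw_zero (ν : Measure ℤ) : walkLaw ν 0 = Measure.dirac 0 := rfl

theorem walkLaw_succ (ν : Measure ℤ) (n : ℕ) : walkLaw ν (n + 1) = (walkLaw ν n).conv ν := rfl

instance isProbabilityMeasure_walkLaw (ν : Measure ℤ) [IsProbabilityMeasure ν] (n : ℕ) :
    IsProbabilityMeasure (walkLaw ν n) := by
  induction n with
  | zero => rw [walkLaw_zero]; infer_instance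
  | succ n ih => rw [walkLaw_succ]; infer_instance

theorem walkLaw_one (ν : Measure ℤ) [IsProbabilityMeasure ν] : walkLaw ν 1 = ν := by
  rw [walkLaw_succ, walkLaw_zero, Measure.dirac_zero_conv]

theorem walkLaw_add (ν : Measure ℤ) [IsProbabilityMeasure ν] (m n : ℕ) :
    walkLaw ν (m + n) = (walkLaw ν m).conv (walkLaw ν n) := by
  induction n with
  | zero => rw [add_zero, walkLaw_zero, Measure.conv_dirac_zero]
  | succ n ih => rw [← add_assoc, walkLaw_succ, ih, walkLaw_succ, Measure.conv_assoc]

theorem conv_int_apply (μ ν : Measure ℤ) [SFinite μ] [SFinite ν] (A : Set ℤ) :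
    (μ.conv ν) A = ∫⁻ z, μ {x | x + z ∈ A} ∂ν := by
  rw [Measure.conv, Measure.map_apply (by fun_prop) (MeasurableSet.of_discrete),
    Measure.prod_apply_symm (MeasurableSet.of_discrete)]
  rfl

theorem lintegral_neg_eq {μ : Measure ℤ} (hμ : μ.map (fun x => -x) = μ) (f : ℤ → ℝ≥0∞) :
    ∫⁻ x, f (-x) ∂μ = ∫⁻ x, f x ∂μ := by
  conv_rhs => rw [← hμ, lintegral_map Measurable.of_discrete Measurable.of_discrete]

theorem measure_neg_eq {ν : Measure ℤ} (hν : ν.map (fun x => -x) = ν) (A : Set ℤ) :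
    ν {x | -x ∈ A} = ν A := by
  conv_rhs => rw [← hν, Measure.map_apply Measurable.of_discrete MeasurableSet.of_discrete]
  rfl

/-- Symmetry of the step law is inherited by all its convolution powers. -/
theorem map_neg_walkLaw {ν : Measure ℤ} [IsProbabilityMeasure ν]
    (hν : ν.map (fun x => -x) = ν) (n : ℕ) : (walkLaw ν n).map (fun x => -x) = walkLaw ν n := by
  induction n with
  | zero => rw [walkLaw_zero, Measure.map_dirac' Measurable.of_discrete, neg_zero]
  | succ n ih =>
    ext A hA
    rw [walkLaw_succ, Measure.map_apply Measurable.of_discrete hA, conv_int_apply, conv_int_apply,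
      ← lintegral_neg_eq hν fun z => walkLaw ν n {x | x + z ∈ A}]
    refine lintegral_congr fun z => ?_
    rw [← measure_neg_eq ih]
    congr 1
    ext x
    simp only [Set.mem_ofPred_eq, Set.mem_preimage]
    rw [neg_add, neg_neg]

/-- `P(f(X) = g(Y)) ≤ (P(f(X) = f(Y)) + P(g(X) = g(Y))) / 2` for independent `X`, `Y` with the
same law: the arithmetic-geometric mean inequality, summed over the common value. -/
theorem two_mul_prod_eq_le (μ : Measure ℤ) [SFinite μ] (f g : ℤ → ℤ) :
    2 * (μ.prod μ) {p | f p.1 = g p.2} ≤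
      (μ.prod μ) {p | f p.1 = f p.2} + (μ.prod μ) {p | g p.1 = g p.2} := by
  have key : ∀ f g : ℤ → ℤ, (μ.prod μ) {p | f p.1 = g p.2}
      = ∑' i : ℤ, μ (f ⁻¹' {i}) * μ (g ⁻¹' {i}) := by
    intro f g
    rw [Measure.prod_apply MeasurableSet.of_discrete]
    have : ∀ a, μ (Prod.mk a ⁻¹' {p : ℤ × ℤ | f p.1 = g p.2})
        = (fun i => μ (g ⁻¹' {i})) (f a) := by
      intro a
      congr 1
      ext b
      simp [eq_comm]
    simp_rw [this]
    rw [← lintegral_map (f := fun i => μ (g ⁻¹' {i})) (g := f) Measurable.of_discrete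
      Measurable.of_discrete, lintegral_countable']
    refine tsum_congr fun i => ?_
    rw [Measure.map_apply (by fun_prop) MeasurableSet.of_discrete, mul_comm]
  rw [key, key, key, ← ENNReal.tsum_mul_left, ← ENNReal.tsum_add]
  refine ENNReal.tsum_le_tsum fun i => ?_
  generalize μ (f ⁻¹' {i}) = a
  generalize μ (g ⁻¹' {i}) = b
  rcases eq_or_ne a ∞ with rfl | ha
  · simp
  rcases eq_or_ne b ∞ with rfl | hb
  · simp
  lift a to NNReal using ha
  lift b to NNReal using hb
  norm_cast
  rw [← mul_assoc, ← sq, ← sq]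
  exact two_mul_le_add_sq a b

/-- For the convolution square of a symmetric law, no interval of length `2 y` carries much more
mass than the one centred at the origin. The line is cut into blocks of length `y + 1`, and two
points at distance at most `y` lie in the same or in neighbouring blocks. -/
theorem conv_self_shift_le {μ : Measure ℤ} [IsProbabilityMeasure μ]
    (hμ : μ.map (fun x => -x) = μ) (v : ℤ) (y : ℕ) :
    (μ.conv μ) {x | |x + v| ≤ y} ≤ 3 * (μ.conv μ) {x | |x| ≤ y} := by
  have hconv : ∀ v : ℤ, (μ.conv μ) {x | |x + v| ≤ y}
      = (μ.prod μ) {p : ℤ × ℤ | |p.1 - p.2 + v| ≤ y} := by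
    intro v
    rw [conv_int_apply, Measure.prod_apply_symm MeasurableSet.of_discrete]
    rw [← lintegral_neg_eq hμ fun z => μ {x | x + z ∈ {x | |x + v| ≤ (y : ℤ)}}]
    rfl
  have h0 := hconv 0
  simp only [add_zero] at h0
  rw [hconv v, h0]
  set L : ℤ := (y : ℤ) + 1 with hL
  have hLpos : 0 < L := by positivity
  have hblock : ∀ a b : ℤ, a / L = b / L → |a - b| ≤ y := by
    intro a b h
    have h1 := Int.emod_add_mul_ediv a L
    have h2 := Int.emod_add_mul_ediv b L
    have h3 := Int.emod_nonneg a hLpos.ne'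
    have h4 := Int.emod_nonneg b hLpos.ne'
    have h5 := Int.emod_lt_of_pos a hLpos
    have h6 := Int.emod_lt_of_pos b hLpos
    rw [h] at h1
    rw [abs_le]; constructor <;> linarith
  -- Two points in the same block are at distance at most `y`; for a fixed offset of the blocks the
  -- event is reduced to this case by `two_mul_prod_eq_le`.
  have hpair : ∀ e : ℤ, (μ.prod μ) {p | p.1 / L = (p.2 - v) / L + e}
      ≤ (μ.prod μ) {p : ℤ × ℤ | |p.1 - p.2| ≤ y} := by
    intro e
    have h := two_mul_prod_eq_le μ (fun a => a / L) (fun b => (b - v) / L + e)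
    have h1 : (μ.prod μ) {p | p.1 / L = p.2 / L} ≤ (μ.prod μ) {p : ℤ × ℤ | |p.1 - p.2| ≤ y} :=
      measure_mono fun p hp => hblock _ _ hp
    have h2 : (μ.prod μ) {p | (p.1 - v) / L + e = (p.2 - v) / L + e}
        ≤ (μ.prod μ) {p : ℤ × ℤ | |p.1 - p.2| ≤ y} :=
      measure_mono fun p hp => by
        have := hblock _ _ (add_right_cancel hp)
        simpa using this
    have h3 := h.trans (add_le_add h1 h2)
    rw [← two_mul] at h3
    exact (ENNReal.mul_le_mul_iff_right (by simp) (by simp)).1 h3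
  calc (μ.prod μ) {p : ℤ × ℤ | |p.1 - p.2 + v| ≤ y}
      ≤ (μ.prod μ) (({p | p.1 / L = (p.2 - v) / L + (-1)} ∪ {p | p.1 / L = (p.2 - v) / L + 0})
          ∪ {p | p.1 / L = (p.2 - v) / L + 1}) := by
        refine measure_mono fun p hp => ?_
        simp only [Set.mem_ofPred_eq, Set.mem_union, abs_le] at hp ⊢
        obtain ⟨hp1, hp2⟩ := hp
        have h1 : p.1 / L ≤ (p.2 - v) / L + 1 := by
          have := Int.ediv_le_ediv hLpos (show p.1 ≤ (p.2 - v) + 1 * L by linarith)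
          rwa [Int.add_mul_ediv_right _ _ hLpos.ne'] at this
        have h2 : (p.2 - v) / L ≤ p.1 / L + 1 := by
          have := Int.ediv_le_ediv hLpos (show (p.2 - v) ≤ p.1 + 1 * L by linarith)
          rwa [Int.add_mul_ediv_right _ _ hLpos.ne'] at this
        omega
    _ ≤ _ := (measure_union_le _ _).trans (add_le_add (measure_union_le _ _) le_rfl)
    _ ≤ _ := add_le_add (add_le_add (hpair _) (hpair _)) (hpair _)
    _ = 3 * (μ.prod μ) {p : ℤ × ℤ | |p.1 - p.2| ≤ y} := by ring

/-- One more step of a symmetric walk does not destroy the mass of `[-y, y]`, provided that `y` is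
not below the smallest possible size of a step. -/
theorem walkLaw_Icc_le_succ {ν : Measure ℤ} [IsProbabilityMeasure ν]
    (hν : ν.map (fun x => -x) = ν) {y₀ y : ℕ} (hy : y₀ ≤ y) (n : ℕ) :
    ν {x | |x| ≤ y₀} * walkLaw ν n {x | |x| ≤ y} ≤ 2 * walkLaw ν (n + 1) {x | |x| ≤ y} := by
  have hsym := map_neg_walkLaw hν n
  have hhalf : walkLaw ν n {x | |x| ≤ y} ≤ 2 * walkLaw ν n {x | 0 ≤ x ∧ x ≤ y} := by
    have h := measure_neg_eq hsym {x | 0 ≤ x ∧ x ≤ y}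
    rw [two_mul]
    nth_rw 2 [← h]
    refine (measure_mono fun x hx => ?_).trans (measure_union_le _ _)
    simp only [Set.mem_ofPred_eq, Set.mem_union, abs_le] at hx ⊢
    omega
  have hneg := measure_neg_eq hsym {x | 0 ≤ x ∧ x ≤ y}
  have hstep : ν {x | |x| ≤ y₀} * walkLaw ν n {x | 0 ≤ x ∧ x ≤ y}
      ≤ walkLaw ν (n + 1) {x | |x| ≤ y} := by
    rw [walkLaw_succ, conv_int_apply, mul_comm]
    rw [← setLIntegral_const]
    refine (setLIntegral_mono' MeasurableSet.of_discrete fun z hz => ?_).trans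
      (setLIntegral_le_lintegral _ _)
    simp only [Set.mem_ofPred_eq, abs_le] at hz
    rcases le_total 0 z with h | h
    · rw [← hneg]
      refine measure_mono fun x hx => ?_
      simp only [Set.mem_ofPred_eq, abs_le] at hx ⊢
      omega
    · refine measure_mono fun x hx => ?_
      simp only [Set.mem_ofPred_eq, abs_le] at hx ⊢
      omega
  calc ν {x | |x| ≤ y₀} * walkLaw ν n {x | |x| ≤ y}
      ≤ ν {x | |x| ≤ y₀} * (2 * walkLaw ν n {x | 0 ≤ x ∧ x ≤ y}) := by gcongr
    _ = 2 * (ν {x | |x| ≤ y₀} * walkLaw ν n {x | 0 ≤ x ∧ x ≤ y}) := by ring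
    _ ≤ _ := by gcongr

/-- Intervals of the same length, at a later time and with an arbitrary centre, carry at most a
constant times the mass of `[-y, y]` under a symmetric walk. -/
theorem exists_walkLaw_shift_le {ν : Measure ℤ} [IsProbabilityMeasure ν]
    (hν : ν.map (fun x => -x) = ν) {y₀ : ℕ} (hy₀ : ν {x | |x| ≤ y₀} ≠ 0) :
    ∃ C : ℝ≥0∞, C ≠ ∞ ∧ ∀ y ≥ y₀, ∀ m n, m ≤ n → ∀ v : ℤ,
      walkLaw ν n {x | |x + v| ≤ y} ≤ C * walkLaw ν m {x | |x| ≤ y} := by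
  set c := ν {x | |x| ≤ y₀} with hc
  have hc1 : c ≤ 1 := prob_le_one
  have hctop : c ≠ ∞ := (hc1.trans_lt ENNReal.one_lt_top).ne
  -- The law at time `l + l` is a convolution square, and the remaining `j` steps only average the
  -- centre of the interval. An odd time `m` is reduced to `m - 1` by `walkLaw_Icc_le_succ`.
  have heven : ∀ (y l j : ℕ) (v : ℤ),
      walkLaw ν (l + l + j) {x | |x + v| ≤ y} ≤ 3 * walkLaw ν (l + l) {x | |x| ≤ y} := by
    intro y l j v
    rw [walkLaw_add ν (l + l) j, conv_int_apply]
    calc ∫⁻ z, walkLaw ν (l + l) {x | x + z ∈ {x | |x + v| ≤ y}} ∂(walkLaw ν j)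
        ≤ ∫⁻ _, 3 * walkLaw ν (l + l) {x | |x| ≤ y} ∂(walkLaw ν j) := by
          refine lintegral_mono fun z => ?_
          simp only [Set.mem_ofPred_eq, add_assoc]
          rw [walkLaw_add]
          exact conv_self_shift_le (map_neg_walkLaw hν l) (z + v) y
      _ = _ := by simp
  refine ⟨3 * (2 / c), ENNReal.mul_ne_top (by simp) (ENNReal.div_ne_top (by simp) hy₀), ?_⟩
  intro y hy m n hmn v
  have h2c : 1 ≤ 2 / c := by
    rw [ENNReal.le_div_iff_mul_le (Or.inl hy₀) (Or.inl hctop), one_mul]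
    exact hc1.trans (by norm_num)
  obtain ⟨j, rfl⟩ := Nat.exists_eq_add_of_le hmn
  rcases Nat.even_or_odd' m with ⟨l, rfl | rfl⟩
  · rw [two_mul]
    refine (heven y l j v).trans ?_
    gcongr
    exact le_mul_of_one_le_right (by simp) h2c
  · have h1 : walkLaw ν (2 * l) {x | |x| ≤ y} ≤ 2 / c * walkLaw ν (2 * l + 1) {x | |x| ≤ y} := by
      have := walkLaw_Icc_le_succ hν hy (2 * l)
      rw [ENNReal.div_eq_inv_mul, mul_assoc, ← ENNReal.mul_le_iff_le_inv hy₀ hctop]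
      exact this
    have h2 := heven y l (1 + j) v
    rw [← two_mul, ← add_assoc] at h2
    calc _ ≤ _ := h2
      _ ≤ 3 * (2 / c * walkLaw ν (2 * l + 1) {x | |x| ≤ y}) := by gcongr
      _ = _ := by ring

/-- If the weights `w` are decreasing up to a constant, then the weighted Green function of a walk
is, up to the same constant, largest at the origin. -/
theorem tsum_walkLaw_mul_le (ν : Measure ℤ) [IsProbabilityMeasure ν] (w : ℕ → ℝ≥0∞) (C : ℝ≥0∞)
    (hw : ∀ m n, m ≤ n → w n ≤ C * w m) (x : ℤ) :
    ∑' n, walkLaw ν n {x} * w n ≤ C * ∑' n, walkLaw ν n {0} * w n := by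
  set M := C * ∑' n, walkLaw ν n {0} * w n with hM
  -- Induction along the first steps until the walk, run backwards from `x`, visits the origin; the
  -- shift `j` counts these steps.
  have key : ∀ N j : ℕ, ∀ x : ℤ, ∑ n ∈ Finset.range N, walkLaw ν n {x} * w (n + j) ≤ M := by
    intro N
    induction N with
    | zero => intro j x; simp
    | succ N ih =>
      intro j x
      rcases eq_or_ne x 0 with rfl | hx
      · rw [hM, ← ENNReal.tsum_mul_left]
        refine (Finset.sum_le_sum fun n _ => ?_).trans (ENNReal.sum_le_tsum _)
        calc walkLaw ν n {0} * w (n + j) ≤ walkLaw ν n {0} * (C * w n) := by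
              gcongr; exact hw _ _ (by omega)
          _ = _ := by ring
      · rw [Finset.sum_range_succ']
        have h0 : walkLaw ν 0 {x} = 0 := by
          rw [walkLaw_zero, Measure.dirac_apply' _ MeasurableSet.of_discrete]
          simp [hx.symm]
        rw [h0, zero_mul, add_zero]
        have hstep : ∀ n, walkLaw ν (n + 1) {x} = ∫⁻ z, walkLaw ν n {x - z} ∂ν := by
          intro n
          rw [walkLaw_succ, conv_int_apply]
          refine lintegral_congr fun z => ?_
          congr 1
          ext u
          simp only [Set.mem_singleton_iff, Set.mem_ofPred_eq]
          omega
        simp_rw [hstep]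
        calc ∑ n ∈ Finset.range N, (∫⁻ z, walkLaw ν n {x - z} ∂ν) * w (n + 1 + j)
            = ∫⁻ z, ∑ n ∈ Finset.range N, walkLaw ν n {x - z} * w (n + (1 + j)) ∂ν := by
              rw [lintegral_finsetSum _ (fun _ _ => Measurable.of_discrete)]
              refine Finset.sum_congr rfl fun n _ => ?_
              rw [lintegral_mul_const _ Measurable.of_discrete, add_assoc]
          _ ≤ ∫⁻ _, M ∂ν := lintegral_mono fun z => ih (1 + j) (x - z)
          _ = M := by simp
  rw [ENNReal.tsum_eq_iSup_nat]
  exact iSup_le fun N => by simpa using key N 0 x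

/-- The smallest size of a step: almost every step is at least as large, so that a window of this
size is charged by the step law and is not larger than any window spanned by a step. -/
theorem exists_minimal_step (ν : Measure ℤ) [IsProbabilityMeasure ν] :
    ∃ y₀ : ℕ, ν {x | |x| ≤ y₀} ≠ 0 ∧ ∀ᵐ z ∂ν, (y₀ : ℤ) ≤ |z| := by
  classical
  have hex : ∃ y : ℕ, ν {x | |x| ≤ y} ≠ 0 := by
    by_contra! h
    have h1 : ν (⋃ y : ℕ, {x | |x| ≤ (y : ℤ)}) = 0 := measure_iUnion_null h
    have h2 : (⋃ y : ℕ, {x : ℤ | |x| ≤ (y : ℤ)}) = Set.univ := by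
      refine Set.eq_univ_of_forall fun x => Set.mem_iUnion.2 ⟨x.natAbs, ?_⟩
      simp
    rw [h2] at h1
    simp at h1
  refine ⟨Nat.find hex, Nat.find_spec hex, ?_⟩
  rcases Nat.eq_zero_or_pos (Nat.find hex) with h0 | hpos
  · rw [h0]; simp
  · have hmin := Nat.find_min hex (Nat.sub_lt hpos one_pos)
    rw [not_not] at hmin
    rw [ae_iff]
    refine measure_mono_null (fun x hx => ?_) hmin
    simp only [Set.mem_ofPred_eq, not_le] at hx ⊢
    omega

/-! ### The position compared with an independent step -/

/-- The probability that the position at time `n` of the walk with step law `ν` is not larger, in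
absolute value, than an independent step. -/
noncomputable def overlap (ν : Measure ℤ) (n : ℕ) : ℝ≥0∞ :=
  ((walkLaw ν n).prod ν) {p | |p.1| ≤ |p.2|}

theorem overlap_shift_eq_lintegral (ν : Measure ℤ) [IsProbabilityMeasure ν] (n : ℕ) (v : ℤ) :
    ((walkLaw ν n).prod ν) {p | |p.1 + v| ≤ |p.2|} =
      ∫⁻ z, walkLaw ν n {x | |x + v| ≤ (z.natAbs : ℤ)} ∂ν := by
  rw [Measure.prod_apply_symm MeasurableSet.of_discrete]
  refine lintegral_congr fun z => ?_
  rw [Int.natCast_natAbs]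
  rfl

theorem overlap_eq_lintegral (ν : Measure ℤ) [IsProbabilityMeasure ν] (n : ℕ) :
    overlap ν n = ∫⁻ z, walkLaw ν n {x | |x| ≤ (z.natAbs : ℤ)} ∂ν := by
  have h := overlap_shift_eq_lintegral ν n 0
  simp only [add_zero] at h
  exact h

/-- Up to a constant, the probability that the walk started at `v` is overlapped by a step at
time `n` is at most the one for the walk started at the origin, at any earlier time. -/
theorem exists_overlap_shift_le {ν : Measure ℤ} [IsProbabilityMeasure ν]
    (hν : ν.map (fun x => -x) = ν) :
    ∃ C : ℝ≥0∞, C ≠ ∞ ∧ ∀ m n, m ≤ n → ∀ v : ℤ,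
      ((walkLaw ν n).prod ν) {p | |p.1 + v| ≤ |p.2|} ≤ C * overlap ν m := by
  obtain ⟨y₀, hy₀, hae⟩ := exists_minimal_step ν
  obtain ⟨C, hC, h⟩ := exists_walkLaw_shift_le hν hy₀
  refine ⟨C, hC, fun m n hmn v => ?_⟩
  rw [overlap_shift_eq_lintegral, overlap_eq_lintegral,
    ← lintegral_const_mul _ Measurable.of_discrete]
  refine lintegral_mono_ae ?_
  filter_upwards [hae] with z hz
  exact h _ (by rw [← Int.natCast_natAbs] at hz; exact_mod_cast hz) m n hmn v

/-- Together with `exists_overlap_shift_le`: overlaps at consecutive times are comparable. -/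
theorem exists_overlap_le_succ {ν : Measure ℤ} [IsProbabilityMeasure ν]
    (hν : ν.map (fun x => -x) = ν) :
    ∃ C : ℝ≥0∞, C ≠ ∞ ∧ ∀ n, overlap ν n ≤ C * overlap ν (n + 1) := by
  obtain ⟨y₀, hy₀, hae⟩ := exists_minimal_step ν
  have htop : ν {x | |x| ≤ (y₀ : ℤ)} ≠ ∞ := measure_ne_top _ _
  refine ⟨(ν {x | |x| ≤ (y₀ : ℤ)})⁻¹ * 2,
    ENNReal.mul_ne_top (ENNReal.inv_ne_top.2 hy₀) (by simp), fun n => ?_⟩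
  rw [overlap_eq_lintegral, overlap_eq_lintegral, ← lintegral_const_mul _ Measurable.of_discrete]
  refine lintegral_mono_ae ?_
  filter_upwards [hae] with z hz
  rw [mul_assoc, ← ENNReal.mul_le_iff_le_inv hy₀ htop]
  exact walkLaw_Icc_le_succ hν (by rw [← Int.natCast_natAbs] at hz; exact_mod_cast hz) n

theorem prod_measure_neg_left {μ ν : Measure ℤ} [IsProbabilityMeasure μ] [IsProbabilityMeasure ν]
    (hμ : μ.map (fun x => -x) = μ) (A : Set (ℤ × ℤ)) :
    (μ.prod ν) {p | (-p.1, p.2) ∈ A} = (μ.prod ν) A := by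
  rw [Measure.prod_apply_symm MeasurableSet.of_discrete,
    Measure.prod_apply_symm MeasurableSet.of_discrete]
  exact lintegral_congr fun z => measure_neg_eq hμ ((fun x => (x, z)) ⁻¹' A)

theorem prod_measure_neg_right {μ ν : Measure ℤ} [IsProbabilityMeasure μ] [IsProbabilityMeasure ν]
    (hν : ν.map (fun x => -x) = ν) (A : Set (ℤ × ℤ)) :
    (μ.prod ν) {p | (p.1, -p.2) ∈ A} = (μ.prod ν) A := by
  rw [Measure.prod_apply MeasurableSet.of_discrete, Measure.prod_apply MeasurableSet.of_discrete]
  exact lintegral_congr fun z => measure_neg_eq hν (Prod.mk z ⁻¹' A)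

/-- The four reflections of the cone `0 ≤ x ≤ z` cover the set `|x| ≤ |z|`. -/
theorem overlap_le_four_mul {ν : Measure ℤ} [IsProbabilityMeasure ν]
    (hν : ν.map (fun x => -x) = ν) (n : ℕ) :
    overlap ν n ≤ 4 * ((walkLaw ν n).prod ν) {p | 0 ≤ p.1 ∧ p.1 ≤ p.2} := by
  have hs := map_neg_walkLaw hν n
  set A : Set (ℤ × ℤ) := {p | 0 ≤ p.1 ∧ p.1 ≤ p.2} with hA
  have h1 := prod_measure_neg_left (ν := ν) hs A
  have h2 := prod_measure_neg_right (μ := walkLaw ν n) hν A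
  have h3 := prod_measure_neg_right (μ := walkLaw ν n) hν {p | (-p.1, p.2) ∈ A}
  rw [h1] at h3
  calc overlap ν n ≤ ((walkLaw ν n).prod ν) ((A ∪ {p | (-p.1, p.2) ∈ A}) ∪
        ({p | (p.1, -p.2) ∈ A} ∪ {p | (p.1, -p.2) ∈ {p : ℤ × ℤ | (-p.1, p.2) ∈ A}})) := by
        refine measure_mono fun p hp => ?_
        simp only [hA, Set.mem_union, Set.mem_ofPred_eq] at hp ⊢
        rcases abs_cases p.1 with h | h <;> rcases abs_cases p.2 with h' | h' <;> omega
    _ ≤ _ := (measure_union_le _ _).trans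
        (add_le_add (measure_union_le _ _) (measure_union_le _ _))
    _ = _ := by rw [h1, h2, h3]; ring

theorem prod_cone_le_overlap (ν : Measure ℤ) (n : ℕ) :
    ((walkLaw ν n).prod ν) {p | 0 ≤ p.1 ∧ p.1 ≤ p.2} ≤ overlap ν n := by
  refine measure_mono fun p hp => ?_
  simp only [Set.mem_ofPred_eq] at hp ⊢
  rw [abs_of_nonneg hp.1, abs_of_nonneg (hp.1.trans hp.2)]
  exact hp.2

theorem abs_le_abs_of_mul_add_nonpos {x z : ℤ} (h : x * (x + z) ≤ 0) : |x| ≤ |z| := by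
  rw [← sq_le_sq]
  nlinarith [sq_nonneg (x + z)]

theorem prod_crossing_le_overlap (ν : Measure ℤ) (n : ℕ) :
    ((walkLaw ν n).prod ν) {p | p.1 * (p.1 + p.2) ≤ 0} ≤ overlap ν n :=
  measure_mono fun _ hp => abs_le_abs_of_mul_add_nonpos hp

theorem prod_cone_le_crossing {ν : Measure ℤ} [IsProbabilityMeasure ν]
    (hν : ν.map (fun x => -x) = ν) (n : ℕ) :
    ((walkLaw ν n).prod ν) {p | 0 ≤ p.1 ∧ p.1 ≤ p.2} ≤
      ((walkLaw ν n).prod ν) {p | p.1 * (p.1 + p.2) ≤ 0} := by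
  rw [← prod_measure_neg_right hν {p : ℤ × ℤ | 0 ≤ p.1 ∧ p.1 ≤ p.2}]
  refine measure_mono fun p hp => ?_
  simp only [Set.mem_ofPred_eq] at hp ⊢
  exact mul_nonpos_of_nonneg_of_nonpos hp.1 (by omega)

/-! ### Joint laws of a random walk -/

section Walk

variable {Ω : Type*} [MeasurableSpace Ω] {μ : Measure Ω} {S : ℕ → Ω → ℤ}

/-- The law of the jump of the walk `S`. -/
noncomputable def jumpLaw (S : ℕ → Ω → ℤ) (μ : Measure Ω) : Measure ℤ :=
  μ.map fun ω => S 1 ω - S 0 ω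

theorem IsRandomWalk.measurable_increment (hS : IsRandomWalk S μ) (m n : ℕ) :
    Measurable fun ω => S n ω - S m ω := (hS.measurable n).sub (hS.measurable m)

theorem IsRandomWalk.measurable_jump (hS : IsRandomWalk S μ) (n : ℕ) :
    Measurable fun ω => S (n + 1) ω - S n ω := hS.measurable_increment n (n + 1)

theorem HasSymmetricJumps.map_neg_jumpLaw (hS : IsRandomWalk S μ) (h : HasSymmetricJumps S μ) :
    (jumpLaw S μ).map (fun x => -x) = jumpLaw S μ := by
  rw [jumpLaw, Measure.map_map Measurable.of_discrete (hS.measurable_jump 0)]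
  exact h.map_eq.symm

theorem IsRandomWalk.map_jump (hS : IsRandomWalk S μ) (n : ℕ) :
    μ.map (fun ω => S (n + 1) ω - S n ω) = jumpLaw S μ := (hS.identDistrib n).map_eq

/-- The position and jump at time `m` are independent of the increments that follow; this is the
form needed for two positions and the jumps at these times. -/
theorem IsRandomWalk.indepFun_increments (hS : IsRandomWalk S μ) (m n : ℕ) (hmn : m + 1 ≤ n) :
    IndepFun (fun ω => (S m ω - S 0 ω, S (m + 1) ω - S m ω))
      (fun ω => (S n ω - S (m + 1) ω, S (n + 1) ω - S n ω)) μ := by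
  have h := hS.indep.indepFun_finset (Finset.range (m + 1)) (Finset.Ico (m + 1) (n + 1))
    (by
      rw [Finset.disjoint_left]
      intro a ha hb
      simp at ha hb
      omega) hS.measurable_jump
  have hmeas : ∀ (I : Finset ℕ) (k : ℕ) (hk : k ∈ I), Measurable fun f : I → ℤ =>
      ((∑ i : I, if (i : ℕ) < k then f i else 0), f ⟨k, hk⟩) := by
    intro I k hk
    refine Measurable.prodMk (Finset.measurable_sum _ fun i _ => ?_) (measurable_pi_apply _)
    split_ifs
    exacts [measurable_pi_apply i, measurable_const]
  have h2 := h.comp (hmeas _ m (Finset.self_mem_range_succ m))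
    (hmeas _ n (Finset.mem_Ico.2 ⟨hmn, n.lt_succ_self⟩))
  convert h2 using 1
  · ext ω
    · simp only [Function.comp]
      rw [Finset.sum_coe_sort (Finset.range (m + 1)) fun i =>
        if i < m then S (i + 1) ω - S i ω else 0, Finset.sum_range_succ, if_neg (lt_irrefl m),
        add_zero, Finset.sum_congr rfl (fun i hi => if_pos (Finset.mem_range.1 hi)),
        Finset.sum_range_sub fun i => S i ω]
    · rfl
  · ext ω
    · simp only [Function.comp]
      rw [Finset.sum_coe_sort (Finset.Ico (m + 1) (n + 1)) fun i =>
        if i < n then S (i + 1) ω - S i ω else 0, Finset.sum_Ico_succ_top hmn,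
        if_neg (lt_irrefl n),
        add_zero, Finset.sum_congr rfl (fun i hi => if_pos (Finset.mem_Ico.1 hi).2),
        Finset.sum_Ico_eq_sub _ hmn, Finset.sum_range_sub fun i => S i ω,
        Finset.sum_range_sub fun i => S i ω]
      ring
    · rfl

theorem IsRandomWalk.indepFun_past_jump (hS : IsRandomWalk S μ) (m n : ℕ) (hmn : m ≤ n) :
    IndepFun (fun ω => S n ω - S m ω) (fun ω => S (n + 1) ω - S n ω) μ := by
  have h := hS.indep.indepFun_finset (Finset.Ico m n) {n} (by simp) hS.measurable_jump
  have hlast : Measurable fun f : ({n} : Finset ℕ) → ℤ => f ⟨n, Finset.mem_singleton_self n⟩ :=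
    measurable_pi_apply _
  have h2 := h.comp (φ := fun f : Finset.Ico m n → ℤ => ∑ i, f i)
    (Finset.measurable_sum _ fun i _ => measurable_pi_apply i) hlast
  convert h2 using 1
  · ext ω
    simp only [Function.comp]
    rw [Finset.sum_coe_sort (Finset.Ico m n) fun i => S (i + 1) ω - S i ω,
      Finset.sum_Ico_eq_sub _ hmn, Finset.sum_range_sub fun i => S i ω,
      Finset.sum_range_sub fun i => S i ω]
    ring
  · rfl

variable [IsProbabilityMeasure μ]

theorem IsRandomWalk.isProbabilityMeasure_jumpLaw (hS : IsRandomWalk S μ) :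
    IsProbabilityMeasure (jumpLaw S μ) :=
  Measure.isProbabilityMeasure_map (hS.measurable_jump 0).aemeasurable

theorem IsRandomWalk.map_increment (hS : IsRandomWalk S μ) (m n : ℕ) :
    μ.map (fun ω => S (m + n) ω - S m ω) = walkLaw (jumpLaw S μ) n := by
  induction n with
  | zero => simp [walkLaw_zero, Measure.map_const]
  | succ n ih =>
    rw [walkLaw_succ, ← ih, ← hS.map_jump (m + n), ← (hS.indepFun_past_jump m (m + n)
      (by omega)).map_add_eq_map_conv_map (hS.measurable_increment _ _)
      (hS.measurable_jump _)]
    congr 1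
    ext ω
    simp only [Pi.add_apply, add_assoc]
    ring

theorem IsRandomWalk.map_increment_jump (hS : IsRandomWalk S μ) (m n : ℕ) :
    μ.map (fun ω => (S (m + n) ω - S m ω, S (m + n + 1) ω - S (m + n) ω)) =
      (walkLaw (jumpLaw S μ) n).prod (jumpLaw S μ) := by
  rw [(indepFun_iff_map_prod_eq_prod_map_map (hS.measurable_increment _ _).aemeasurable
    (hS.measurable_jump _).aemeasurable).1 (hS.indepFun_past_jump m (m + n) (by omega)),
    hS.map_increment, hS.map_jump]

theorem IsRandomWalk.measure_preimage (hS : IsRandomWalk S μ) (n : ℕ) (A : Set ℤ) :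
    μ {ω | S n ω ∈ A} = walkLaw (jumpLaw S μ) n A := by
  have h := hS.map_increment 0 n
  rw [← h, Measure.map_apply (hS.measurable_increment _ _) MeasurableSet.of_discrete]
  refine measure_congr ?_
  filter_upwards [hS.start] with ω hω
  refine propext ?_
  change S n ω ∈ A ↔ S (0 + n) ω - S 0 ω ∈ A
  rw [hω, zero_add, sub_zero]

theorem IsRandomWalk.measure_preimage_jump (hS : IsRandomWalk S μ) (n : ℕ) (A : Set (ℤ × ℤ)) :
    μ {ω | (S n ω, S (n + 1) ω - S n ω) ∈ A} =
      ((walkLaw (jumpLaw S μ) n).prod (jumpLaw S μ)) A := by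
  have h := hS.map_increment_jump 0 n
  rw [← h, Measure.map_apply ((hS.measurable_increment _ _).prodMk
    (hS.measurable_increment _ _)) MeasurableSet.of_discrete]
  refine measure_congr ?_
  filter_upwards [hS.start] with ω hω
  refine propext ?_
  change (S n ω, S (n + 1) ω - S n ω) ∈ A ↔
    (S (0 + n) ω - S 0 ω, S (0 + n + 1) ω - S (0 + n) ω) ∈ A
  rw [hω, zero_add, sub_zero]

/-- A bound for the joint occurrence of an event at the position and jump at time `m`, and of one
at the position and jump at a later time `n`: if the second has probability at most `K` for every
starting point, then the probability is at most `K` times that of the first event. -/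
theorem IsRandomWalk.measure_two_times_le (hS : IsRandomWalk S μ) (m n : ℕ) (hmn : m + 1 ≤ n)
    (A B : Set (ℤ × ℤ)) (K : ℝ≥0∞)
    (hK : ∀ v : ℤ, ((walkLaw (jumpLaw S μ) (n - (m + 1))).prod (jumpLaw S μ))
      {p | (p.1 + v, p.2) ∈ B} ≤ K) :
    μ {ω | (S m ω, S (m + 1) ω - S m ω) ∈ A ∧ (S n ω, S (n + 1) ω - S n ω) ∈ B} ≤
      K * μ {ω | (S m ω, S (m + 1) ω - S m ω) ∈ A} := by
  have hprob := hS.isProbabilityMeasure_jumpLaw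
  have hi := hS.indepFun_increments m n hmn
  have hm1 : Measurable fun ω => (S m ω - S 0 ω, S (m + 1) ω - S m ω) :=
    (hS.measurable_increment _ _).prodMk (hS.measurable_jump m)
  have hm2 : Measurable fun ω => (S n ω - S (m + 1) ω, S (n + 1) ω - S n ω) :=
    (hS.measurable_increment _ _).prodMk (hS.measurable_jump n)
  have hl1 := hS.map_increment_jump 0 m
  have hl2 := hS.map_increment_jump (m + 1) (n - (m + 1))
  rw [zero_add] at hl1
  rw [Nat.add_sub_cancel' hmn] at hl2
  have hlaw := (indepFun_iff_map_prod_eq_prod_map_map hm1.aemeasurable hm2.aemeasurable).1 hi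
  rw [hl1, hl2] at hlaw
  set D : Set ((ℤ × ℤ) × (ℤ × ℤ)) :=
    {q | q.1 ∈ A ∧ (q.2.1 + (q.1.1 + q.1.2), q.2.2) ∈ B} with hD
  have h1 : μ {ω | (S m ω, S (m + 1) ω - S m ω) ∈ A ∧ (S n ω, S (n + 1) ω - S n ω) ∈ B}
      = (((walkLaw (jumpLaw S μ) m).prod (jumpLaw S μ)).prod
        ((walkLaw (jumpLaw S μ) (n - (m + 1))).prod (jumpLaw S μ))) D := by
    rw [← hlaw, Measure.map_apply (hm1.prodMk hm2) MeasurableSet.of_discrete]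
    refine measure_congr ?_
    filter_upwards [hS.start] with ω hω
    refine propext ?_
    change _ ↔ ((S m ω - S 0 ω, S (m + 1) ω - S m ω) ∈ A ∧ ((S n ω - S (m + 1) ω) +
      ((S m ω - S 0 ω) + (S (m + 1) ω - S m ω)), S (n + 1) ω - S n ω) ∈ B)
    have h3 : S n ω - S (m + 1) ω + (S m ω - S 0 ω + (S (m + 1) ω - S m ω)) = S n ω := by
      rw [hω]; ring
    rw [h3, hω, sub_zero]
    rfl
  rw [h1, hS.measure_preimage_jump, Measure.prod_apply MeasurableSet.of_discrete,
    ← setLIntegral_const, ← lintegral_indicator MeasurableSet.of_discrete]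
  refine lintegral_mono fun p => ?_
  by_cases hp : p ∈ A
  · rw [Set.indicator_of_mem hp]
    refine le_trans (measure_mono fun q hq => ?_) (hK (p.1 + p.2))
    exact hq.2
  · rw [Set.indicator_of_notMem hp]
    refine le_of_eq (measure_mono_null (fun q hq => ?_) (measure_empty (μ :=
      (walkLaw (jumpLaw S μ) (n - (m + 1))).prod (jumpLaw S μ))))
    exact hp hq.1

theorem IsRandomWalk.measure_two_returns (hS : IsRandomWalk S μ) (m n : ℕ) :
    μ {ω | S m ω = 0 ∧ S (m + n) ω = 0} =
      walkLaw (jumpLaw S μ) m {0} * walkLaw (jumpLaw S μ) n {0} := by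
  have hi : IndepFun (fun ω => S m ω - S 0 ω) (fun ω => S (m + n) ω - S m ω) μ := by
    have h := hS.indep.indepFun_finset (Finset.range m) (Finset.Ico m (m + n))
      (by
        rw [Finset.disjoint_left]
        intro a ha hb
        simp at ha hb
        omega) hS.measurable_jump
    have h2 := h.comp
      (φ := fun f : (i : Finset.range m) → ℤ => ∑ i, f i)
      (ψ := fun f : (i : Finset.Ico m (m + n)) → ℤ => ∑ i, f i)
      (Finset.measurable_sum _ fun i _ => measurable_pi_apply i)
      (Finset.measurable_sum _ fun i _ => measurable_pi_apply i)
    convert h2 using 1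
    · ext ω
      simp only [Function.comp]
      rw [Finset.sum_coe_sort (Finset.range m) fun i => S (i + 1) ω - S i ω,
        Finset.sum_range_sub fun i => S i ω]
    · ext ω
      simp only [Function.comp]
      rw [Finset.sum_coe_sort (Finset.Ico m (m + n)) fun i => S (i + 1) ω - S i ω,
        Finset.sum_Ico_eq_sub _ (by omega), Finset.sum_range_sub fun i => S i ω,
        Finset.sum_range_sub fun i => S i ω]
      ring
  have h1 := hi.measure_inter_preimage_eq_mul {0} {0} MeasurableSet.of_discrete
    MeasurableSet.of_discrete
  have hl1 := hS.map_increment 0 m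
  rw [zero_add] at hl1
  rw [← hS.map_increment m n, ← hl1, Measure.map_apply (hS.measurable_increment _ _)
    MeasurableSet.of_discrete, Measure.map_apply (hS.measurable_increment _ _)
    MeasurableSet.of_discrete, ← h1]
  refine measure_congr ?_
  filter_upwards [hS.start] with ω hω
  refine propext ?_
  change (S m ω = 0 ∧ S (m + n) ω = 0) ↔ (S m ω - S 0 ω = 0 ∧ S (m + n) ω - S m ω = 0)
  rw [hω]
  constructor <;> intro h <;> omega

end Walk

/-! ### Events that occur infinitely often -/

/-- A Kochen–Stone lemma: if the events `E n` satisfy the renewal-type bound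
`P(E m ∩ E n) ≤ K P(E m) P(E (n - m - 1))` for `m < n` and their probabilities have an infinite
sum, then infinitely many of them occur with positive probability. -/
theorem measure_frequently_ne_zero_of_renewal {Ω : Type*} [MeasurableSpace Ω] {μ : Measure Ω}
    [IsProbabilityMeasure μ] {E : ℕ → Set Ω} (hE : ∀ n, MeasurableSet (E n)) {K : ℝ≥0∞}
    (hK : K ≠ ∞)
    (hren : ∀ m n, m < n → μ (E m ∩ E n) ≤ K * (μ (E m) * μ (E (n - (m + 1)))))
    (hsum : ∑' n, μ (E n) = ∞) : μ {ω | ∃ᶠ n in atTop, ω ∈ E n} ≠ 0 := by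
  set k := K.toReal with hk
  have hk0 : 0 ≤ k := ENNReal.toReal_nonneg
  set e : ℕ → ℝ := fun n => μ.real (E n) with he
  have he0 : ∀ n, 0 ≤ e n := fun n => measureReal_nonneg
  have hren' : ∀ m n, m < n → μ.real (E m ∩ E n) ≤ k * (e m * e (n - (m + 1))) := by
    intro m n hmn
    have := ENNReal.toReal_mono (by finiteness) (hren m n hmn)
    simpa [ENNReal.toReal_mul, hk, he, Measure.real] using this
  set s : ℕ → ℝ := fun N => ∑ n ∈ Finset.range N, e n with hs
  have hsN : Tendsto s atTop atTop := by
    rw [hs, ← not_summable_iff_tendsto_nat_atTop_of_nonneg he0]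
    intro hsm
    apply hsm.tsum_ofReal_ne_top
    rw [← hsum]
    exact tsum_congr fun n => ofReal_measureReal
  set F : ℕ → Set Ω := fun M => ⋃ n ≥ M, E n with hF
  have hFm : ∀ M, MeasurableSet (F M) := fun M =>
    MeasurableSet.iUnion fun n => MeasurableSet.iUnion fun _ => hE n
  have hlow : ∀ M, (1 + 4 * k)⁻¹ ≤ μ.real (F M) := by
    intro M
    -- A window `[M, N)` long enough for its total mass to dominate the mass of `[0, M)`.
    obtain ⟨N, hN1, hN2⟩ : ∃ N, M ≤ N ∧ 2 * s M + 1 ≤ s N :=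
      ((eventually_ge_atTop M).and (hsN.eventually_ge_atTop _)).exists
    set T := ∑ n ∈ Finset.Ico M N, e n with hT
    have hTs : T = s N - s M := Finset.sum_Ico_eq_sub _ hN1
    have hsM : 0 ≤ s M := Finset.sum_nonneg fun n _ => he0 n
    have hT1 : 1 ≤ T := by linarith
    have hsT : s N ≤ 2 * T := by linarith
    set X : Ω → ℝ := fun ω => ∑ n ∈ Finset.Ico M N, (E n).indicator (fun _ => (1 : ℝ)) ω with hX
    have hint : ∀ A : Set Ω, MeasurableSet A → Integrable (A.indicator fun _ => (1 : ℝ)) μ :=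
      fun A hA => (integrable_const _).indicator hA
    have hintX : Integrable X μ := integrable_finsetSum _ fun n _ => hint _ (hE n)
    have hEX : ∫ ω, X ω ∂μ = T := by
      rw [hX, integral_finsetSum _ fun n _ => hint _ (hE n)]
      exact Finset.sum_congr rfl fun n _ => integral_indicator_one (hE n)
    have hX2 : ∀ ω, X ω ^ 2 = ∑ i ∈ Finset.Ico M N, ∑ j ∈ Finset.Ico M N,
        (E i ∩ E j).indicator (fun _ => (1 : ℝ)) ω := by
      intro ω
      rw [hX, sq, Finset.sum_mul_sum]
      refine Finset.sum_congr rfl fun i _ => Finset.sum_congr rfl fun j _ => ?_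
      by_cases hi : ω ∈ E i <;> by_cases hj : ω ∈ E j <;> simp [hi, hj]
    have hintX2 : Integrable (fun ω => X ω ^ 2) μ := by
      rw [funext hX2]
      exact integrable_finsetSum _ fun i _ => integrable_finsetSum _ fun j _ =>
        hint _ ((hE i).inter (hE j))
    have hEX2 : ∫ ω, X ω ^ 2 ∂μ = ∑ i ∈ Finset.Ico M N, ∑ j ∈ Finset.Ico M N,
        μ.real (E i ∩ E j) := by
      rw [funext hX2]
      rw [integral_finsetSum _ fun i _ => integrable_finsetSum _ fun j _ =>
        hint _ ((hE i).inter (hE j))]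
      refine Finset.sum_congr rfl fun i _ => ?_
      rw [integral_finsetSum _ fun j _ => hint _ ((hE i).inter (hE j))]
      exact Finset.sum_congr rfl fun j _ => integral_indicator_one ((hE i).inter (hE j))
    have hpart : ∀ i, ∑ j ∈ Finset.Ico (i + 1) N, e (j - (i + 1)) ≤ s N := by
      intro i
      rw [Finset.sum_Ico_eq_sum_range]
      simp only [Nat.add_sub_cancel_left]
      exact Finset.sum_le_sum_of_subset_of_nonneg (Finset.range_mono (by omega))
        fun n _ _ => he0 n
    have hupper : ∑ i ∈ Finset.Ico M N, ∑ j ∈ Finset.Ico M N, (if i < j then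
        μ.real (E i ∩ E j) else 0) ≤ T * (k * s N) := by
      rw [hT, Finset.sum_mul]
      refine Finset.sum_le_sum fun i hi => ?_
      calc ∑ j ∈ Finset.Ico M N, (if i < j then μ.real (E i ∩ E j) else 0)
          = ∑ j ∈ (Finset.Ico M N).filter (i < ·), μ.real (E i ∩ E j) :=
            (Finset.sum_filter _ _).symm
        _ ≤ ∑ j ∈ Finset.Ico (i + 1) N, μ.real (E i ∩ E j) :=
            Finset.sum_le_sum_of_subset_of_nonneg (fun j hj => by
              simp at hj ⊢; omega) fun _ _ _ => measureReal_nonneg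
        _ ≤ ∑ j ∈ Finset.Ico (i + 1) N, k * (e i * e (j - (i + 1))) :=
            Finset.sum_le_sum fun j hj => hren' i j (by simp at hj; omega)
        _ = e i * (k * ∑ j ∈ Finset.Ico (i + 1) N, e (j - (i + 1))) := by
            rw [Finset.mul_sum, Finset.mul_sum]
            exact Finset.sum_congr rfl fun j _ => by ring
        _ ≤ e i * (k * s N) := by
            have := he0 i
            gcongr
            exact hpart i
    have hEX2le : ∫ ω, X ω ^ 2 ∂μ ≤ T ^ 2 * (1 + 4 * k) := by
      rw [hEX2]
      have hsplit : ∀ i j, μ.real (E i ∩ E j) = (if i = j then e i else 0) +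
          (if i < j then μ.real (E i ∩ E j) else 0) +
          (if j < i then μ.real (E j ∩ E i) else 0) := by
        intro i j
        rcases lt_trichotomy i j with h | h | h
        · simp [h, h.ne, h.not_gt]
        · simp [h, he]
        · simp [h, h.ne', h.not_gt, Set.inter_comm]
      rw [Finset.sum_congr rfl fun i _ => Finset.sum_congr rfl fun j _ => hsplit i j]
      simp only [Finset.sum_add_distrib]
      rw [Finset.sum_comm (f := fun i j => if j < i then μ.real (E j ∩ E i) else 0)]
      have hdiag : ∑ i ∈ Finset.Ico M N, ∑ j ∈ Finset.Ico M N, (if i = j then e i else 0) = T := by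
        refine Finset.sum_congr rfl fun i hi => ?_
        rw [Finset.sum_ite_eq, if_pos hi]
      rw [hdiag]
      have h1 : T * (k * s N) ≤ T * (k * (2 * T)) := by gcongr
      nlinarith
    set c := T * (1 + 4 * k) with hc
    have hcpos : 0 < c := by positivity
    -- The Cauchy–Schwarz inequality for `X = X 1_F`, in the form `2 X 1_F ≤ X ^ 2 / c + c 1_F`,
    -- where `c = T (1 + 4 k)` makes the expectation of the first summand at most `T`.
    have hpt : ∀ ω, 2 * X ω ≤ X ω ^ 2 / c + c * (F M).indicator (fun _ => (1 : ℝ)) ω := by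
      intro ω
      by_cases hω : ω ∈ F M
      · rw [Set.indicator_of_mem hω, mul_one]
        have := two_mul_le_add_sq (X ω) c
        have h2 : X ω ^ 2 / c + c = (X ω ^ 2 + c ^ 2) / c := by field_simp
        rw [h2, le_div_iff₀ hcpos]
        exact this
      · have : X ω = 0 := by
          refine Finset.sum_eq_zero fun n hn => Set.indicator_of_notMem (fun h => hω ?_) _
          exact Set.mem_biUnion (Finset.mem_Ico.1 hn).1 h
        rw [Set.indicator_of_notMem hω, this]
        simp
    have hfin := integral_mono (hintX.const_mul 2)
      ((hintX2.div_const c).add ((hint _ (hFm M)).const_mul c)) hpt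
    simp only [Pi.add_apply] at hfin
    rw [integral_add (hintX2.div_const c) ((hint _ (hFm M)).const_mul c), integral_const_mul,
      integral_const_mul, integral_div, hEX,
      show ∫ ω, (F M).indicator (fun _ => (1 : ℝ)) ω ∂μ = μ.real (F M) from
        integral_indicator_one (hFm M)] at hfin
    have h3 : (∫ ω, X ω ^ 2 ∂μ) / c ≤ T := by
      rw [div_le_iff₀ hcpos, hc]
      nlinarith
    have h4 : T ≤ c * μ.real (F M) := by linarith
    rw [inv_le_iff_one_le_mul₀ (by positivity)]
    rw [hc] at h4
    have hTpos : 0 < T := by linarith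
    nlinarith
  have hset : {ω | ∃ᶠ n in atTop, ω ∈ E n} = ⋂ M, F M := by
    ext ω
    simp [hF, frequently_atTop]
  rw [hset]
  have hanti : Antitone F := fun a b hab =>
    Set.biUnion_mono (fun n hn => le_trans hab hn) fun _ _ => le_rfl
  have hlim := tendsto_measure_iInter_atTop (μ := μ) (fun M => (hFm M).nullMeasurableSet) hanti
    ⟨0, measure_ne_top _ _⟩
  have hpos : 0 < ENNReal.ofReal (1 + 4 * k)⁻¹ := by
    rw [ENNReal.ofReal_pos]; positivity
  refine (hpos.trans_le (ge_of_tendsto' hlim fun M => ?_)).ne'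
  exact (ENNReal.ofReal_le_iff_le_toReal (measure_ne_top _ _)).2 (hlow M)

/-- An abstract zero-one law of Hewitt–Savage type: an event which is invariant under
measure-preserving maps that, for every event of a generating algebra, can be chosen to make this
event independent of itself, has probability zero or one. -/
theorem measure_eq_zero_or_one_of_invariant {Ω ι : Type*} [m : MeasurableSpace Ω] {μ : Measure Ω}
    [IsProbabilityMeasure μ] {𝒜 : Set (Set Ω)} (h𝒜 : IsSetAlgebra 𝒜)
    (hgen : m = MeasurableSpace.generateFrom 𝒜) {σ : ι → Ω → Ω}
    (hσ : ∀ i, MeasurePreserving (σ i) μ μ)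
    (hind : ∀ B ∈ 𝒜, ∃ i, μ (B ∩ σ i ⁻¹' B) = μ B * μ B)
    {A : Set Ω} (hA : MeasurableSet A) (hinv : ∀ i, σ i ⁻¹' A = A) : μ A = 0 ∨ μ A = 1 := by
  have hdense := Measure.MeasureDense.of_generateFrom_isSetAlgebra_finite (μ := μ) h𝒜 hgen
  have hkey : ∀ ε : ℝ, 0 < ε → |μ.real A - μ.real A ^ 2| ≤ 4 * ε := by
    intro ε hε
    obtain ⟨B, hB, hAB⟩ := hdense.approx A hA (measure_ne_top _ _) ε hε
    have hBm := hdense.measurable B hB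
    have hAB' : μ.real (symmDiff A B) ≤ ε := by
      rw [Measure.real]
      exact ENNReal.toReal_le_of_le_ofReal hε.le hAB.le
    obtain ⟨i, hi⟩ := hind B hB
    set B' := σ i ⁻¹' B with hB'
    have hB'm : MeasurableSet B' := (hσ i).measurable hBm
    have hAB2 : μ.real (symmDiff A B') ≤ ε := by
      have : symmDiff A B' = σ i ⁻¹' (symmDiff A B) := by
        conv_lhs => rw [← hinv i]
        rfl
      rw [this, Measure.real, (hσ i).measure_preimage (hA.symmDiff hBm).nullMeasurableSet]
      exact hAB'
    have hi' : μ.real (B ∩ B') = μ.real B * μ.real B := by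
      rw [Measure.real, hi, ENNReal.toReal_mul]; rfl
    have h1 : |μ.real A - μ.real B| ≤ ε :=
      (abs_measureReal_sub_le_measureReal_symmDiff hA.nullMeasurableSet
        hBm.nullMeasurableSet).trans hAB'
    have h2 : |μ.real A - μ.real (B ∩ B')| ≤ 2 * ε := by
      refine (abs_measureReal_sub_le_measureReal_symmDiff hA.nullMeasurableSet
        (hBm.inter hB'm).nullMeasurableSet).trans ?_
      have : symmDiff A (B ∩ B') ⊆ symmDiff A B ∪ symmDiff A B' := by
        intro x
        simp only [Set.mem_symmDiff, Set.mem_union, Set.mem_inter_iff]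
        tauto
      calc μ.real (symmDiff A (B ∩ B')) ≤ μ.real (symmDiff A B ∪ symmDiff A B') :=
            measureReal_mono this
        _ ≤ μ.real (symmDiff A B) + μ.real (symmDiff A B') := measureReal_union_le _ _
        _ ≤ 2 * ε := by linarith
    have ha0 : 0 ≤ μ.real A := measureReal_nonneg
    have ha1 : μ.real A ≤ 1 := measureReal_le_one
    have hb0 : 0 ≤ μ.real B := measureReal_nonneg
    have hb1 : μ.real B ≤ 1 := measureReal_le_one
    rw [hi'] at h2
    rw [abs_le] at h1 h2 ⊢
    constructor <;> nlinarith
  have hzero : μ.real A - μ.real A ^ 2 = 0 := by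
    by_contra hne
    have hpos := abs_pos.2 hne
    have := hkey (|μ.real A - μ.real A ^ 2| / 8) (by positivity)
    linarith
  have hprod : μ.real A * (1 - μ.real A) = 0 := by linarith
  rcases mul_eq_zero.1 hprod with h | h
  · left
    exact (measureReal_eq_zero_iff).1 h
  · right
    have : μ.real A = 1 := by linarith
    rw [Measure.real] at this
    exact (ENNReal.toReal_eq_one_iff _).1 this

/-- Pairing two independent sequences, each of them consisting of independent variables, gives a
sequence of independent pairs. -/
theorem iIndepFun_prodMk_of_indepFun {Ω : Type*} [MeasurableSpace Ω] {μ : Measure Ω}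
    [IsProbabilityMeasure μ] {X Y : ℕ → Ω → ℤ}
    (hX : iIndepFun X μ) (hY : iIndepFun Y μ)
    (hXY : IndepFun (fun ω n => X n ω) (fun ω n => Y n ω) μ)
    (hXm : ∀ n, Measurable (X n)) (hYm : ∀ n, Measurable (Y n)) :
    iIndepFun (fun n ω => (X n ω, Y n ω)) μ := by
  refine iIndepSets.iIndep (fun n => ((hXm n).prodMk (hYm n)).comap_le)
    (fun n => {A | ∃ R ∈ Set.image2 (· ×ˢ ·) {s : Set ℤ | MeasurableSet s}
      {t : Set ℤ | MeasurableSet t}, (fun ω => (X n ω, Y n ω)) ⁻¹' R = A})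
    (fun n => isPiSystem_prod.comap _) (fun n => ?_) ?_
  · rw [← generateFrom_prod, MeasurableSpace.comap_generateFrom]
    rfl
  · rw [iIndepSets_iff]
    intro S f hf
    choose! R hR using hf
    have hR' : ∀ i ∈ S, ∃ s t : Set ℤ, f i = X i ⁻¹' s ∩ Y i ⁻¹' t := by
      intro i hi
      obtain ⟨⟨s, -, t, -, hst⟩, h2⟩ := hR i hi
      refine ⟨s, t, ?_⟩
      rw [← h2, ← hst]
      rfl
    choose! s t hst using hR'
    have hXs := hX.measure_inter_preimage_eq_mul S (sets := s) fun i _ => MeasurableSet.of_discrete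
    have hYt := hY.measure_inter_preimage_eq_mul S (sets := t) fun i _ => MeasurableSet.of_discrete
    have h1 := hXY.measure_inter_preimage_eq_mul
      (⋂ i ∈ S, (fun x : ℕ → ℤ => x i) ⁻¹' s i) (⋂ i ∈ S, (fun x : ℕ → ℤ => x i) ⁻¹' t i)
      (Finset.measurableSet_biInter _ fun i _ => measurable_pi_apply i MeasurableSet.of_discrete)
      (Finset.measurableSet_biInter _ fun i _ => measurable_pi_apply i MeasurableSet.of_discrete)
    have e1 : (fun ω n => X n ω) ⁻¹' (⋂ i ∈ S, (fun x : ℕ → ℤ => x i) ⁻¹' s i)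
        = ⋂ i ∈ S, X i ⁻¹' s i := by
      simp only [Set.preimage_iInter]; rfl
    have e2 : (fun ω n => Y n ω) ⁻¹' (⋂ i ∈ S, (fun x : ℕ → ℤ => x i) ⁻¹' t i)
        = ⋂ i ∈ S, Y i ⁻¹' t i := by
      simp only [Set.preimage_iInter]; rfl
    rw [e1, e2, hXs, hYt] at h1
    have h2 : ⋂ i ∈ S, f i = (⋂ i ∈ S, X i ⁻¹' s i) ∩ ⋂ i ∈ S, Y i ⁻¹' t i := by
      ext ω
      simp only [Set.mem_iInter, Set.mem_inter_iff]
      constructor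
      · intro h
        exact ⟨fun i hi => (hst i hi ▸ h i hi).1, fun i hi => (hst i hi ▸ h i hi).2⟩
      · intro h i hi
        rw [hst i hi]
        exact ⟨h.1 i hi, h.2 i hi⟩
    rw [h2, h1, ← Finset.prod_mul_distrib]
    refine Finset.prod_congr rfl fun i hi => ?_
    rw [hst i hi]
    have := hXY.comp (measurable_pi_apply (X := fun _ : ℕ => ℤ) i)
      (measurable_pi_apply (X := fun _ : ℕ => ℤ) i)
    exact (this.measure_inter_preimage_eq_mul _ _ MeasurableSet.of_discrete
      MeasurableSet.of_discrete).symm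

/-- The permutation of `ℕ` that exchanges the blocks `[0, N)` and `[N, 2 N)`. -/
def blockSwap (N : ℕ) : Equiv.Perm ℕ where
  toFun i := if i < N then i + N else if i < 2 * N then i - N else i
  invFun i := if i < N then i + N else if i < 2 * N then i - N else i
  left_inv i := by dsimp only; split_ifs <;> omega
  right_inv i := by dsimp only; split_ifs <;> omega

theorem blockSwap_apply (N i : ℕ) :
    blockSwap N i = if i < N then i + N else if i < 2 * N then i - N else i := rfl

/-- The Hewitt–Savage zero-one law for a sequence of independent, identically distributed
variables. It is enough that the event is invariant under the exchange of the first two blocks of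
any given length. -/
theorem infinitePi_eq_zero_or_one_of_blockSwap {α : Type*} [MeasurableSpace α]
    (ν : Measure α) [IsProbabilityMeasure ν] {A : Set (ℕ → α)} (hA : MeasurableSet A)
    (hinv : ∀ N x, (fun i => x (blockSwap N i)) ∈ A ↔ x ∈ A) :
    Measure.infinitePi (fun _ : ℕ => ν) A = 0 ∨ Measure.infinitePi (fun _ : ℕ => ν) A = 1 := by
  have hσ : ∀ N, MeasurePreserving (fun (x : ℕ → α) i => x (blockSwap N i))
      (Measure.infinitePi fun _ : ℕ => ν) (Measure.infinitePi fun _ : ℕ => ν) := fun N =>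
    ⟨measurable_pi_lambda _ fun i => measurable_pi_apply _,
      Measure.map_infinitePi_infinitePi_of_inj (P := fun _ : ℕ => ν) (blockSwap N).injective⟩
  refine measure_eq_zero_or_one_of_invariant (𝒜 := measurableCylinders fun _ : ℕ => α)
    isSetAlgebra_measurableCylinders generateFrom_measurableCylinders.symm hσ ?_ hA
    (fun N => Set.ext fun x => hinv N x)
  intro B hB
  obtain ⟨s, S, hS, rfl⟩ := (mem_measurableCylinders B).1 hB
  obtain ⟨N, hN⟩ : ∃ N, ∀ i ∈ s, i < N := ⟨s.sup id + 1, fun i hi =>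
    Nat.lt_succ_of_le (Finset.le_sup (f := id) hi)⟩
  refine ⟨N, ?_⟩
  have hind : iIndepFun (fun (i : ℕ) (x : ℕ → α) => x i) (Measure.infinitePi fun _ : ℕ => ν) :=
    iIndepFun_infinitePi (P := fun _ : ℕ => ν) (X := fun _ x => x) fun _ => measurable_id
  have hdisj : Disjoint s (s.map (blockSwap N).toEmbedding) := by
    rw [Finset.disjoint_left]
    intro i hi hi'
    obtain ⟨j, hj, hji⟩ := Finset.mem_map.1 hi'
    have h1 := hN i hi
    have h2 := hN j hj
    simp only [Equiv.coe_toEmbedding, blockSwap_apply, if_pos h2] at hji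
    omega
  have h2 := hind.indepFun_finset _ _ hdisj fun i => measurable_pi_apply i
  have hmeas : Measurable fun (g : (s.map (blockSwap N).toEmbedding) → α) (i : s) =>
      g ⟨blockSwap N i, Finset.mem_map_of_mem _ i.2⟩ :=
    measurable_pi_lambda _ fun i => measurable_pi_apply _
  have h3 := h2.comp measurable_id hmeas
  have h4 := h3.measure_inter_preimage_eq_mul S S hS hS
  have hpre : (fun (x : ℕ → α) i => x (blockSwap N i)) ⁻¹' (cylinder s S) =
      ((fun (g : (s.map (blockSwap N).toEmbedding) → α) (i : s) =>
      g ⟨blockSwap N i, Finset.mem_map_of_mem _ i.2⟩) ∘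
        fun (x : ℕ → α) (i : s.map (blockSwap N).toEmbedding) => x i) ⁻¹' S := rfl
  have hB' := (hσ N).measure_preimage (MeasurableSet.cylinder s hS).nullMeasurableSet
  rw [hpre] at hB' ⊢
  calc _ = _ := h4
    _ = _ := by rw [hB']; rfl

/-! ### The zero-one criterion -/

theorem setOf_frequently_atTop_eq {Ω : Type*} (p : ℕ → Ω → Prop) :
    {ω | ∃ᶠ n in atTop, p n ω} = ⋂ M, ⋃ n ≥ M, {ω | p n ω} := by
  ext ω
  simp [frequently_atTop]

section Pair

variable {Ω : Type*} [MeasurableSpace Ω] {μ : Measure Ω} {H V : ℕ → Ω → ℤ}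

/-- The event that the walk `H` vanishes at time `n + 1` while the position of `V` at time `n` and
its next jump form an element of `B`. -/
def returnEvent (H V : ℕ → Ω → ℤ) (B : Set (ℤ × ℤ)) (n : ℕ) : Set Ω :=
  {ω | H (n + 1) ω = 0 ∧ (V n ω, V (n + 1) ω - V n ω) ∈ B}

theorem measurableSet_returnEvent (hH : IsRandomWalk H μ) (hV : IsRandomWalk V μ)
    (B : Set (ℤ × ℤ)) (n : ℕ) : MeasurableSet (returnEvent H V B n) :=
  (hH.measurable (n + 1) (MeasurableSet.of_discrete (s := {0}))).inter
    ((hV.measurable n).prodMk (hV.measurable_jump n) (MeasurableSet.of_discrete (s := B)))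

variable [IsProbabilityMeasure μ]

/-- The zero-one law for the recurrence of an event which involves the position of a pair of
independent walks and its next position. -/
theorem measure_frequently_eq_zero_or_one (hH : IsRandomWalk H μ) (hV : IsRandomWalk V μ)
    (hindep : IndepFun (fun ω n => H n ω) (fun ω n => V n ω) μ) (B : Set ((ℤ × ℤ) × (ℤ × ℤ))) :
    μ {ω | ∃ᶠ n in atTop, ((H n ω, V n ω), (H (n + 1) ω, V (n + 1) ω)) ∈ B} = 0 ∨
      μ {ω | ∃ᶠ n in atTop, ((H n ω, V n ω), (H (n + 1) ω, V (n + 1) ω)) ∈ B} = 1 := by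
  set Z : ℕ → Ω → ℤ × ℤ := fun n ω => (H (n + 1) ω - H n ω, V (n + 1) ω - V n ω) with hZ
  have hZm : ∀ n, Measurable (Z n) := fun n => (hH.measurable_jump n).prodMk (hV.measurable_jump n)
  have hdiff : Measurable fun (x : ℕ → ℤ) (n : ℕ) => x (n + 1) - x n :=
    measurable_pi_lambda _ fun n => (measurable_pi_apply _).sub (measurable_pi_apply _)
  have hZi : iIndepFun Z μ := iIndepFun_prodMk_of_indepFun hH.indep hV.indep
    (hindep.comp hdiff hdiff) hH.measurable_jump hV.measurable_jump
  set ν := μ.map (Z 0) with hν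
  have : IsProbabilityMeasure ν := Measure.isProbabilityMeasure_map (hZm 0).aemeasurable
  have hlaw1 : ∀ n, μ.map (Z n) = (jumpLaw H μ).prod (jumpLaw V μ) := by
    intro n
    have h1 := (hindep.comp hdiff hdiff).comp (measurable_pi_apply (X := fun _ : ℕ => ℤ) n)
      (measurable_pi_apply (X := fun _ : ℕ => ℤ) n)
    have h2 := (indepFun_iff_map_prod_eq_prod_map_map (hH.measurable_jump n).aemeasurable
      (hV.measurable_jump n).aemeasurable).1 h1
    rw [hH.map_jump, hV.map_jump] at h2
    exact h2
  have hlaw : μ.map (fun ω n => Z n ω) = Measure.infinitePi fun _ : ℕ => ν := by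
    rw [hZi.map_fun_eq_infinitePi_map hZm]
    congr 1
    ext1 n
    rw [hν, hlaw1, hlaw1]
  set T : ℕ → (ℕ → ℤ × ℤ) → ℤ × ℤ := fun n z => ∑ i ∈ Finset.range n, z i with hT
  have hTm : ∀ n, Measurable (T n) := fun n =>
    Finset.measurable_sum _ fun i _ => measurable_pi_apply i
  set A : Set (ℕ → ℤ × ℤ) := {z | ∃ᶠ n in atTop, (T n z, T (n + 1) z) ∈ B} with hA
  have hAm : MeasurableSet A := by
    rw [hA, setOf_frequently_atTop_eq]
    exact MeasurableSet.iInter fun M => MeasurableSet.iUnion fun n => MeasurableSet.iUnion fun _ =>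
      ((hTm n).prodMk (hTm (n + 1))) MeasurableSet.of_discrete
  have hAinv : ∀ N z, (fun i => z (blockSwap N i)) ∈ A ↔ z ∈ A := by
    intro N z
    -- The exchange of two blocks of jumps does not change the positions after these blocks.
    have hsum : ∀ n ≥ 2 * N, T n (fun i => z (blockSwap N i)) = T n z := by
      intro n hn
      refine Equiv.Perm.sum_comp (blockSwap N) _ z fun i hi => ?_
      simp only [Finset.coe_range, Set.mem_Iio]
      by_contra hlt
      apply hi
      rw [blockSwap_apply, if_neg (by omega), if_neg (by omega)]
    refine frequently_congr ?_
    filter_upwards [eventually_ge_atTop (2 * N)] with n hn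
    rw [hsum n hn, hsum (n + 1) (by omega)]
  have hmain := infinitePi_eq_zero_or_one_of_blockSwap ν hAm hAinv
  rw [← hlaw, Measure.map_apply (measurable_pi_lambda _ hZm) hAm] at hmain
  have heq : μ {ω | ∃ᶠ n in atTop, ((H n ω, V n ω), (H (n + 1) ω, V (n + 1) ω)) ∈ B} =
      μ ((fun ω n => Z n ω) ⁻¹' A) := by
    refine measure_congr ?_
    filter_upwards [hH.start, hV.start] with ω hω1 hω2
    refine propext ?_
    have hpos : ∀ n, T n (fun n => Z n ω) = (H n ω, V n ω) := by
      intro n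
      simp only [hT, hZ, Prod.ext_iff, Prod.fst_sum, Prod.snd_sum]
      rw [Finset.sum_range_sub fun i => H i ω, Finset.sum_range_sub fun i => V i ω, hω1, hω2]
      simp
    change (∃ᶠ n in atTop, _) ↔ ∃ᶠ n in atTop, (T n (fun n => Z n ω), T (n + 1) fun n => Z n ω) ∈ B
    simp_rw [hpos]
  rw [heq]
  exact hmain

theorem measure_returnEvent (hH : IsRandomWalk H μ) (hV : IsRandomWalk V μ)
    (hindep : IndepFun (fun ω n => H n ω) (fun ω n => V n ω) μ) (B : Set (ℤ × ℤ)) (n : ℕ) :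
    μ (returnEvent H V B n) = walkLaw (jumpLaw H μ) (n + 1) {0} *
      ((walkLaw (jumpLaw V μ) n).prod (jumpLaw V μ)) B := by
  have h := hindep.measure_inter_preimage_eq_mul {x : ℕ → ℤ | x (n + 1) ∈ ({0} : Set ℤ)}
    {x : ℕ → ℤ | (x n, x (n + 1) - x n) ∈ B}
    (measurable_pi_apply (X := fun _ : ℕ => ℤ) (n + 1) MeasurableSet.of_discrete)
    (((measurable_pi_apply (X := fun _ : ℕ => ℤ) n).prodMk
      ((measurable_pi_apply (X := fun _ : ℕ => ℤ) (n + 1)).sub (measurable_pi_apply n)))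
      MeasurableSet.of_discrete)
  rw [← hH.measure_preimage, ← hV.measure_preimage_jump]
  exact h

/-- If a set `B` of positions and jumps of `V` is hit from every starting point with a probability
comparable to the one for the origin, then infinitely many of the events `returnEvent H V B n`
occur with positive probability as soon as their probabilities have an infinite sum. -/
theorem measure_frequently_returnEvent_ne_zero (hH : IsRandomWalk H μ) (hV : IsRandomWalk V μ)
    (hindep : IndepFun (fun ω n => H n ω) (fun ω n => V n ω) μ) {B : Set (ℤ × ℤ)} {K : ℝ≥0∞}
    (hK : K ≠ ∞)
    (hB : ∀ (j : ℕ) (v : ℤ), ((walkLaw (jumpLaw V μ) j).prod (jumpLaw V μ))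
      {p | (p.1 + v, p.2) ∈ B} ≤ K * ((walkLaw (jumpLaw V μ) j).prod (jumpLaw V μ)) B)
    (hsum : ∑' n, μ (returnEvent H V B n) = ∞) :
    μ {ω | ∃ᶠ n in atTop, ω ∈ returnEvent H V B n} ≠ 0 := by
  refine measure_frequently_ne_zero_of_renewal (measurableSet_returnEvent hH hV B) hK ?_ hsum
  intro m n hmn
  have h := hindep.measure_inter_preimage_eq_mul
    {x : ℕ → ℤ | (x (m + 1), x (n + 1)) ∈ ({(0, 0)} : Set (ℤ × ℤ))}
    {x : ℕ → ℤ | ((x m, x (m + 1) - x m), (x n, x (n + 1) - x n)) ∈ B ×ˢ B}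
    (((measurable_pi_apply (X := fun _ : ℕ => ℤ) (m + 1)).prodMk
      (measurable_pi_apply (X := fun _ : ℕ => ℤ) (n + 1))) MeasurableSet.of_discrete)
    ((((measurable_pi_apply (X := fun _ : ℕ => ℤ) m).prodMk
      ((measurable_pi_apply (X := fun _ : ℕ => ℤ) (m + 1)).sub (measurable_pi_apply m))).prodMk
      ((measurable_pi_apply (X := fun _ : ℕ => ℤ) n).prodMk
      ((measurable_pi_apply (X := fun _ : ℕ => ℤ) (n + 1)).sub (measurable_pi_apply n))))
      MeasurableSet.of_discrete)
  have hV2 := hV.measure_two_times_le m n hmn B B _ fun v => hB (n - (m + 1)) v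
  have hH2 := hH.measure_two_returns (m + 1) (n - m)
  rw [show m + 1 + (n - m) = n + 1 by omega] at hH2
  have hidx : n - m = n - (m + 1) + 1 := by omega
  rw [hV.measure_preimage_jump] at hV2
  calc μ (returnEvent H V B m ∩ returnEvent H V B n)
      = μ {ω | H (m + 1) ω = 0 ∧ H (n + 1) ω = 0} *
        μ {ω | (V m ω, V (m + 1) ω - V m ω) ∈ B ∧ (V n ω, V (n + 1) ω - V n ω) ∈ B} := by
        have e1 : {ω | H (m + 1) ω = 0 ∧ H (n + 1) ω = 0} = (fun ω n => H n ω) ⁻¹'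
            {x : ℕ → ℤ | (x (m + 1), x (n + 1)) ∈ ({(0, 0)} : Set (ℤ × ℤ))} := by
          ext ω; simp
        rw [e1]
        refine Eq.trans ?_ h
        congr 1
        rw [← e1]
        ext ω
        simp only [returnEvent, Set.mem_inter_iff, Set.mem_ofPred_eq, Set.mem_preimage,
          Set.mem_prod]
        tauto
    _ ≤ _ := by
        rw [hH2, measure_returnEvent hH hV hindep, measure_returnEvent hH hV hindep, ← hidx]
        refine (mul_le_mul_right hV2 _).trans (le_of_eq ?_)
        ring

theorem tsum_cone_eq (hH : IsRandomWalk H μ) (hV : IsRandomWalk V μ) :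
    ∑' n : ℕ, μ {ω | H (n + 1) ω = 0} * μ {ω | 0 ≤ V n ω ∧ V n ω ≤ V (n + 1) ω - V n ω} =
      ∑' n : ℕ, walkLaw (jumpLaw H μ) (n + 1) {0} *
        ((walkLaw (jumpLaw V μ) n).prod (jumpLaw V μ)) {p | 0 ≤ p.1 ∧ p.1 ≤ p.2} := by
  refine tsum_congr fun n => ?_
  rw [← hH.measure_preimage, ← hV.measure_preimage_jump]
  rfl

theorem ENNReal.tsum_eq_top_of_le_mul {f g : ℕ → ℝ≥0∞} {C : ℝ≥0∞} (hC : C ≠ ∞)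
    (h : ∀ n, f n ≤ C * g n) (hf : ∑' n, f n = ∞) : ∑' n, g n = ∞ := by
  by_contra hg
  have h1 := ENNReal.tsum_le_tsum h
  rw [hf, ENNReal.tsum_mul_left, top_le_iff] at h1
  exact ENNReal.mul_ne_top hC hg h1

/-- The zero-one criterion: Borel–Cantelli in one direction, and the Kochen–Stone lemma together
with the zero-one law in the other. -/
theorem measure_frequently_crossing_eq_one_iff (hH : IsRandomWalk H μ) (hV : IsRandomWalk V μ)
    (hVsymm : HasSymmetricJumps V μ)
    (hindep : IndepFun (fun ω n => H n ω) (fun ω n => V n ω) μ) :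
    μ {ω | ∃ᶠ n in atTop, H (n + 1) ω = 0 ∧ V n ω * V (n + 1) ω ≤ 0} = 1 ↔
      ∑' n : ℕ, μ {ω | H (n + 1) ω = 0} *
        μ {ω | 0 ≤ V n ω ∧ V n ω ≤ V (n + 1) ω - V n ω} = ∞ := by
  have hprob := hV.isProbabilityMeasure_jumpLaw
  have hs := hVsymm.map_neg_jumpLaw hV
  rw [tsum_cone_eq hH hV]
  set B : Set (ℤ × ℤ) := {p | p.1 * (p.1 + p.2) ≤ 0} with hB
  have hset : {ω | ∃ᶠ n in atTop, H (n + 1) ω = 0 ∧ V n ω * V (n + 1) ω ≤ 0} =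
      {ω | ∃ᶠ n in atTop, ω ∈ returnEvent H V B n} := by
    ext ω
    simp only [returnEvent, hB, Set.mem_ofPred_eq, add_sub_cancel]
  constructor
  · intro h1
    by_contra hfin
    have h0 : μ {ω | ∃ᶠ n in atTop, ω ∈ returnEvent H V B n} = 0 := by
      refine measure_setOfPred_frequently_eq_zero fun htop => hfin ?_
      refine ENNReal.tsum_eq_top_of_le_mul (C := 4) (by simp) (fun n => ?_) htop
      calc μ {ω | ω ∈ returnEvent H V B n} = _ := measure_returnEvent hH hV hindep B n
        _ ≤ walkLaw (jumpLaw H μ) (n + 1) {0} * (4 *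
            ((walkLaw (jumpLaw V μ) n).prod (jumpLaw V μ)) {p | 0 ≤ p.1 ∧ p.1 ≤ p.2}) := by
          gcongr
          exact (prod_crossing_le_overlap _ n).trans (overlap_le_four_mul hs n)
        _ = _ := by ring
    rw [hset, h0] at h1
    exact zero_ne_one h1
  · intro hdiv
    obtain ⟨C, hC, hshift⟩ := exists_overlap_shift_le hs
    have hne : μ {ω | ∃ᶠ n in atTop, ω ∈ returnEvent H V B n} ≠ 0 := by
      refine measure_frequently_returnEvent_ne_zero hH hV hindep (K := C * 4)
        (ENNReal.mul_ne_top hC (by simp)) (fun j v => ?_) ?_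
      · calc ((walkLaw (jumpLaw V μ) j).prod (jumpLaw V μ)) {p | (p.1 + v, p.2) ∈ B}
            ≤ ((walkLaw (jumpLaw V μ) j).prod (jumpLaw V μ)) {p | |p.1 + v| ≤ |p.2|} :=
              measure_mono fun p hp => abs_le_abs_of_mul_add_nonpos hp
          _ ≤ C * overlap (jumpLaw V μ) j := hshift j j le_rfl v
          _ ≤ C * (4 * ((walkLaw (jumpLaw V μ) j).prod (jumpLaw V μ)) B) := by
              gcongr
              exact (overlap_le_four_mul hs j).trans
                (mul_le_mul_right (prod_cone_le_crossing hs j) _)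
          _ = _ := by ring
      · rw [← top_le_iff, ← hdiv]
        refine ENNReal.tsum_le_tsum fun n => ?_
        rw [measure_returnEvent hH hV hindep]
        exact mul_le_mul_right (prod_cone_le_crossing hs n) _
    rw [hset]
    refine (measure_frequently_eq_zero_or_one hH hV hindep
      {q | q.2.1 = 0 ∧ (q.1.2, q.2.2 - q.1.2) ∈ B}).resolve_left hne

/-- The probability of the cone at time `n` is comparable to the overlap at time `n` and hence to
the one at time `n + 1`, the time at which `H` returns. -/
theorem tsum_cone_eq_top_iff (hH : IsRandomWalk H μ) (hV : IsRandomWalk V μ)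
    (hVsymm : HasSymmetricJumps V μ) :
    ∑' n : ℕ, μ {ω | H (n + 1) ω = 0} * μ {ω | 0 ≤ V n ω ∧ V n ω ≤ V (n + 1) ω - V n ω} = ∞ ↔
      ∑' n : ℕ, walkLaw (jumpLaw H μ) n {0} * overlap (jumpLaw V μ) n = ∞ := by
  have hprob := hV.isProbabilityMeasure_jumpLaw
  have hprobH := hH.isProbabilityMeasure_jumpLaw
  have hs := hVsymm.map_neg_jumpLaw hV
  have hshift : ∑' n : ℕ, walkLaw (jumpLaw H μ) n {0} * overlap (jumpLaw V μ) n = ∞ ↔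
      ∑' n : ℕ, walkLaw (jumpLaw H μ) (n + 1) {0} * overlap (jumpLaw V μ) (n + 1) = ∞ := by
    have hfin : walkLaw (jumpLaw H μ) 0 {0} * overlap (jumpLaw V μ) 0 ≠ ∞ :=
      ENNReal.mul_ne_top (measure_ne_top _ _) (measure_ne_top _ _)
    rw [tsum_eq_zero_add' ENNReal.summable, ENNReal.add_eq_top]
    exact or_iff_right hfin
  rw [tsum_cone_eq hH hV, hshift]
  constructor
  · obtain ⟨C, hC, h⟩ := exists_overlap_le_succ hs
    refine ENNReal.tsum_eq_top_of_le_mul hC fun n => ?_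
    calc _ ≤ walkLaw (jumpLaw H μ) (n + 1) {0} * (C * overlap (jumpLaw V μ) (n + 1)) := by
          gcongr
          exact (prod_cone_le_overlap _ n).trans (h n)
      _ = _ := by ring
  · obtain ⟨C, hC, h⟩ := exists_overlap_shift_le hs
    refine ENNReal.tsum_eq_top_of_le_mul (C := C * 4) (ENNReal.mul_ne_top hC (by simp)) fun n => ?_
    have h1 : overlap (jumpLaw V μ) (n + 1) ≤ C * overlap (jumpLaw V μ) n := by
      have := h n (n + 1) n.le_succ 0
      simp only [add_zero] at this
      exact this
    calc _ ≤ walkLaw (jumpLaw H μ) (n + 1) {0} * (C * (4 *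
          ((walkLaw (jumpLaw V μ) n).prod (jumpLaw V μ)) {p | 0 ≤ p.1 ∧ p.1 ≤ p.2})) := by
          gcongr
          refine h1.trans ?_
          gcongr
          exact overlap_le_four_mul hs n
      _ = _ := by ring

/-- If the pair of walks is transient, then the expected number of times at which `H` vanishes and
`V` lies in `[-y₀, y₀]` is finite, for any window that is charged by the law of the jumps of `V`.
Otherwise, infinitely many such visits would have positive probability. -/
theorem tsum_walkLaw_mul_window_ne_top (hH : IsRandomWalk H μ) (hV : IsRandomWalk V μ)
    (hVsymm : HasSymmetricJumps V μ)
    (hindep : IndepFun (fun ω n => H n ω) (fun ω n => V n ω) μ) (htr : IsTransientPair H V μ)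
    {y₀ : ℕ} (hy₀ : jumpLaw V μ {x | |x| ≤ y₀} ≠ 0) :
    ∑' n, walkLaw (jumpLaw H μ) n {0} * walkLaw (jumpLaw V μ) n {x | |x| ≤ y₀} ≠ ∞ := by
  have hprob := hV.isProbabilityMeasure_jumpLaw
  have hprobH := hH.isProbabilityMeasure_jumpLaw
  have hs := hVsymm.map_neg_jumpLaw hV
  have hfin : walkLaw (jumpLaw H μ) 0 {0} * walkLaw (jumpLaw V μ) 0 {x | |x| ≤ y₀} ≠ ∞ :=
    ENNReal.mul_ne_top (measure_ne_top _ _) (measure_ne_top _ _)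
  rw [tsum_eq_zero_add' ENNReal.summable]
  refine ENNReal.add_ne_top.2 ⟨hfin, fun htop => ?_⟩
  obtain ⟨C, hC, hshift⟩ := exists_walkLaw_shift_le hs hy₀
  have hlaw : ∀ (j : ℕ) (v : ℤ), ((walkLaw (jumpLaw V μ) j).prod (jumpLaw V μ))
      {p | |p.1 + v + p.2| ≤ y₀} = walkLaw (jumpLaw V μ) (j + 1) {x | |x + v| ≤ y₀} := by
    intro j v
    rw [walkLaw_succ, conv_int_apply, Measure.prod_apply_symm MeasurableSet.of_discrete]
    refine lintegral_congr fun z => ?_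
    congr 1
    ext x
    simp only [Set.mem_preimage, Set.mem_ofPred_eq]
    rw [add_right_comm]
  have hlaw0 : ∀ j : ℕ, ((walkLaw (jumpLaw V μ) j).prod (jumpLaw V μ))
      {p | |p.1 + p.2| ≤ y₀} = walkLaw (jumpLaw V μ) (j + 1) {x | |x| ≤ y₀} := by
    intro j
    simpa only [add_zero] using hlaw j 0
  have hne := measure_frequently_returnEvent_ne_zero hH hV hindep (B := {p | |p.1 + p.2| ≤ y₀})
    hC (fun j v => by
      change ((walkLaw (jumpLaw V μ) j).prod (jumpLaw V μ)) {p | |p.1 + v + p.2| ≤ y₀} ≤ _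
      rw [hlaw, hlaw0]
      exact hshift y₀ le_rfl (j + 1) (j + 1) le_rfl v) (by
      rw [← htop]
      refine tsum_congr fun n => ?_
      rw [measure_returnEvent hH hV hindep, hlaw0])
  refine hne (measure_mono_null ?_ htr)
  intro ω hω hlim
  have hlim' := (tendsto_add_atTop_iff_nat 1 (f := fun n => ‖((H n ω, V n ω) : ℤ × ℤ)‖)).2 hlim
  obtain ⟨n, hn1, hn2⟩ := (hω.and_eventually (hlim'.eventually_gt_atTop (y₀ : ℝ))).exists
  obtain ⟨h1, h2⟩ := hn1
  simp only [Set.mem_ofPred_eq, add_sub_cancel] at h2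
  rw [Prod.norm_def, h1] at hn2
  simp only [norm_zero] at hn2
  rw [max_eq_right (norm_nonneg _), Int.norm_eq_abs] at hn2
  have h3 : ((|V (n + 1) ω| : ℤ) : ℝ) ≤ (y₀ : ℝ) := by exact_mod_cast h2
  rw [Int.cast_abs] at h3
  linarith

end Pair

/-! ### Characteristic functions of laws on the integers -/

/-- Lebesgue measure on `(-π, π]`, over which all Fourier integrals are taken. -/
noncomputable def periodMeasure : Measure ℝ := volume.restrict (Set.Ioc (-Real.pi) Real.pi)

instance isFiniteMeasure_periodMeasure : IsFiniteMeasure periodMeasure := by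
  unfold periodMeasure; infer_instance

theorem periodMeasure_real_univ : periodMeasure.real Set.univ = 2 * Real.pi := by
  rw [periodMeasure, measureReal_restrict_apply_univ, Real.volume_real_Ioc_of_le
    (by linarith [Real.pi_pos])]
  ring

theorem ae_mem_period : ∀ᵐ t ∂periodMeasure, t ∈ Set.Ioc (-Real.pi) Real.pi :=
  ae_restrict_mem measurableSet_Ioc

theorem ae_abs_le_pi : ∀ᵐ t ∂periodMeasure, |t| ≤ Real.pi := by
  filter_upwards [ae_mem_period] with t ht
  exact abs_le.2 ⟨ht.1.le, ht.2⟩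

theorem integral_period_exp (x : ℤ) :
    ∫ t, Complex.exp (t * x * Complex.I) ∂periodMeasure =
      if x = 0 then (2 * Real.pi : ℂ) else 0 := by
  rw [periodMeasure, ← intervalIntegral.integral_of_le (by linarith [Real.pi_pos])]
  split_ifs with hx
  · subst hx
    simp
    ring
  · have hc : (x : ℂ) * Complex.I ≠ 0 := mul_ne_zero (by exact_mod_cast hx) Complex.I_ne_zero
    have h1 : ∀ t : ℝ, Complex.exp (t * x * Complex.I) = Complex.exp (x * Complex.I * t) := by
      intro t; congr 1; ring
    simp_rw [h1]
    rw [integral_exp_mul_complex hc]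
    have h2 : Complex.exp (x * Complex.I * (Real.pi : ℝ)) =
        Complex.exp (x * Complex.I * ((-Real.pi : ℝ) : ℂ)) := by
      rw [Complex.exp_eq_exp_iff_exists_int]
      refine ⟨x, ?_⟩
      push_cast
      ring
    rw [h2, sub_self, zero_div]

/-- The characteristic function of a law on `ℤ`. -/
noncomputable def latticeCharFun (ν : Measure ℤ) (t : ℝ) : ℂ :=
  ∫ x : ℤ, Complex.exp (t * x * Complex.I) ∂ν

theorem norm_exp_int_mul_I (t : ℝ) (x : ℤ) : ‖Complex.exp (t * x * Complex.I)‖ = 1 := by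
  have : (t * x * Complex.I : ℂ) = ((t * x : ℝ) : ℂ) * Complex.I := by push_cast; ring
  rw [this, Complex.norm_exp_ofReal_mul_I]

theorem integrable_exp_int (ν : Measure ℤ) [IsFiniteMeasure ν] (t : ℝ) :
    Integrable (fun x : ℤ => Complex.exp (t * x * Complex.I)) ν :=
  (integrable_const (1 : ℝ)).mono' (Measurable.of_discrete.aestronglyMeasurable)
    (ae_of_all _ fun x => (norm_exp_int_mul_I t x).le)

theorem continuous_latticeCharFun (ν : Measure ℤ) [IsFiniteMeasure ν] :
    Continuous (latticeCharFun ν) := by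
  refine continuous_of_dominated (bound := fun _ => 1)
    (fun t => Measurable.of_discrete.aestronglyMeasurable)
    (fun t => ae_of_all _ fun x => (norm_exp_int_mul_I t x).le) (integrable_const _)
    (ae_of_all _ fun x => by fun_prop)

theorem norm_latticeCharFun_le_one (ν : Measure ℤ) [IsProbabilityMeasure ν] (t : ℝ) :
    ‖latticeCharFun ν t‖ ≤ 1 := by
  refine (norm_integral_le_of_norm_le_const (C := 1)
    (ae_of_all _ fun x => (norm_exp_int_mul_I t x).le)).trans ?_
  simp

theorem latticeCharFun_dirac (a : ℤ) (t : ℝ) :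
    latticeCharFun (Measure.dirac a) t = Complex.exp (t * a * Complex.I) := by
  rw [latticeCharFun, integral_dirac]

theorem latticeCharFun_conv (μ ν : Measure ℤ) [IsProbabilityMeasure μ] [IsProbabilityMeasure ν]
    (t : ℝ) : latticeCharFun (μ.conv ν) t = latticeCharFun μ t * latticeCharFun ν t := by
  rw [latticeCharFun, Measure.conv, integral_map (by fun_prop)
    (Measurable.of_discrete.aestronglyMeasurable)]
  have : ∀ p : ℤ × ℤ, Complex.exp (t * ((p.1 + p.2 : ℤ) : ℂ) * Complex.I) =
      Complex.exp (t * p.1 * Complex.I) * Complex.exp (t * p.2 * Complex.I) := by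
    intro p
    rw [← Complex.exp_add]
    congr 1
    push_cast
    ring
  simp_rw [this]
  exact integral_prod_mul (fun x : ℤ => Complex.exp (t * x * Complex.I))
    fun x : ℤ => Complex.exp (t * x * Complex.I)

theorem latticeCharFun_walkLaw (ν : Measure ℤ) [IsProbabilityMeasure ν] (n : ℕ) (t : ℝ) :
    latticeCharFun (walkLaw ν n) t = latticeCharFun ν t ^ n := by
  induction n with
  | zero => rw [walkLaw_zero, latticeCharFun_dirac]; simp
  | succ n ih => rw [walkLaw_succ, latticeCharFun_conv, ih, pow_succ]

/-- The characteristic function of a symmetric law is real. -/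
theorem latticeCharFun_eq_ofReal {ν : Measure ℤ} (hν : ν.map (fun x => -x) = ν) (t : ℝ) :
    latticeCharFun ν t = ((latticeCharFun ν t).re : ℂ) := by
  have h : (starRingEnd ℂ) (latticeCharFun ν t) = latticeCharFun ν t := by
    conv_rhs => rw [latticeCharFun, ← hν, integral_map (by fun_prop)
      (Measurable.of_discrete.aestronglyMeasurable)]
    rw [latticeCharFun, ← integral_conj]
    refine integral_congr_ae (ae_of_all _ fun x => ?_)
    simp only [← Complex.exp_conj]
    congr 1
    simp
  exact (Complex.conj_eq_iff_re.1 h).symm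

/-- Fourier inversion on `ℤ`. -/
theorem integral_latticeCharFun_mul_exp (ν : Measure ℤ) [IsProbabilityMeasure ν] (y : ℤ) :
    ∫ t, latticeCharFun ν t * Complex.exp (t * y * Complex.I) ∂periodMeasure =
      2 * Real.pi * ν.real {-y} := by
  have hint : Integrable (Function.uncurry fun (t : ℝ) (x : ℤ) =>
      Complex.exp (t * (x + y : ℤ) * Complex.I)) (periodMeasure.prod ν) := by
    refine (integrable_const (1 : ℝ)).mono' ?_ (ae_of_all _ fun p =>
      (norm_exp_int_mul_I p.1 (p.2 + y)).le)
    refine Measurable.aestronglyMeasurable ?_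
    refine measurable_from_prod_countable_left fun x => ?_
    exact Continuous.measurable (by fun_prop)
  have h1 : ∀ t : ℝ, latticeCharFun ν t * Complex.exp (t * y * Complex.I) =
      ∫ x : ℤ, Complex.exp (t * (x + y : ℤ) * Complex.I) ∂ν := by
    intro t
    rw [latticeCharFun, ← integral_mul_const]
    refine integral_congr_ae (ae_of_all _ fun x => ?_)
    simp only [← Complex.exp_add]
    congr 1
    push_cast
    ring
  simp_rw [h1]
  rw [integral_integral_swap hint]
  simp_rw [integral_period_exp]
  have h2 : ∀ x : ℤ, (if x + y = 0 then (2 * Real.pi : ℂ) else 0) =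
      ({-y} : Set ℤ).indicator (fun _ => (2 * Real.pi : ℂ)) x := by
    intro x
    rw [Set.indicator_apply]
    simp only [Set.mem_singleton_iff, eq_neg_iff_add_eq_zero]
  simp_rw [h2]
  rw [integral_indicator_const _ MeasurableSet.of_discrete, Complex.real_smul]
  ring

theorem integral_latticeCharFun_mul_cos (ν : Measure ℤ) [IsProbabilityMeasure ν] (m : ℤ) :
    ∫ t, latticeCharFun ν t * (Real.cos (m * t) : ℂ) ∂periodMeasure =
      ((Real.pi * (ν.real {m} + ν.real {-m}) : ℝ) : ℂ) := by
  have hint : ∀ y : ℤ, Integrable (fun t : ℝ => latticeCharFun ν t *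
      Complex.exp (t * y * Complex.I)) periodMeasure := by
    intro y
    refine (integrable_const (1 : ℝ)).mono' (((continuous_latticeCharFun ν).mul
      (by fun_prop)).aestronglyMeasurable) (ae_of_all _ fun t => ?_)
    rw [norm_mul, norm_exp_int_mul_I, mul_one]
    exact norm_latticeCharFun_le_one ν t
  have h : ∀ t : ℝ, latticeCharFun ν t * (Real.cos (m * t) : ℂ) =
      (latticeCharFun ν t * Complex.exp (t * m * Complex.I) +
        latticeCharFun ν t * Complex.exp (t * (-m : ℤ) * Complex.I)) / 2 := by
    intro t
    rw [Complex.ofReal_cos, Complex.cos]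
    push_cast
    rw [show (m * t * Complex.I : ℂ) = t * m * Complex.I by ring,
      show (-(m * t : ℂ) * Complex.I) = t * -m * Complex.I by ring]
    ring
  simp_rw [h]
  rw [integral_div, integral_add (hint m) (hint (-m)), integral_latticeCharFun_mul_exp,
    integral_latticeCharFun_mul_exp, neg_neg]
  push_cast
  ring

/-- If a law charges two distinct points, then the modulus of its characteristic function stays
below `1` in a quantitative way. -/
theorem norm_latticeCharFun_le (ν : Measure ℤ) [IsProbabilityMeasure ν] {a b : ℤ} (hab : a ≠ b)
    (t : ℝ) :
    ‖latticeCharFun ν t‖ ≤ 1 - ν.real {a} * ν.real {b} * (1 - Real.cos ((b - a : ℤ) * t)) := by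
  set p := ν.real {a} with hp
  set q := ν.real {b} with hq
  have hp0 : 0 ≤ p := measureReal_nonneg
  have hq0 : 0 ≤ q := measureReal_nonneg
  set S : Finset ℤ := {a, b} with hS
  have hSr : ν.real (S : Set ℤ) = p + q := by
    rw [hS, Finset.coe_pair, Set.insert_eq, measureReal_union (by simpa using hab)
      MeasurableSet.of_discrete]
  have hpq : p + q ≤ 1 := hSr ▸ measureReal_le_one
  have hdec := integral_add_compl (μ := ν) (s := (S : Set ℤ)) MeasurableSet.of_discrete
    (integrable_exp_int ν t)
  have hfin : ∫ x in (S : Set ℤ), Complex.exp (t * x * Complex.I) ∂ν =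
      p * Complex.exp (t * a * Complex.I) + q * Complex.exp (t * b * Complex.I) := by
    rw [setIntegral_finset _ (integrable_exp_int ν t).integrableOn, hS, Finset.sum_pair hab,
      Complex.real_smul, Complex.real_smul]
  have hrest : ‖∫ x in (S : Set ℤ)ᶜ, Complex.exp (t * x * Complex.I) ∂ν‖ ≤ 1 - (p + q) := by
    refine (norm_setIntegral_le_of_norm_le_const (C := 1) (measure_lt_top _ _)
      fun x _ => (norm_exp_int_mul_I t x).le).trans ?_
    rw [one_mul, probReal_compl_eq_one_sub MeasurableSet.of_discrete, hSr]
  set c := Real.cos ((b - a : ℤ) * t) with hc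
  have hc1 : c ≤ 1 := Real.cos_le_one _
  have hc2 : -1 ≤ c := Real.neg_one_le_cos _
  have hmain : ‖(p * Complex.exp (t * a * Complex.I) + q * Complex.exp (t * b * Complex.I) : ℂ)‖ ≤
      p + q - p * q * (1 - c) := by
    have hfac : (p * Complex.exp (t * a * Complex.I) + q * Complex.exp (t * b * Complex.I) : ℂ) =
        Complex.exp (t * a * Complex.I) *
          (p + q * Complex.exp (((b - a : ℤ) * t : ℝ) * Complex.I)) := by
      rw [mul_add, mul_left_comm _ (q : ℂ), ← Complex.exp_add, mul_comm (p : ℂ)]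
      congr 3
      push_cast
      ring
    have hsq : ‖(p + q * Complex.exp (((b - a : ℤ) * t : ℝ) * Complex.I) : ℂ)‖ ^ 2 =
        (p + q) ^ 2 - 2 * (p * q * (1 - c)) := by
      rw [← Complex.normSq_eq_norm_sq, Complex.exp_mul_I, ← Complex.ofReal_cos,
        ← Complex.ofReal_sin, Complex.normSq_apply]
      simp only [Complex.add_re, Complex.mul_re, Complex.ofReal_re, Complex.ofReal_im,
        Complex.add_im, Complex.mul_im, Complex.I_re, Complex.I_im]
      have := Real.sin_sq_add_cos_sq ((b - a : ℤ) * t)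
      rw [← hc] at this ⊢
      linear_combination q ^ 2 * this
    have hpq1 : p * q * (1 - c) ≤ p + q := by nlinarith [mul_nonneg hp0 hq0]
    rw [hfac, norm_mul, norm_exp_int_mul_I, one_mul]
    refine abs_le_of_sq_le_sq' ?_ (by linarith) |>.2
    rw [hsq]
    have hx : 0 ≤ p * q * (1 - c) := mul_nonneg (mul_nonneg hp0 hq0) (by linarith)
    nlinarith [mul_nonneg hx (sub_nonneg.2 hpq), sq_nonneg (p * q * (1 - c))]
  rw [latticeCharFun, ← hdec, hfin]
  refine (norm_add_le _ _).trans ?_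
  linarith

theorem ae_cos_lt_one {d : ℤ} (hd : d ≠ 0) : ∀ᵐ t ∂periodMeasure, Real.cos (d * t) < 1 := by
  refine ae_restrict_of_ae ?_
  have hcount : (Set.range fun n : ℤ => (n : ℝ) * (2 * Real.pi) / d).Countable :=
    Set.countable_range _
  filter_upwards [hcount.ae_notMem volume] with t ht
  refine lt_of_le_of_ne (Real.cos_le_one _) fun h => ht ?_
  obtain ⟨n, hn⟩ := (Real.cos_eq_one_iff _).1 h
  refine ⟨n, ?_⟩
  have hd' : (d : ℝ) ≠ 0 := by exact_mod_cast hd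
  simp only [hn]
  field_simp

theorem ae_norm_latticeCharFun_lt_one (ν : Measure ℤ) [IsProbabilityMeasure ν] {a b : ℤ}
    (hab : a ≠ b) (ha : ν {a} ≠ 0) (hb : ν {b} ≠ 0) :
    ∀ᵐ t ∂periodMeasure, ‖latticeCharFun ν t‖ < 1 := by
  filter_upwards [ae_cos_lt_one (sub_ne_zero.2 hab.symm)] with t ht
  refine (norm_latticeCharFun_le ν hab t).trans_lt ?_
  have h1 : 0 < ν.real {a} := ENNReal.toReal_pos ha (measure_ne_top _ _)
  have h2 : 0 < ν.real {b} := ENNReal.toReal_pos hb (measure_ne_top _ _)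
  have h3 : 0 < 1 - Real.cos ((b - a : ℤ) * t) := by linarith
  have := mul_pos (mul_pos h1 h2) h3
  linarith

/-- A law on `ℤ` is a point mass or charges two distinct points. -/
theorem eq_dirac_or_exists_two_atoms (ν : Measure ℤ) [IsProbabilityMeasure ν] :
    (∃ a, ν = Measure.dirac a) ∨ ∃ a b, a < b ∧ ν {a} ≠ 0 ∧ ν {b} ≠ 0 := by
  by_cases h : ∃ a b, a ≠ b ∧ ν {a} ≠ 0 ∧ ν {b} ≠ 0
  · right
    obtain ⟨a, b, hab, ha, hb⟩ := h
    rcases lt_or_gt_of_ne hab with h | h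
    exacts [⟨a, b, h, ha, hb⟩, ⟨b, a, h, hb, ha⟩]
  · left
    push Not at h
    obtain ⟨a, ha⟩ : ∃ a, ν {a} ≠ 0 := by
      by_contra! h0
      have := (measure_iUnion_null (μ := ν) h0)
      rw [Set.iUnion_of_singleton, measure_univ] at this
      exact one_ne_zero this
    refine ⟨a, ?_⟩
    have hae : ∀ᵐ x ∂ν, x = a := by
      rw [ae_iff_of_countable]
      intro x hx
      by_contra hne
      exact hx (h a x (Ne.symm hne) ha)
    have h1 := Measure.map_congr (f := id) (g := fun _ => a) (μ := ν)
      (mβ := inferInstance) hae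
    rw [Measure.map_id, Measure.map_const, measure_univ, one_smul] at h1
    exact h1

/-! ### The tail series -/

/-- The two-sided tail `m ↦ ν {x | m ≤ |x|}` of a law on `ℤ`. -/
noncomputable def lawTail (ν : Measure ℤ) (m : ℕ) : ℝ := ν.real {x | (m : ℤ) ≤ |x|}

/-- The trigonometric series with coefficients `r ^ m ν {x | m ≤ |x|}`. -/
noncomputable def lawTailSeries (ν : Measure ℤ) (r s : ℝ) : ℝ :=
  ∑' m : ℕ, r ^ m * lawTail ν m * Real.cos (m * s)

theorem lawTail_nonneg (ν : Measure ℤ) (m : ℕ) : 0 ≤ lawTail ν m := measureReal_nonneg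

theorem pow_mul_lawTail_nonneg (ν : Measure ℤ) {r : ℝ} (hr0 : 0 ≤ r) (m : ℕ) :
    0 ≤ r ^ m * lawTail ν m :=
  mul_nonneg (pow_nonneg hr0 m) (lawTail_nonneg ν m)

section

variable (ν : Measure ℤ) [IsProbabilityMeasure ν]

theorem lawTail_le_one (m : ℕ) : lawTail ν m ≤ 1 := measureReal_le_one

theorem lawTail_antitone : Antitone (lawTail ν) := fun a b hab =>
  measureReal_mono fun x hx => by
    simp only [Set.mem_ofPred_eq] at hx ⊢
    exact le_trans (by exact_mod_cast hab) hx

theorem pow_mul_lawTail_le {r : ℝ} (hr0 : 0 ≤ r) (m : ℕ) : r ^ m * lawTail ν m ≤ r ^ m :=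
  mul_le_of_le_one_right (pow_nonneg hr0 m) (lawTail_le_one ν m)

theorem pow_mul_lawTail_le_one {r : ℝ} (hr0 : 0 ≤ r) (hr1 : r < 1) (m : ℕ) :
    r ^ m * lawTail ν m ≤ 1 :=
  (pow_mul_lawTail_le ν hr0 m).trans (pow_le_one₀ hr0 hr1.le)

theorem summable_pow_mul_lawTail {r : ℝ} (hr0 : 0 ≤ r) (hr1 : r < 1) :
    Summable fun m => r ^ m * lawTail ν m :=
  Summable.of_nonneg_of_le (pow_mul_lawTail_nonneg ν hr0) (pow_mul_lawTail_le ν hr0)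
    (summable_geometric_of_lt_one hr0 hr1)

omit [IsProbabilityMeasure ν] in
theorem abs_lawTailSeries_term_le {r : ℝ} (hr0 : 0 ≤ r) (m : ℕ) (s : ℝ) :
    ‖r ^ m * lawTail ν m * Real.cos (m * s)‖ ≤ r ^ m * lawTail ν m := by
  rw [norm_mul, Real.norm_of_nonneg (pow_mul_lawTail_nonneg ν hr0 m)]
  exact mul_le_of_le_one_right (pow_mul_lawTail_nonneg ν hr0 m) (Real.abs_cos_le_one _)

theorem abs_lawTailSeries_le {r : ℝ} (hr0 : 0 ≤ r) (hr1 : r < 1) (s : ℝ) :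
    |lawTailSeries ν r s| ≤ ∑' m, r ^ m * lawTail ν m :=
  tsum_of_norm_bounded (summable_pow_mul_lawTail ν hr0 hr1).hasSum
    fun m => abs_lawTailSeries_term_le ν hr0 m s

theorem continuous_lawTailSeries {r : ℝ} (hr0 : 0 ≤ r) (hr1 : r < 1) :
    Continuous (lawTailSeries ν r) :=
  continuous_tsum (fun m => by fun_prop) (summable_pow_mul_lawTail ν hr0 hr1)
    fun m s => abs_lawTailSeries_term_le ν hr0 m s

/-- Abel summation: a power series with decreasing coefficients, on the unit circle. -/
theorem norm_one_sub_mul_tsum_le {a : ℕ → ℝ} (ha : Antitone a) (ha0 : ∀ m, 0 ≤ a m)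
    (hs : Summable a) {z : ℂ} (hz : ‖z‖ = 1) : ‖(1 - z) * ∑' m, (a m : ℂ) * z ^ m‖ ≤ 2 * a 0 := by
  have hnorm : ∀ m, ‖(a m : ℂ) * z ^ m‖ = a m := by
    intro m
    rw [norm_mul, norm_pow, hz, one_pow, mul_one, Complex.norm_real,
      Real.norm_of_nonneg (ha0 m)]
  have hsz : Summable fun m => (a m : ℂ) * z ^ m := by
    refine Summable.of_norm ?_
    simp_rw [hnorm]
    exact hs
  have hs1 : Summable fun m => a (m + 1) := (summable_nat_add_iff 1).2 hs
  have hdiff : Summable fun m => a m - a (m + 1) := hs.sub hs1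
  have htel : ∑' m, (a m - a (m + 1)) = a 0 := by
    rw [hs.tsum_sub hs1, hs.tsum_eq_zero_add]
    ring
  have hsz1 : Summable fun m => (a (m + 1) : ℂ) * z ^ (m + 1) := (summable_nat_add_iff 1).2 hsz
  have hexp : (1 - z) * ∑' m, (a m : ℂ) * z ^ m =
      a 0 - ∑' m, ((a m - a (m + 1) : ℝ) : ℂ) * z ^ (m + 1) := by
    have h1 : ∑' m, ((a m - a (m + 1) : ℝ) : ℂ) * z ^ (m + 1) =
        z * ∑' m, (a m : ℂ) * z ^ m - ∑' m, (a (m + 1) : ℂ) * z ^ (m + 1) := by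
      rw [← tsum_mul_left, ← (hsz.mul_left z).tsum_sub hsz1]
      refine tsum_congr fun m => ?_
      push_cast
      ring
    rw [h1, sub_mul, one_mul, hsz.tsum_eq_zero_add]
    simp
    ring
  have hbound : ‖∑' m, ((a m - a (m + 1) : ℝ) : ℂ) * z ^ (m + 1)‖ ≤ a 0 := by
    rw [← htel]
    refine tsum_of_norm_bounded hdiff.hasSum fun m => ?_
    rw [norm_mul, norm_pow, hz, one_pow, mul_one, Complex.norm_real,
      Real.norm_of_nonneg (sub_nonneg.2 (ha m.le_succ))]
  rw [hexp]
  refine (norm_sub_le _ _).trans ?_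
  rw [Complex.norm_real, Real.norm_of_nonneg (ha0 0)]
  linarith

theorem norm_one_sub_exp_ge {s : ℝ} (hs : |s| ≤ Real.pi) :
    2 / Real.pi * |s| ≤ ‖(1 : ℂ) - Complex.exp (s * Complex.I)‖ := by
  rw [norm_sub_rev, mul_comm (s : ℂ), Complex.norm_exp_I_mul_ofReal_sub_one, norm_mul,
    Real.norm_ofNat, Real.norm_eq_abs]
  have h := Real.mul_abs_le_abs_sin (x := s / 2) (by rw [abs_div, abs_two]; linarith)
  rw [abs_div, abs_two] at h
  calc 2 / Real.pi * |s| = 2 * (2 / Real.pi * (|s| / 2)) := by ring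
    _ ≤ _ := by gcongr

/-- Since the tail is decreasing, the tail series is `O(1 / |s|)` uniformly in `r`. -/
theorem abs_lawTailSeries_mul_abs_le {r s : ℝ} (hr0 : 0 ≤ r) (hr1 : r < 1) (hs : |s| ≤ Real.pi) :
    |lawTailSeries ν r s| * |s| ≤ Real.pi := by
  set z : ℂ := Complex.exp (s * Complex.I) with hz
  have hz1 : ‖z‖ = 1 := Complex.norm_exp_ofReal_mul_I s
  set a : ℕ → ℝ := fun m => r ^ m * lawTail ν m with ha
  have hsa : Summable a := summable_pow_mul_lawTail ν hr0 hr1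
  have hanti : Antitone a := fun m n hmn =>
    mul_le_mul (pow_le_pow_of_le_one hr0 hr1.le hmn) (lawTail_antitone ν hmn)
      (lawTail_nonneg ν n) (pow_nonneg hr0 m)
  have hsz : Summable fun m => (a m : ℂ) * z ^ m := by
    refine Summable.of_norm ?_
    have : ∀ m, ‖(a m : ℂ) * z ^ m‖ = a m := by
      intro m
      rw [norm_mul, norm_pow, hz1, one_pow, mul_one, Complex.norm_real,
        Real.norm_of_nonneg (pow_mul_lawTail_nonneg ν hr0 m)]
    simp_rw [this]
    exact hsa
  have hre : lawTailSeries ν r s = (∑' m, (a m : ℂ) * z ^ m).re := by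
    rw [Complex.re_tsum hsz]
    refine tsum_congr fun m => ?_
    rw [Complex.re_ofReal_mul, hz, ← Complex.exp_nat_mul, show ((m : ℂ) * (s * Complex.I)) =
      ((m * s : ℝ) : ℂ) * Complex.I by push_cast; ring, Complex.exp_ofReal_mul_I_re]
  have h1 : |lawTailSeries ν r s| ≤ ‖∑' m, (a m : ℂ) * z ^ m‖ := by
    rw [hre]; exact Complex.abs_re_le_norm _
  have h2 := norm_one_sub_mul_tsum_le hanti (pow_mul_lawTail_nonneg ν hr0) hsa hz1
  rw [norm_mul] at h2
  have h3 : a 0 ≤ 1 := pow_mul_lawTail_le_one ν hr0 hr1 0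
  have h4 := norm_one_sub_exp_ge hs
  have h5 : 2 / Real.pi * (|lawTailSeries ν r s| * |s|) ≤ 2 := by
    calc 2 / Real.pi * (|lawTailSeries ν r s| * |s|)
        = (2 / Real.pi * |s|) * |lawTailSeries ν r s| := by ring
      _ ≤ ‖1 - z‖ * ‖∑' m, (a m : ℂ) * z ^ m‖ := by gcongr
      _ ≤ 2 := by linarith
  have hpi := Real.pi_pos
  rw [div_mul_eq_mul_div, div_le_iff₀ hpi] at h5
  linarith

/-- The Fourier coefficients of the tail series, paired with a law `ρ` on `ℤ`. -/
theorem integral_lawTailSeries_mul_charFun {r : ℝ} (hr0 : 0 ≤ r) (hr1 : r < 1) (ρ : Measure ℤ)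
    [IsProbabilityMeasure ρ] :
    ∫ s, (lawTailSeries ν r s : ℂ) * latticeCharFun ρ s ∂periodMeasure =
      ((∑' m : ℕ, r ^ m * lawTail ν m * (Real.pi * (ρ.real {(m : ℤ)} + ρ.real {-(m : ℤ)})) : ℝ) :
        ℂ) := by
  set F : ℕ → ℝ → ℂ := fun m s =>
    ((r ^ m * lawTail ν m : ℝ) : ℂ) * (latticeCharFun ρ s * (Real.cos ((m : ℤ) * s) : ℂ)) with hF
  have hbound : ∀ m s, ‖F m s‖ ≤ r ^ m * lawTail ν m := by
    intro m s
    rw [hF]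
    simp only [norm_mul, Complex.norm_real]
    rw [← norm_mul, Real.norm_of_nonneg (pow_mul_lawTail_nonneg ν hr0 m)]
    refine mul_le_of_le_one_right (pow_mul_lawTail_nonneg ν hr0 m) ?_
    exact mul_le_one₀ (norm_latticeCharFun_le_one ρ s) (norm_nonneg _) (Real.abs_cos_le_one _)
  have hint : ∀ m, Integrable (F m) periodMeasure := fun m =>
    (integrable_const (r ^ m * lawTail ν m)).mono'
      (Continuous.aestronglyMeasurable (by
        have := continuous_latticeCharFun ρ
        fun_prop)) (ae_of_all _ (hbound m))
  have hsum : Summable fun m => ∫ s, ‖F m s‖ ∂periodMeasure := by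
    refine Summable.of_nonneg_of_le (fun m => integral_nonneg fun s => norm_nonneg _)
      (fun m => ?_) ((summable_pow_mul_lawTail ν hr0 hr1).mul_right (2 * Real.pi))
    refine (integral_mono (hint m).norm (integrable_const _) (hbound m)).trans (le_of_eq ?_)
    rw [integral_const, periodMeasure_real_univ, smul_eq_mul, mul_comm]
  have h := integral_tsum_of_summable_integral_norm hint hsum
  have h1 : ∀ s, ∑' m, F m s = (lawTailSeries ν r s : ℂ) * latticeCharFun ρ s := by
    intro s
    rw [lawTailSeries, Complex.ofReal_tsum, ← tsum_mul_right]
    refine tsum_congr fun m => ?_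
    simp only [hF]
    push_cast
    ring
  simp_rw [h1] at h
  rw [← h, Complex.ofReal_tsum]
  refine tsum_congr fun m => ?_
  simp only [hF]
  rw [integral_const_mul, integral_latticeCharFun_mul_cos]
  push_cast
  ring

theorem summable_real_natCast (ρ : Measure ℤ) [IsProbabilityMeasure ρ] :
    Summable fun m : ℕ => ρ.real {(m : ℤ)} :=
  summable_measure_toReal (f := fun m : ℕ => {(m : ℤ)}) (fun m => MeasurableSet.of_discrete)
    fun a b hab => by simpa using hab

theorem tsum_real_natCast_le_one (ρ : Measure ℤ) [IsProbabilityMeasure ρ] :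
    ∑' m : ℕ, ρ.real {(m : ℤ)} ≤ 1 := by
  have h := measure_iUnion (μ := ρ) (f := fun m : ℕ => {(m : ℤ)})
    (fun a b hab => by simpa using hab) fun m => MeasurableSet.of_discrete
  have h2 : ∑' m : ℕ, ρ.real {(m : ℤ)} = (∑' m : ℕ, ρ {(m : ℤ)}).toReal :=
    (ENNReal.tsum_toReal_eq fun m => measure_ne_top _ _).symm
  rw [h2, ← h]
  exact measureReal_le_one

/-- `E[r ^ W P(|X| ≥ W); W ≥ 0]`, where `W` is the position at time `n` of the walk with step law
`ν` and `X` is an independent step. -/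
noncomputable def tailWeight (r : ℝ) (n : ℕ) : ℝ :=
  ∑' m : ℕ, r ^ m * lawTail ν m * (walkLaw ν n).real {(m : ℤ)}

omit [IsProbabilityMeasure ν] in
theorem tailWeight_nonneg {r : ℝ} (hr0 : 0 ≤ r) (n : ℕ) : 0 ≤ tailWeight ν r n :=
  tsum_nonneg fun m => mul_nonneg (pow_mul_lawTail_nonneg ν hr0 m) measureReal_nonneg

theorem summable_tailWeight {r : ℝ} (hr0 : 0 ≤ r) (hr1 : r < 1) (n : ℕ) :
    Summable fun m : ℕ => r ^ m * lawTail ν m * (walkLaw ν n).real {(m : ℤ)} :=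
  Summable.of_nonneg_of_le (fun m => mul_nonneg (pow_mul_lawTail_nonneg ν hr0 m) measureReal_nonneg)
    (fun m => mul_le_of_le_one_right (pow_mul_lawTail_nonneg ν hr0 m) measureReal_le_one)
    (summable_pow_mul_lawTail ν hr0 hr1)

theorem tailWeight_le_one {r : ℝ} (hr0 : 0 ≤ r) (hr1 : r < 1) (n : ℕ) : tailWeight ν r n ≤ 1 :=
  ((summable_tailWeight ν hr0 hr1 n).tsum_le_tsum
    (fun m => mul_le_of_le_one_left measureReal_nonneg (pow_mul_lawTail_le_one ν hr0 hr1 m))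
    (summable_real_natCast _)).trans (tsum_real_natCast_le_one _)

theorem integral_lawTailSeries_mul_pow {r : ℝ} (hr0 : 0 ≤ r) (hr1 : r < 1)
    (hν : ν.map (fun x => -x) = ν) (n : ℕ) :
    ∫ s, lawTailSeries ν r s * (latticeCharFun ν s).re ^ n ∂periodMeasure =
      2 * Real.pi * tailWeight ν r n := by
  have h := integral_lawTailSeries_mul_charFun ν hr0 hr1 (walkLaw ν n)
  have h1 : ∀ s, (lawTailSeries ν r s : ℂ) * latticeCharFun (walkLaw ν n) s =
      ((lawTailSeries ν r s * (latticeCharFun ν s).re ^ n : ℝ) : ℂ) := by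
    intro s
    rw [latticeCharFun_walkLaw, latticeCharFun_eq_ofReal hν]
    push_cast
    simp
  simp_rw [h1] at h
  rw [integral_complex_ofReal, Complex.ofReal_inj] at h
  rw [h, tailWeight, ← tsum_mul_left]
  refine tsum_congr fun m => ?_
  have h2 : (walkLaw ν n).real {-(m : ℤ)} = (walkLaw ν n).real {(m : ℤ)} := by
    rw [Measure.real, Measure.real, ← measure_neg_eq (map_neg_walkLaw hν n) {-(m : ℤ)}]
    congr 2
    ext x
    simp
  rw [h2]
  ring

end

/-! ### Integrability of the resolvent -/

/-- The real part of `1 / (1 - z)`, with the value `0` at `z = 1`. -/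
noncomputable def resolventRe (z : ℂ) : ℝ := ((1 - z)⁻¹).re

theorem resolventRe_nonneg {z : ℂ} (hz : ‖z‖ ≤ 1) : 0 ≤ resolventRe z := by
  rw [resolventRe, Complex.inv_re]
  refine div_nonneg ?_ (Complex.normSq_nonneg _)
  rw [Complex.sub_re, Complex.one_re]
  linarith [(Complex.re_le_norm z).trans hz]

theorem measurable_resolventRe : Measurable resolventRe :=
  Complex.measurable_re.comp ((measurable_const.sub measurable_id).inv)

theorem hasSum_resolventRe {z : ℂ} (hz : ‖z‖ < 1) : HasSum (fun n => (z ^ n).re) (resolventRe z) :=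
  Complex.hasSum_re (hasSum_geometric_of_norm_lt_one hz)

theorem integral_latticeCharFun_pow (ν : Measure ℤ) [IsProbabilityMeasure ν] (n : ℕ) :
    ∫ t, latticeCharFun ν t ^ n ∂periodMeasure = 2 * Real.pi * (walkLaw ν n).real {0} := by
  have h := integral_latticeCharFun_mul_exp (walkLaw ν n) 0
  simpa [latticeCharFun_walkLaw] using h

section

variable (ν ρ : Measure ℤ) [IsProbabilityMeasure ν] [IsProbabilityMeasure ρ]

theorem norm_charFun_mul_le_one (t s : ℝ) : ‖latticeCharFun ν t * latticeCharFun ρ s‖ ≤ 1 := by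
  rw [norm_mul]
  exact mul_le_one₀ (norm_latticeCharFun_le_one ν t) (norm_nonneg _)
    (norm_latticeCharFun_le_one ρ s)

theorem continuous_charFun_mul : Continuous fun p : ℝ × ℝ =>
    latticeCharFun ν p.1 * latticeCharFun ρ p.2 :=
  ((continuous_latticeCharFun ν).comp continuous_fst).mul
    ((continuous_latticeCharFun ρ).comp continuous_snd)

theorem measurable_resolventRe_charFun : Measurable fun p : ℝ × ℝ =>
    resolventRe (latticeCharFun ν p.1 * latticeCharFun ρ p.2) :=
  measurable_resolventRe.comp (continuous_charFun_mul ν ρ).measurable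

theorem norm_smul_charFun_lt_one {x : ℝ} (hx0 : 0 ≤ x) (hx1 : x < 1) (p : ℝ × ℝ) :
    ‖(x : ℂ) * (latticeCharFun ν p.1 * latticeCharFun ρ p.2)‖ < 1 := by
  rw [norm_mul, Complex.norm_real, Real.norm_of_nonneg hx0]
  exact (mul_le_of_le_one_right hx0 (norm_charFun_mul_le_one ν ρ p.1 p.2)).trans_lt hx1

/-- The Abel-regularized Green function at the origin, as a Fourier integral. -/
theorem lintegral_resolventRe_smul_le {x : ℝ} (hx0 : 0 ≤ x) (hx1 : x < 1) :
    ∫⁻ p : ℝ × ℝ, ENNReal.ofReal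
        (resolventRe ((x : ℂ) * (latticeCharFun ν p.1 * latticeCharFun ρ p.2)))
        ∂(periodMeasure.prod periodMeasure) ≤
      ENNReal.ofReal ((2 * Real.pi) ^ 2) * ∑' n, walkLaw ν n {0} * walkLaw ρ n {0} := by
  set F : ℕ → ℝ × ℝ → ℂ := fun n p =>
    ((x : ℂ) * (latticeCharFun ν p.1 * latticeCharFun ρ p.2)) ^ n with hF
  have hlt := norm_smul_charFun_lt_one ν ρ hx0 hx1
  have hbound : ∀ n p, ‖F n p‖ ≤ x ^ n := by
    intro n p
    simp only [hF, norm_pow]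
    refine pow_le_pow_left₀ (norm_nonneg _) ?_ n
    rw [norm_mul, Complex.norm_real, Real.norm_of_nonneg hx0]
    exact mul_le_of_le_one_right hx0 (norm_charFun_mul_le_one ν ρ p.1 p.2)
  have hcont : ∀ n, Continuous (F n) := fun n =>
    (continuous_const.mul (continuous_charFun_mul ν ρ)).pow n
  have hint : ∀ n, Integrable (F n) (periodMeasure.prod periodMeasure) := fun n =>
    (integrable_const (x ^ n)).mono' (hcont n).aestronglyMeasurable (ae_of_all _ (hbound n))
  have hsum : Summable fun n => ∫ p, ‖F n p‖ ∂(periodMeasure.prod periodMeasure) := by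
    refine Summable.of_nonneg_of_le (fun m => integral_nonneg fun s => norm_nonneg _)
      (fun n => integral_mono (hint n).norm (integrable_const _) (hbound n)) ?_
    simp_rw [integral_const]
    exact (summable_geometric_of_lt_one hx0 hx1).const_smul _
  have h := hasSum_integral_of_summable_integral_norm hint hsum
  have hgeo : ∀ p, ∑' n, F n p = (1 - (x : ℂ) * (latticeCharFun ν p.1 * latticeCharFun ρ p.2))⁻¹ :=
    fun p => tsum_geometric_of_norm_lt_one (hlt p)
  have hFint : ∀ n, ∫ p, F n p ∂(periodMeasure.prod periodMeasure) =
      ((x ^ n * ((2 * Real.pi) ^ 2 * ((walkLaw ν n).real {0} * (walkLaw ρ n).real {0})) : ℝ) :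
        ℂ) := by
    intro n
    simp only [hF, mul_pow]
    rw [integral_const_mul, integral_prod_mul (fun t => latticeCharFun ν t ^ n)
      fun s => latticeCharFun ρ s ^ n, integral_latticeCharFun_pow, integral_latticeCharFun_pow]
    push_cast
    ring
  simp_rw [hgeo, hFint] at h
  have hintR : Integrable (fun p : ℝ × ℝ => (1 - (x : ℂ) *
      (latticeCharFun ν p.1 * latticeCharFun ρ p.2))⁻¹) (periodMeasure.prod periodMeasure) := by
    refine (integrable_const ((1 - x)⁻¹)).mono' (Measurable.aestronglyMeasurable
      (measurable_const.sub (continuous_const.mul (continuous_charFun_mul ν ρ)).measurable).inv)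
      (ae_of_all _ fun p => ?_)
    rw [norm_inv]
    refine inv_anti₀ (by linarith) ?_
    refine le_trans ?_ (norm_sub_norm_le _ _)
    rw [norm_one, norm_mul, Complex.norm_real, Real.norm_of_nonneg hx0]
    linarith [mul_le_of_le_one_right hx0 (norm_charFun_mul_le_one ν ρ p.1 p.2)]
  have hre := Complex.hasSum_re h
  have hre2 : (∫ p : ℝ × ℝ, (1 - (x : ℂ) * (latticeCharFun ν p.1 * latticeCharFun ρ p.2))⁻¹
      ∂(periodMeasure.prod periodMeasure)).re = ∫ p : ℝ × ℝ, resolventRe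
        ((x : ℂ) * (latticeCharFun ν p.1 * latticeCharFun ρ p.2))
        ∂(periodMeasure.prod periodMeasure) := (integral_re hintR).symm
  rw [hre2] at hre
  simp only [Complex.ofReal_re] at hre
  have hintR' : Integrable (fun p : ℝ × ℝ => resolventRe
      ((x : ℂ) * (latticeCharFun ν p.1 * latticeCharFun ρ p.2)))
      (periodMeasure.prod periodMeasure) := hintR.re
  rw [← ofReal_integral_eq_lintegral_ofReal hintR'
    (ae_of_all _ fun p => resolventRe_nonneg (hlt p).le)]
  have hnn : ∀ n, 0 ≤ x ^ n * ((2 * Real.pi) ^ 2 *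
      ((walkLaw ν n).real {0} * (walkLaw ρ n).real {0})) := fun n => by positivity
  rw [← hre.tsum_eq, ENNReal.ofReal_tsum_of_nonneg hnn hre.summable, ← ENNReal.tsum_mul_left]
  refine ENNReal.tsum_le_tsum fun n => ?_
  have h1 : x ^ n ≤ 1 := pow_le_one₀ hx0 hx1.le
  calc ENNReal.ofReal (x ^ n * ((2 * Real.pi) ^ 2 *
        ((walkLaw ν n).real {0} * (walkLaw ρ n).real {0})))
      ≤ ENNReal.ofReal ((2 * Real.pi) ^ 2 *
        ((walkLaw ν n).real {0} * (walkLaw ρ n).real {0})) :=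
        ENNReal.ofReal_le_ofReal (mul_le_of_le_one_left (by positivity) h1)
    _ = _ := by
        rw [ENNReal.ofReal_mul (by positivity), ENNReal.ofReal_mul measureReal_nonneg,
          ofReal_measureReal, ofReal_measureReal]

/-- If the Green function of the pair of walks is finite at the origin, then the real part of
`1 / (1 - φ(t) ψ(s))` is integrable over the square of periods. -/
theorem integrable_resolventRe (hG : ∑' n, walkLaw ν n {0} * walkLaw ρ n {0} ≠ ∞) :
    Integrable (fun p : ℝ × ℝ => resolventRe (latticeCharFun ν p.1 * latticeCharFun ρ p.2))
      (periodMeasure.prod periodMeasure) := by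
  refine ⟨(measurable_resolventRe_charFun ν ρ).aestronglyMeasurable, ?_⟩
  have hnn : ∀ᵐ p : ℝ × ℝ ∂(periodMeasure.prod periodMeasure),
      0 ≤ resolventRe (latticeCharFun ν p.1 * latticeCharFun ρ p.2) :=
    ae_of_all _ fun p => resolventRe_nonneg (norm_charFun_mul_le_one ν ρ p.1 p.2)
  rw [hasFiniteIntegral_iff_ofReal hnn]
  set x : ℕ → ℝ := fun k => 1 - 1 / ((k : ℝ) + 1) with hx
  have hx0 : ∀ k, 0 ≤ x k := by
    intro k
    simp only [hx, sub_nonneg]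
    rw [div_le_one (by positivity)]
    linarith [(Nat.cast_nonneg k : (0 : ℝ) ≤ k)]
  have hx1 : ∀ k, x k < 1 := by
    intro k
    simp only [hx, sub_lt_self_iff]
    positivity
  have hxlim : Tendsto x atTop (𝓝 1) := by
    have h := (tendsto_one_div_add_atTop_nhds_zero_nat (𝕜 := ℝ)).const_sub 1
    rwa [sub_zero] at h
  set f : ℕ → ℝ × ℝ → ℝ≥0∞ := fun k p => ENNReal.ofReal
    (resolventRe ((x k : ℂ) * (latticeCharFun ν p.1 * latticeCharFun ρ p.2))) with hf
  have hfm : ∀ k, Measurable (f k) := fun k => ENNReal.measurable_ofReal.comp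
    (measurable_resolventRe.comp ((continuous_charFun_mul ν ρ).measurable.const_mul _))
  have hpt : ∀ p : ℝ × ℝ, ENNReal.ofReal
      (resolventRe (latticeCharFun ν p.1 * latticeCharFun ρ p.2)) ≤
        liminf (fun k => f k p) atTop := by
    intro p
    set z := latticeCharFun ν p.1 * latticeCharFun ρ p.2 with hz
    by_cases h1 : 1 - z = 0
    -- Here the left-hand side is `0`, the value of the inverse of `0`.
    · have : resolventRe z = 0 := by rw [resolventRe, h1]; simp
      rw [this]
      simp
    · have hlim : Tendsto (fun k => f k p) atTop (𝓝 (ENNReal.ofReal (resolventRe z))) := by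
        refine ENNReal.tendsto_ofReal ?_
        refine (Complex.continuous_re.tendsto _).comp ?_
        refine Tendsto.inv₀ ?_ h1
        refine tendsto_const_nhds.sub ?_
        have := ((Complex.continuous_ofReal.tendsto _).comp hxlim).mul_const z
        simpa using this
      exact hlim.liminf_eq.ge
  calc ∫⁻ p, ENNReal.ofReal (resolventRe (latticeCharFun ν p.1 * latticeCharFun ρ p.2))
        ∂(periodMeasure.prod periodMeasure)
      ≤ ∫⁻ p, liminf (fun k => f k p) atTop ∂(periodMeasure.prod periodMeasure) :=
        lintegral_mono hpt
    _ ≤ liminf (fun k => ∫⁻ p, f k p ∂(periodMeasure.prod periodMeasure)) atTop :=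
        lintegral_liminf_le hfm
    _ ≤ ENNReal.ofReal ((2 * Real.pi) ^ 2) * ∑' n, walkLaw ν n {0} * walkLaw ρ n {0} := by
        refine (liminf_le_liminf (Eventually.of_forall fun k =>
          lintegral_resolventRe_smul_le ν ρ (hx0 k) (hx1 k))).trans ?_
        rw [liminf_const]
    _ < ∞ := (ENNReal.mul_ne_top (by simp) hG).lt_top

end

/-! ### The kernel method -/

section

variable (ν ρ : Measure ℤ) [IsProbabilityMeasure ν] [IsProbabilityMeasure ρ]

/-- The integrand `Re (Φ(r, s) / (1 - φ(t) ψ(s)))` of the Fourier criterion, for the step laws `ν`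
and `ρ`. -/
noncomputable def lawIntegrand (r t s : ℝ) : ℝ :=
  lawTailSeries ρ r s * resolventRe (latticeCharFun ν t * latticeCharFun ρ s)

theorem abs_re_latticeCharFun_le_one (s : ℝ) : |(latticeCharFun ρ s).re| ≤ 1 :=
  (Complex.abs_re_le_norm _).trans (norm_latticeCharFun_le_one ρ s)

omit [IsProbabilityMeasure ν] [IsProbabilityMeasure ρ] in
theorem re_charFun_mul_pow (hρ : ρ.map (fun x => -x) = ρ) (t s : ℝ) (n : ℕ) :
    ((latticeCharFun ν t * latticeCharFun ρ s) ^ n).re =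
      (latticeCharFun ν t ^ n).re * (latticeCharFun ρ s).re ^ n := by
  rw [latticeCharFun_eq_ofReal hρ, mul_pow, ← Complex.ofReal_pow, Complex.re_mul_ofReal]
  simp

theorem integrable_pow_re_latticeCharFun (n : ℕ) :
    Integrable (fun s => |(latticeCharFun ρ s).re| ^ n) periodMeasure := by
  have hc := continuous_latticeCharFun ρ
  refine (integrable_const (1 : ℝ)).mono' (Continuous.aestronglyMeasurable
    (((Complex.continuous_re.comp hc).abs).pow n)) (ae_of_all _ fun s => ?_)
  rw [norm_pow, Real.norm_eq_abs, abs_abs]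
  exact pow_le_one₀ (abs_nonneg _) (abs_re_latticeCharFun_le_one ρ s)

omit [IsProbabilityMeasure ν] in
theorem integrable_lawIntegrand {r : ℝ} (hr0 : 0 ≤ r) (hr1 : r < 1)
    (hψ : Integrable (fun p : ℝ × ℝ => resolventRe (latticeCharFun ν p.1 * latticeCharFun ρ p.2))
      (periodMeasure.prod periodMeasure)) :
    Integrable (fun p : ℝ × ℝ => lawIntegrand ν ρ r p.1 p.2)
      (periodMeasure.prod periodMeasure) :=
  hψ.bdd_mul (c := ∑' m, r ^ m * lawTail ρ m)
    ((continuous_lawTailSeries ρ hr0 hr1).comp continuous_snd).aestronglyMeasurable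
    (ae_of_all _ fun p => abs_lawTailSeries_le ρ hr0 hr1 p.2)

omit [IsProbabilityMeasure ρ] in
/-- Integrating the geometric series in the first variable, against a kernel `k`. -/
theorem integral_kernel_mul_resolventRe (hρ : ρ.map (fun x => -x) = ρ) {k : ℝ → ℝ} {K : ℝ}
    (hkm : Measurable k) (hkb : ∀ t, |k t| ≤ K) {s : ℝ} (hs : ‖latticeCharFun ρ s‖ < 1) :
    HasSum (fun n => (∫ t, k t * (latticeCharFun ν t ^ n).re ∂periodMeasure) *
      (latticeCharFun ρ s).re ^ n)
      (∫ t, k t * resolventRe (latticeCharFun ν t * latticeCharFun ρ s) ∂periodMeasure) := by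
  set g := (latticeCharFun ρ s).re with hg
  have hg1 : |g| < 1 := (Complex.abs_re_le_norm _).trans_lt hs
  set F : ℕ → ℝ → ℝ := fun n t => k t * ((latticeCharFun ν t ^ n).re * g ^ n) with hF
  have hK : 0 ≤ K := (abs_nonneg _).trans (hkb 0)
  have hbound : ∀ n t, ‖F n t‖ ≤ K * |g| ^ n := by
    intro n t
    simp only [hF, norm_mul, norm_pow, Real.norm_eq_abs]
    have h1 : |(latticeCharFun ν t ^ n).re| ≤ 1 := (Complex.abs_re_le_norm _).trans
      (by rw [norm_pow]; exact pow_le_one₀ (norm_nonneg _) (norm_latticeCharFun_le_one ν t))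
    refine mul_le_mul (hkb t) ?_ (by positivity) hK
    exact mul_le_of_le_one_left (by positivity) h1
  have hc := continuous_latticeCharFun ν
  have hint : ∀ n, Integrable (F n) periodMeasure := fun n =>
    (integrable_const (K * |g| ^ n)).mono' (hkm.mul
      ((Complex.continuous_re.comp (hc.pow n)).measurable.mul_const _)).aestronglyMeasurable
      (ae_of_all _ (hbound n))
  have hsum : Summable fun n => ∫ t, ‖F n t‖ ∂periodMeasure := by
    refine Summable.of_nonneg_of_le (fun m => integral_nonneg fun s => norm_nonneg _)
      (fun n => integral_mono (hint n).norm (integrable_const _) (hbound n)) ?_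
    simp_rw [integral_const]
    exact ((summable_geometric_of_lt_one (abs_nonneg _) hg1).mul_left K).const_smul _
  have h := hasSum_integral_of_summable_integral_norm hint hsum
  have h1 : ∀ t, ∑' n, F n t = k t * resolventRe (latticeCharFun ν t * latticeCharFun ρ s) := by
    intro t
    have hlt : ‖latticeCharFun ν t * latticeCharFun ρ s‖ < 1 := by
      rw [norm_mul]
      exact (mul_le_of_le_one_left (norm_nonneg _) (norm_latticeCharFun_le_one ν t)).trans_lt hs
    rw [← (hasSum_resolventRe hlt).tsum_eq, ← tsum_mul_left]
    refine tsum_congr fun n => ?_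
    rw [re_charFun_mul_pow ν ρ hρ]
  have h2 : ∀ n, ∫ t, F n t ∂periodMeasure =
      (∫ t, k t * (latticeCharFun ν t ^ n).re ∂periodMeasure) * g ^ n := by
    intro n
    rw [← integral_mul_const]
    simp only [hF, mul_assoc]
  simp_rw [h1, h2] at h
  exact h

/-- Exchange of the sum and the integral in the second variable. The summability assumption says
that the Green function of the pair is finite. -/
theorem hasSum_integral_lawTailSeries_mul {r : ℝ} (hr0 : 0 ≤ r) (hr1 : r < 1)
    (hρ : ρ.map (fun x => -x) = ρ) {u : ℕ → ℝ} {D : ℝ → ℝ}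
    (hu : Summable fun n => |u n| * ∫ s, |(latticeCharFun ρ s).re| ^ n ∂periodMeasure)
    (hD : ∀ᵐ s ∂periodMeasure, HasSum (fun n => u n * (latticeCharFun ρ s).re ^ n) (D s)) :
    HasSum (fun n => u n * (2 * Real.pi * tailWeight ρ r n))
      (∫ s, lawTailSeries ρ r s * D s ∂periodMeasure) := by
  set M := ∑' m, r ^ m * lawTail ρ m with hM
  set F : ℕ → ℝ → ℝ := fun n s =>
    u n * (lawTailSeries ρ r s * (latticeCharFun ρ s).re ^ n) with hF
  have hbound : ∀ n s, ‖F n s‖ ≤ M * (|u n| * |(latticeCharFun ρ s).re| ^ n) := by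
    intro n s
    simp only [hF, norm_mul, norm_pow, Real.norm_eq_abs]
    calc |u n| * (|lawTailSeries ρ r s| * |(latticeCharFun ρ s).re| ^ n)
        ≤ |u n| * (M * |(latticeCharFun ρ s).re| ^ n) := by
          gcongr
          exact abs_lawTailSeries_le ρ hr0 hr1 s
      _ = _ := by ring
  have hc := continuous_latticeCharFun ρ
  have hct := continuous_lawTailSeries ρ hr0 hr1
  have hdom : ∀ n, Integrable (fun s => M * (|u n| * |(latticeCharFun ρ s).re| ^ n))
      periodMeasure := fun n => ((integrable_pow_re_latticeCharFun ρ n).const_mul _).const_mul _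
  have hint : ∀ n, Integrable (F n) periodMeasure := fun n =>
    (hdom n).mono' (Continuous.aestronglyMeasurable
      (continuous_const.mul (hct.mul ((Complex.continuous_re.comp hc).pow n))))
      (ae_of_all _ (hbound n))
  have hsum : Summable fun n => ∫ s, ‖F n s‖ ∂periodMeasure := by
    refine Summable.of_nonneg_of_le (fun m => integral_nonneg fun s => norm_nonneg _)
      (fun n => integral_mono (hint n).norm (hdom n) (hbound n)) ?_
    simp_rw [integral_const_mul]
    exact hu.mul_left M
  have h := hasSum_integral_of_summable_integral_norm hint hsum
  have h1 : ∫ s, ∑' n, F n s ∂periodMeasure = ∫ s, lawTailSeries ρ r s * D s ∂periodMeasure := by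
    refine integral_congr_ae ?_
    filter_upwards [hD] with s hs
    rw [← hs.tsum_eq, ← tsum_mul_left]
    refine tsum_congr fun n => ?_
    simp only [hF]
    ring
  have h2 : ∀ n, ∫ s, F n s ∂periodMeasure = u n * (2 * Real.pi * tailWeight ρ r n) := by
    intro n
    rw [← integral_lawTailSeries_mul_pow ρ hr0 hr1 hρ, ← integral_const_mul]
  simp_rw [h1, h2] at h
  exact h

omit [IsProbabilityMeasure ν] in
/-- For `|φ(t)| < 1` the integral in the second variable is at most `2 π / (1 - |φ(t)|)`, uniformly
in `r`: it pairs the powers of `φ(t)` with weights that do not exceed `1`. -/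
theorem abs_integral_lawIntegrand_le {r : ℝ} (hr0 : 0 ≤ r) (hr1 : r < 1)
    (hρ : ρ.map (fun x => -x) = ρ) {t : ℝ} (ht : ‖latticeCharFun ν t‖ < 1) :
    |∫ s, lawIntegrand ν ρ r t s ∂periodMeasure| ≤ 2 * Real.pi / (1 - ‖latticeCharFun ν t‖) := by
  have habs : ∀ n, |(latticeCharFun ν t ^ n).re| ≤ ‖latticeCharFun ν t‖ ^ n := fun n =>
    (Complex.abs_re_le_norm _).trans (norm_pow _ _).le
  have hgeo := summable_geometric_of_lt_one (norm_nonneg (latticeCharFun ν t)) ht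
  have hu : Summable fun n => |(latticeCharFun ν t ^ n).re| *
      ∫ s, |(latticeCharFun ρ s).re| ^ n ∂periodMeasure := by
    refine Summable.of_nonneg_of_le (fun n => mul_nonneg (abs_nonneg _)
      (integral_nonneg fun s => by positivity)) (fun n => ?_) (hgeo.mul_right (2 * Real.pi))
    have h1 : ∫ s, |(latticeCharFun ρ s).re| ^ n ∂periodMeasure ≤ 2 * Real.pi := by
      refine (integral_mono (integrable_pow_re_latticeCharFun ρ n) (integrable_const 1)
        fun s => pow_le_one₀ (abs_nonneg _) (abs_re_latticeCharFun_le_one ρ s)).trans ?_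
      rw [integral_const, periodMeasure_real_univ, smul_eq_mul, mul_one]
    exact mul_le_mul (habs n) h1 (integral_nonneg fun s => by positivity) (by positivity)
  have h := hasSum_integral_lawTailSeries_mul ρ hr0 hr1 hρ hu
    (D := fun s => resolventRe (latticeCharFun ν t * latticeCharFun ρ s)) (ae_of_all _ fun s => by
      have hlt : ‖latticeCharFun ν t * latticeCharFun ρ s‖ < 1 := by
        rw [norm_mul]
        exact (mul_le_of_le_one_right (norm_nonneg _) (norm_latticeCharFun_le_one ρ s)).trans_lt ht
      have := hasSum_resolventRe hlt
      simp_rw [re_charFun_mul_pow ν ρ hρ] at this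
      exact this)
  have h2 : |∫ s, lawIntegrand ν ρ r t s ∂periodMeasure| ≤
      ∑' n, 2 * Real.pi * ‖latticeCharFun ν t‖ ^ n := by
    unfold lawIntegrand
    rw [← h.tsum_eq, ← Real.norm_eq_abs]
    refine tsum_of_norm_bounded (hgeo.mul_left (2 * Real.pi)).hasSum fun n => ?_
    rw [norm_mul, Real.norm_eq_abs, Real.norm_of_nonneg
      (mul_nonneg Real.two_pi_pos.le (tailWeight_nonneg ρ hr0 n))]
    calc |(latticeCharFun ν t ^ n).re| * (2 * Real.pi * tailWeight ρ r n)
        ≤ ‖latticeCharFun ν t‖ ^ n * (2 * Real.pi * 1) := by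
          have := tailWeight_le_one ρ hr0 hr1 n
          have := tailWeight_nonneg ρ hr0 n
          have := habs n
          gcongr
      _ = _ := by ring
  rwa [tsum_mul_left, tsum_geometric_of_lt_one (norm_nonneg _) ht, ← div_eq_mul_inv] at h2

/-- The kernel method: the integral of the Fourier criterion over `U × U` is, up to a bounded
error, a weighted sum with the Fourier weights of a kernel `k`, provided that the replacement of
the indicator function of `U` by `k` only produces a bounded error. -/
theorem exists_abs_integral_sub_le (hρ : ρ.map (fun x => -x) = ρ)
    (hψ : Integrable (fun p : ℝ × ℝ => resolventRe (latticeCharFun ν p.1 * latticeCharFun ρ p.2))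
      (periodMeasure.prod periodMeasure))
    (hlt : ∀ᵐ s ∂periodMeasure, ‖latticeCharFun ρ s‖ < 1)
    {k : ℝ → ℝ} {K : ℝ} (hkm : Measurable k) (hkb : ∀ t, |k t| ≤ K) {u : ℕ → ℝ}
    (hku : ∀ n, ∫ t, k t * (latticeCharFun ν t ^ n).re ∂periodMeasure = u n)
    (hu : Summable fun n => |u n| * ∫ s, |(latticeCharFun ρ s).re| ^ n ∂periodMeasure)
    {U : Set ℝ} (hU : MeasurableSet U) (hUpi : U ⊆ Set.Ioc (-Real.pi) Real.pi) {η : ℝ}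
    (hη : 0 < η) (hηU : Set.Ioo (-η) η ⊆ U) {B : ℝ}
    (hB : ∀ r ∈ Set.Ioo (0 : ℝ) 1, |∫ t, (k t - U.indicator 1 t) *
      (∫ s, lawIntegrand ν ρ r t s ∂periodMeasure) ∂periodMeasure| ≤ B) :
    ∃ B' : ℝ, ∀ r ∈ Set.Ioo (0 : ℝ) 1,
      Summable (fun n => u n * (2 * Real.pi * tailWeight ρ r n)) ∧
      |(∫ t in U, ∫ s in U, lawIntegrand ν ρ r t s) -
        ∑' n, u n * (2 * Real.pi * tailWeight ρ r n)| ≤ B' := by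
  set ψ : ℝ × ℝ → ℝ := fun p => resolventRe (latticeCharFun ν p.1 * latticeCharFun ρ p.2)
    with hψdef
  set Q := periodMeasure.prod periodMeasure with hQ
  have hψ0 : ∀ p, 0 ≤ ψ p := fun p => resolventRe_nonneg (norm_charFun_mul_le_one ν ρ p.1 p.2)
  refine ⟨Real.pi / η * ∫ p, ψ p ∂Q + B, fun r hr => ?_⟩
  have hr0 := hr.1.le
  have hr1 := hr.2
  have hf := integrable_lawIntegrand ν ρ hr0 hr1 hψ
  set f : ℝ × ℝ → ℝ := fun p => lawIntegrand ν ρ r p.1 p.2 with hfdef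
  have hres : periodMeasure.restrict U = volume.restrict U := by
    rw [periodMeasure, Measure.restrict_restrict hU, Set.inter_eq_left.2 hUpi]
  have hI : ∫ t in U, ∫ s in U, lawIntegrand ν ρ r t s = ∫ p in U ×ˢ U, f p ∂Q := by
    rw [← hres, hQ, setIntegral_prod f hf.integrableOn]
  have hJ1 : ∫ t, U.indicator 1 t * (∫ s, lawIntegrand ν ρ r t s ∂periodMeasure) ∂periodMeasure =
      ∫ p in U ×ˢ Set.univ, f p ∂Q := by
    rw [hQ, setIntegral_prod f hf.integrableOn, ← integral_indicator hU]
    refine integral_congr_ae (ae_of_all _ fun t => ?_)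
    by_cases ht : t ∈ U
    · simp [ht, hfdef]
    · simp [ht]
  -- The points of `U ×ˢ univ` outside `U ×ˢ U` satisfy `|s| ≥ η`, whence `|Φ(r, s)| ≤ π / η`.
  have hdiff : |(∫ p in U ×ˢ Set.univ, f p ∂Q) - ∫ p in U ×ˢ U, f p ∂Q| ≤
      Real.pi / η * ∫ p, ψ p ∂Q := by
    have hS : MeasurableSet ((U ×ˢ Set.univ) \ U ×ˢ U) :=
      (hU.prod MeasurableSet.univ).diff (hU.prod hU)
    have hae : ∀ᵐ p ∂(Q.restrict ((U ×ˢ Set.univ) \ U ×ˢ U)), ‖f p‖ ≤ Real.pi / η * ψ p := by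
      rw [ae_restrict_iff' hS]
      have hpi : ∀ᵐ p ∂Q, |p.2| ≤ Real.pi :=
        (Measure.quasiMeasurePreserving_snd (μ := periodMeasure)
          (ν := periodMeasure)).ae ae_abs_le_pi
      filter_upwards [hpi] with p hp hpU
      have hpη : η ≤ |p.2| := by
        by_contra hlt'
        rw [not_le, abs_lt] at hlt'
        exact hpU.2 ⟨hpU.1.1, hηU hlt'⟩
      have h1 := abs_lawTailSeries_mul_abs_le ρ hr0 hr1 hp
      have h2 : |lawTailSeries ρ r p.2| ≤ Real.pi / η := by
        rw [le_div_iff₀ hη]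
        exact (mul_le_mul_of_nonneg_left hpη (abs_nonneg _)).trans h1
      simp only [hfdef, lawIntegrand, norm_mul, Real.norm_eq_abs]
      rw [abs_of_nonneg (hψ0 p)]
      exact mul_le_mul_of_nonneg_right h2 (hψ0 p)
    rw [← setIntegral_sdiff (hU.prod hU) hf.integrableOn (Set.prod_mono le_rfl (Set.subset_univ U)),
      ← integral_const_mul, ← Real.norm_eq_abs]
    exact (norm_integral_le_of_norm_le (hψ.const_mul (Real.pi / η)).integrableOn hae).trans
      (setIntegral_le_integral (hψ.const_mul _)
        (ae_of_all _ fun p => mul_nonneg (by positivity) (hψ0 p)))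
  have hkf : Integrable (fun p : ℝ × ℝ => k p.1 * f p) Q :=
    hf.bdd_mul (c := K) (hkm.comp measurable_fst).aestronglyMeasurable
      (ae_of_all _ fun p => hkb p.1)
  have hsumE := hasSum_integral_lawTailSeries_mul ρ hr0 hr1 hρ hu
    (D := fun s => ∫ t, k t * resolventRe (latticeCharFun ν t * latticeCharFun ρ s)
      ∂periodMeasure) (by
      filter_upwards [hlt] with s hs
      have := integral_kernel_mul_resolventRe ν ρ hρ hkm hkb hs
      simp_rw [hku] at this
      exact this)
  have hJ2 : ∫ t, k t * (∫ s, lawIntegrand ν ρ r t s ∂periodMeasure) ∂periodMeasure =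
      ∑' n, u n * (2 * Real.pi * tailWeight ρ r n) := by
    rw [hsumE.tsum_eq]
    simp_rw [← integral_const_mul]
    rw [integral_integral_swap hkf]
    refine integral_congr_ae (ae_of_all _ fun s => integral_congr_ae (ae_of_all _ fun t => ?_))
    simp only [lawIntegrand]
    ring
  refine ⟨hsumE.summable, ?_⟩
  have hleft : Integrable (fun t => ∫ s, lawIntegrand ν ρ r t s ∂periodMeasure) periodMeasure :=
    hf.integral_prod_left
  have hint1 : Integrable (fun t => k t * ∫ s, lawIntegrand ν ρ r t s ∂periodMeasure)
      periodMeasure := hleft.bdd_mul hkm.aestronglyMeasurable (ae_of_all _ hkb)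
  have hind : Measurable (U.indicator (1 : ℝ → ℝ)) := measurable_one.indicator hU
  have hint2 : Integrable (fun t => U.indicator 1 t * ∫ s, lawIntegrand ν ρ r t s ∂periodMeasure)
      periodMeasure := hleft.bdd_mul (c := 1) hind.aestronglyMeasurable (ae_of_all _ fun t => by
        by_cases ht : t ∈ U <;> simp [ht])
  have hBr := hB r hr
  simp_rw [sub_mul] at hBr
  rw [integral_sub hint1 hint2, hJ1, hJ2] at hBr
  rw [hI]
  rw [abs_le] at hBr hdiff ⊢
  constructor <;> linarith

end

section

variable (ν ρ : Measure ℤ) [IsProbabilityMeasure ν] [IsProbabilityMeasure ρ]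

/-- The absolute moments of a real characteristic function are bounded by the probabilities of a
window around the origin: those of even order are return probabilities, and those of odd order
are smaller than the preceding ones. -/
theorem exists_integral_abs_pow_le (hρ : ρ.map (fun x => -x) = ρ) {y₀ : ℕ}
    (hy₀ : ρ {x | |x| ≤ y₀} ≠ 0) :
    ∃ C : ℝ, 0 ≤ C ∧ ∀ n, ∫ s, |(latticeCharFun ρ s).re| ^ n ∂periodMeasure ≤
      C * (walkLaw ρ n).real {x | |x| ≤ y₀} := by
  set c := ρ.real {x | |x| ≤ y₀} with hc
  have hc0 : 0 < c := ENNReal.toReal_pos hy₀ (measure_ne_top _ _)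
  have hc1 : c ≤ 1 := measureReal_le_one
  have hpi := Real.pi_pos
  have heven : ∀ l, ∫ s, |(latticeCharFun ρ s).re| ^ (2 * l) ∂periodMeasure ≤
      2 * Real.pi * (walkLaw ρ (2 * l)).real {x | |x| ≤ y₀} := by
    intro l
    have h1 : ∫ s, |(latticeCharFun ρ s).re| ^ (2 * l) ∂periodMeasure =
        2 * Real.pi * (walkLaw ρ (2 * l)).real {0} := by
      have h := integral_latticeCharFun_pow ρ (2 * l)
      have h2 : ∀ s, latticeCharFun ρ s ^ (2 * l) =
          ((|(latticeCharFun ρ s).re| ^ (2 * l) : ℝ) : ℂ) := by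
        intro s
        rw [pow_mul |_| 2 l, sq_abs, ← pow_mul]
        conv_lhs => rw [latticeCharFun_eq_ofReal hρ]
        push_cast
        rfl
      simp_rw [h2] at h
      rw [integral_complex_ofReal] at h
      exact_mod_cast h
    rw [h1]
    have : (walkLaw ρ (2 * l)).real {0} ≤ (walkLaw ρ (2 * l)).real {x | |x| ≤ y₀} :=
      measureReal_mono (by intro x hx; simp only [Set.mem_singleton_iff] at hx; simp [hx])
    gcongr
  refine ⟨2 * Real.pi * (2 / c), by positivity, fun n => ?_⟩
  have h2c : 1 ≤ 2 / c := by rw [le_div_iff₀ hc0]; linarith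
  rcases Nat.even_or_odd' n with ⟨l, rfl | rfl⟩
  · refine (heven l).trans ?_
    rw [mul_assoc _ (2 / c)]
    refine mul_le_mul_of_nonneg_left ?_ (by positivity)
    exact le_mul_of_one_le_left measureReal_nonneg h2c
  · have h1 : ∫ s, |(latticeCharFun ρ s).re| ^ (2 * l + 1) ∂periodMeasure ≤
        ∫ s, |(latticeCharFun ρ s).re| ^ (2 * l) ∂periodMeasure :=
      integral_mono (integrable_pow_re_latticeCharFun ρ _) (integrable_pow_re_latticeCharFun ρ _)
        fun s => pow_le_pow_of_le_one (abs_nonneg _) (abs_re_latticeCharFun_le_one ρ s)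
          (Nat.le_succ _)
    have h2 := ENNReal.toReal_mono (by finiteness) (walkLaw_Icc_le_succ hρ (le_refl y₀) (2 * l))
    rw [ENNReal.toReal_mul, ENNReal.toReal_mul, ENNReal.toReal_ofNat] at h2
    change c * (walkLaw ρ (2 * l)).real {x | |x| ≤ y₀} ≤
      2 * (walkLaw ρ (2 * l + 1)).real {x | |x| ≤ y₀} at h2
    refine h1.trans ((heven l).trans ?_)
    rw [mul_assoc _ (2 / c)]
    refine mul_le_mul_of_nonneg_left ?_ (by positivity)
    rw [div_mul_eq_mul_div, le_div_iff₀ hc0]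
    linarith

/-- Finiteness of the Green function, in the form in which the second walk enters through the
absolute moments of its characteristic function. -/
theorem summable_walkLaw_mul_integral (hρ : ρ.map (fun x => -x) = ρ) {y₀ : ℕ}
    (hy₀ : ρ {x | |x| ≤ y₀} ≠ 0)
    (hG : ∑' n, walkLaw ν n {0} * walkLaw ρ n {x | |x| ≤ y₀} ≠ ∞) (x : ℤ) :
    Summable fun n => (walkLaw ν n).real {x} *
      ∫ s, |(latticeCharFun ρ s).re| ^ n ∂periodMeasure := by
  obtain ⟨C, hC, hle⟩ := exists_walkLaw_shift_le hρ hy₀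
  have h1 := tsum_walkLaw_mul_le ν (fun n => walkLaw ρ n {x | |x| ≤ y₀}) C (fun m n hmn => by
    simpa only [add_zero] using hle y₀ le_rfl m n hmn 0) x
  have h2 := ENNReal.summable_toReal (ne_top_of_le_ne_top (ENNReal.mul_ne_top hC hG) h1)
  obtain ⟨D, hD, hDle⟩ := exists_integral_abs_pow_le ρ hρ hy₀
  refine Summable.of_nonneg_of_le (fun n => mul_nonneg measureReal_nonneg
    (integral_nonneg fun s => by positivity)) (fun n => ?_) (h2.mul_left D)
  rw [ENNReal.toReal_mul]
  calc (walkLaw ν n).real {x} * ∫ s, |(latticeCharFun ρ s).re| ^ n ∂periodMeasure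
      ≤ (walkLaw ν n).real {x} * (D * (walkLaw ρ n).real {x | |x| ≤ y₀}) :=
        mul_le_mul_of_nonneg_left (hDle n) measureReal_nonneg
    _ = D * ((walkLaw ν n).real {x} * (walkLaw ρ n).real {x | |x| ≤ y₀}) := by ring

theorem overlap_eq_tsum (n : ℕ) :
    overlap ρ n = ∑' x : ℤ, ENNReal.ofReal (lawTail ρ x.natAbs) * walkLaw ρ n {x} := by
  rw [overlap, Measure.prod_apply MeasurableSet.of_discrete, lintegral_countable']
  refine tsum_congr fun x => ?_
  rw [lawTail, ofReal_measureReal, Int.natCast_natAbs]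
  rfl

/-- The one-sided version of `overlap`, which is the value at `r = 1` of `tailWeight`. -/
theorem overlap_le_two_mul_tsum (hρ : ρ.map (fun x => -x) = ρ) (n : ℕ) :
    overlap ρ n ≤ 2 * ∑' m : ℕ, ENNReal.ofReal (lawTail ρ m) * walkLaw ρ n {(m : ℤ)} := by
  set f : ℤ → ℝ≥0∞ := fun x => ENNReal.ofReal (lawTail ρ x.natAbs) * walkLaw ρ n {x} with hf
  have hneg : ∀ x, f (-x) = f x := by
    intro x
    have : walkLaw ρ n {-x} = walkLaw ρ n {x} := by
      rw [← measure_neg_eq (map_neg_walkLaw hρ n) {-x}]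
      congr 1
      ext z
      simp
    simp only [hf, this, Int.natAbs_neg]
  have hsplit := tsum_of_nat_of_neg_add_one (f := f) ENNReal.summable ENNReal.summable
  rw [overlap_eq_tsum]
  change ∑' x, f x ≤ 2 * ∑' m : ℕ, f (m : ℤ)
  rw [hsplit, two_mul]
  refine add_le_add le_rfl ?_
  simp_rw [hneg]
  have h1 : ∑' m : ℕ, f (m : ℤ) = f 0 + ∑' m : ℕ, f ((m : ℤ) + 1) := by
    rw [tsum_eq_zero_add' ENNReal.summable]
    simp
  rw [h1]
  exact le_add_self

theorem tsum_le_overlap (n : ℕ) :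
    ∑' m : ℕ, ENNReal.ofReal (lawTail ρ m) * walkLaw ρ n {(m : ℤ)} ≤ overlap ρ n := by
  rw [overlap_eq_tsum]
  exact ENNReal.tsum_comp_le_tsum_of_injective Nat.cast_injective
    fun x : ℤ => ENNReal.ofReal (lawTail ρ x.natAbs) * walkLaw ρ n {x}

/-- Abel's theorem for series with nonnegative terms: a weighted sum of the `tailWeight`s tends to
infinity as `r ↑ 1` if and only if the corresponding sum of overlaps diverges. -/
theorem tendsto_tsum_tailWeight_iff (hρ : ρ.map (fun x => -x) = ρ) {u : ℕ → ℝ}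
    (hu : ∀ n, 0 ≤ u n)
    (hs : ∀ r ∈ Set.Ioo (0 : ℝ) 1, Summable fun n => u n * (2 * Real.pi * tailWeight ρ r n)) :
    Tendsto (fun r => ∑' n, u n * (2 * Real.pi * tailWeight ρ r n)) (𝓝[<] 1) atTop ↔
      ∑' n, ENNReal.ofReal (u n) * overlap ρ n = ∞ := by
  set F : ℝ → ℝ≥0∞ := fun r => ∑' n, ENNReal.ofReal (u n) * (ENNReal.ofReal (2 * Real.pi) *
    ∑' m : ℕ, ENNReal.ofReal (r ^ m) * (ENNReal.ofReal (lawTail ρ m) * walkLaw ρ n {(m : ℤ)}))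
    with hF
  have hFr : ∀ r ∈ Set.Ioo (0 : ℝ) 1,
      ENNReal.ofReal (∑' n, u n * (2 * Real.pi * tailWeight ρ r n)) = F r := by
    intro r hr
    rw [ENNReal.ofReal_tsum_of_nonneg (fun n => mul_nonneg (hu n) (mul_nonneg Real.two_pi_pos.le
      (tailWeight_nonneg ρ hr.1.le n))) (hs r hr)]
    refine tsum_congr fun n => ?_
    rw [ENNReal.ofReal_mul (hu n), ENNReal.ofReal_mul Real.two_pi_pos.le, tailWeight,
      ENNReal.ofReal_tsum_of_nonneg (fun m => mul_nonneg (pow_mul_lawTail_nonneg ρ hr.1.le m)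
        measureReal_nonneg) (summable_tailWeight ρ hr.1.le hr.2 n)]
    congr 2
    refine tsum_congr fun m => ?_
    rw [mul_assoc, ENNReal.ofReal_mul (pow_nonneg hr.1.le m),
      ENNReal.ofReal_mul (lawTail_nonneg ρ m), ofReal_measureReal]
  have hF1 : F 1 = ∞ ↔ ∑' n, ENNReal.ofReal (u n) * overlap ρ n = ∞ := by
    simp only [hF, one_pow, ENNReal.ofReal_one, one_mul]
    constructor
    · refine ENNReal.tsum_eq_top_of_le_mul (C := ENNReal.ofReal (2 * Real.pi))
        ENNReal.ofReal_ne_top fun n => ?_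
      rw [mul_left_comm]
      gcongr
      exact tsum_le_overlap ρ n
    · refine ENNReal.tsum_eq_top_of_le_mul (C := 2) (by simp) fun n => ?_
      rw [mul_left_comm]
      gcongr
      refine (overlap_le_two_mul_tsum ρ hρ n).trans ?_
      gcongr
      refine le_mul_of_one_le_left (by simp) ?_
      rw [ENNReal.one_le_ofReal]
      linarith [Real.pi_gt_three]
  have hmem : ∀ᶠ r in 𝓝[<] (1 : ℝ), r ∈ Set.Ioo (0 : ℝ) 1 := Ioo_mem_nhdsLT one_pos
  rw [← hF1]
  constructor
  · intro h
    by_contra htop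
    have hbdd : ∀ r ∈ Set.Ioo (0 : ℝ) 1,
        ∑' n, u n * (2 * Real.pi * tailWeight ρ r n) ≤ (F 1).toReal := by
      intro r hr
      rw [← ENNReal.ofReal_le_iff_le_toReal htop, hFr r hr]
      simp only [hF]
      refine ENNReal.tsum_le_tsum fun n => ?_
      gcongr
      exacts [hr.1.le, hr.2.le]
    obtain ⟨r, hr1, hr2⟩ := (hmem.and (h.eventually_gt_atTop (F 1).toReal)).exists
    exact absurd (hbdd r hr1) (not_le.2 hr2)
  · intro htop
    -- A series of continuous nonnegative functions is lower semicontinuous, so `F 1 = ∞` forces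
    -- `F r → ∞`.
    have hlsc : LowerSemicontinuous F := by
      refine lowerSemicontinuous_tsum fun n => ?_
      have h1 : LowerSemicontinuous fun r : ℝ => ∑' m : ℕ, ENNReal.ofReal (r ^ m) *
          (ENNReal.ofReal (lawTail ρ m) * walkLaw ρ n {(m : ℤ)}) := by
        refine lowerSemicontinuous_tsum fun m => Continuous.lowerSemicontinuous ?_
        exact ENNReal.continuous_mul_const (by finiteness) |>.comp
          (ENNReal.continuous_ofReal.comp (continuous_pow m))
      have h2 := (ENNReal.continuous_const_mul (a := ENNReal.ofReal (u n) *
        ENNReal.ofReal (2 * Real.pi)) (by finiteness)).comp_lowerSemicontinuous h1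
        fun a b hab => mul_le_mul_right hab _
      simpa only [Function.comp_def, mul_assoc] using h2
    rw [tendsto_atTop]
    intro b
    have h1 := (hlsc 1 (ENNReal.ofReal b) (by simp [htop])).filter_mono
      (nhdsWithin_le_nhds (s := Set.Iio 1))
    filter_upwards [h1, hmem] with r hr1 hr2
    rw [← hFr r hr2] at hr1
    exact (lt_of_not_ge fun h => absurd hr1 (not_lt.2 (ENNReal.ofReal_le_ofReal h))).le

/-- The Fourier criterion for a kernel that satisfies the assumptions of
`exists_abs_integral_sub_le` and has nonnegative Fourier weights. -/
theorem tendsto_integral_iff_of_kernel (hρ : ρ.map (fun x => -x) = ρ)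
    (hψ : Integrable (fun p : ℝ × ℝ => resolventRe (latticeCharFun ν p.1 * latticeCharFun ρ p.2))
      (periodMeasure.prod periodMeasure))
    (hlt : ∀ᵐ s ∂periodMeasure, ‖latticeCharFun ρ s‖ < 1)
    {k : ℝ → ℝ} {K : ℝ} (hkm : Measurable k) (hkb : ∀ t, |k t| ≤ K) {u : ℕ → ℝ}
    (hu0 : ∀ n, 0 ≤ u n)
    (hku : ∀ n, ∫ t, k t * (latticeCharFun ν t ^ n).re ∂periodMeasure = u n)
    (hu : Summable fun n => u n * ∫ s, |(latticeCharFun ρ s).re| ^ n ∂periodMeasure)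
    {U : Set ℝ} (hU : MeasurableSet U) (hUpi : U ⊆ Set.Ioc (-Real.pi) Real.pi) {η : ℝ}
    (hη : 0 < η) (hηU : Set.Ioo (-η) η ⊆ U) {B : ℝ}
    (hB : ∀ r ∈ Set.Ioo (0 : ℝ) 1, |∫ t, (k t - U.indicator 1 t) *
      (∫ s, lawIntegrand ν ρ r t s ∂periodMeasure) ∂periodMeasure| ≤ B) :
    Tendsto (fun r => ∫ t in U, ∫ s in U, lawIntegrand ν ρ r t s) (𝓝[<] 1) atTop ↔
      ∑' n, ENNReal.ofReal (u n) * overlap ρ n = ∞ := by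
  obtain ⟨B', hB'⟩ := exists_abs_integral_sub_le ν ρ hρ hψ hlt hkm hkb hku
    (by simpa only [abs_of_nonneg (hu0 _)] using hu) hU hUpi hη hηU hB
  rw [← tendsto_tsum_tailWeight_iff ρ hρ hu0 fun r hr => (hB' r hr).1]
  have hmem : ∀ᶠ r in 𝓝[<] (1 : ℝ), r ∈ Set.Ioo (0 : ℝ) 1 := Ioo_mem_nhdsLT one_pos
  constructor
  · intro h
    refine tendsto_atTop_mono' _ ?_ (tendsto_atTop_add_const_right _ (-B') h)
    filter_upwards [hmem] with r hr
    have := (abs_le.1 (hB' r hr).2).2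
    linarith
  · intro h
    refine tendsto_atTop_mono' _ ?_ (tendsto_atTop_add_const_right _ (-B') h)
    filter_upwards [hmem] with r hr
    have := (abs_le.1 (hB' r hr).2).1
    linarith

end

/-! ### The Fejér kernel -/

/-- The Fejér kernel, normalised to take the value `1` at `0`. -/
noncomputable def fejerKernel (d : ℕ) (t : ℝ) : ℝ :=
  (∑ j ∈ Finset.range d, ∑ l ∈ Finset.range d, Real.cos (((j : ℤ) - l : ℤ) * t)) / d ^ 2

theorem measurable_fejerKernel (d : ℕ) : Measurable (fejerKernel d) := by
  unfold fejerKernel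
  fun_prop

theorem sum_sum_cos_eq_normSq (d : ℕ) (t : ℝ) :
    ∑ j ∈ Finset.range d, ∑ l ∈ Finset.range d, Real.cos (((j : ℤ) - l : ℤ) * t) =
      Complex.normSq (∑ j ∈ Finset.range d, Complex.exp (t * Complex.I) ^ j) := by
  have h1 : ∀ j : ℕ, Complex.exp (t * Complex.I) ^ j =
      Complex.exp (((j * t : ℝ) : ℂ) * Complex.I) := by
    intro j
    rw [← Complex.exp_nat_mul]
    push_cast
    ring_nf
  simp_rw [h1]
  rw [Complex.normSq_apply, Complex.re_sum, Complex.im_sum]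
  simp_rw [Complex.exp_ofReal_mul_I_re, Complex.exp_ofReal_mul_I_im]
  rw [Finset.sum_mul_sum, Finset.sum_mul_sum, ← Finset.sum_add_distrib]
  refine Finset.sum_congr rfl fun j _ => ?_
  rw [← Finset.sum_add_distrib]
  refine Finset.sum_congr rfl fun l _ => ?_
  rw [← Real.cos_sub]
  push_cast
  ring_nf

theorem fejerKernel_nonneg (d : ℕ) (t : ℝ) : 0 ≤ fejerKernel d t := by
  rw [fejerKernel, sum_sum_cos_eq_normSq]
  exact div_nonneg (Complex.normSq_nonneg _) (by positivity)

theorem one_sub_fejerKernel {d : ℕ} (hd : 0 < d) (t : ℝ) : 1 - fejerKernel d t =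
    (∑ j ∈ Finset.range d, ∑ l ∈ Finset.range d,
      (1 - Real.cos (((j : ℤ) - l : ℤ) * t))) / d ^ 2 := by
  have hd' : (d : ℝ) ≠ 0 := by positivity
  simp only [Finset.sum_sub_distrib, Finset.sum_const, Finset.card_range, nsmul_eq_mul, mul_one]
  rw [fejerKernel, sub_div, ← sq, div_self (by positivity)]

theorem fejerKernel_le_one {d : ℕ} (hd : 0 < d) (t : ℝ) : fejerKernel d t ≤ 1 := by
  have h := one_sub_fejerKernel hd t
  have : 0 ≤ 1 - fejerKernel d t := by
    rw [h]
    exact div_nonneg (Finset.sum_nonneg fun j _ => Finset.sum_nonneg fun l _ =>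
      sub_nonneg.2 (Real.cos_le_one _)) (by positivity)
  linarith

theorem one_sub_fejerKernel_le {d : ℕ} (hd : 0 < d) (t : ℝ) :
    1 - fejerKernel d t ≤ (d * t) ^ 2 / 2 := by
  rw [one_sub_fejerKernel hd, div_le_iff₀ (by positivity)]
  calc ∑ j ∈ Finset.range d, ∑ l ∈ Finset.range d, (1 - Real.cos (((j : ℤ) - l : ℤ) * t))
      ≤ ∑ j ∈ Finset.range d, ∑ l ∈ Finset.range d, (d * t) ^ 2 / 2 := by
        refine Finset.sum_le_sum fun j hj => Finset.sum_le_sum fun l hl => ?_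
        have h1 := Real.one_sub_sq_div_two_le_cos (x := ((j : ℤ) - l : ℤ) * t)
        have hj' : (j : ℝ) < d := by exact_mod_cast Finset.mem_range.1 hj
        have hl' : (l : ℝ) < d := by exact_mod_cast Finset.mem_range.1 hl
        have hj0 : (0 : ℝ) ≤ j := by positivity
        have hl0 : (0 : ℝ) ≤ l := by positivity
        have h2 : (((j : ℤ) - l : ℤ) : ℝ) ^ 2 ≤ (d : ℝ) ^ 2 := by
          push_cast
          exact sq_le_sq.2 (by rw [Nat.abs_cast]; exact abs_le.2 ⟨by linarith, by linarith⟩)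
        rw [mul_pow] at h1 ⊢
        have := mul_le_mul_of_nonneg_right h2 (sq_nonneg t)
        linarith
    _ = (d * t) ^ 2 / 2 * d ^ 2 := by
        simp only [Finset.sum_const, Finset.card_range, nsmul_eq_mul]
        ring

/-- The zeros of the Fejér kernel are those of `1 - cos (d t)`, with the exception of the multiples
of `2 π`. -/
theorem fejerKernel_mul_one_sub_cos {d : ℕ} (hd : 0 < d) (t : ℝ) :
    fejerKernel d t * (d ^ 2 * (1 - Real.cos t)) = 1 - Real.cos (d * t) := by
  have hns : ∀ x : ℝ, Complex.normSq (Complex.exp (x * Complex.I) - 1) = 2 * (1 - Real.cos x) := by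
    intro x
    rw [Complex.normSq_apply, Complex.sub_re, Complex.sub_im, Complex.exp_ofReal_mul_I_re,
      Complex.exp_ofReal_mul_I_im, Complex.one_re, Complex.one_im]
    linear_combination Real.sin_sq_add_cos_sq x
  have h := congrArg Complex.normSq (geom_sum_mul (Complex.exp (t * Complex.I)) d)
  have h1 : Complex.exp (t * Complex.I) ^ d = Complex.exp (((d * t : ℝ) : ℂ) * Complex.I) := by
    rw [← Complex.exp_nat_mul]
    push_cast
    ring_nf
  rw [map_mul, h1, hns, hns, ← sum_sum_cos_eq_normSq] at h
  have hd' : (d : ℝ) ≠ 0 := by positivity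
  rw [fejerKernel]
  field_simp
  rw [mul_comm t]
  linarith

/-- The Fejér kernel agrees with the indicator function of a small neighbourhood `U` of `0` up to an
error that vanishes with `1 - cos (d t)`. -/
theorem abs_fejerKernel_sub_indicator_le {d : ℕ} (hd : 0 < d) {U : Set ℝ}
    (hUd : U ⊆ Set.Ioo (-(1 / d)) (1 / d : ℝ)) {η : ℝ} (hη : 0 < η)
    (hηU : Set.Ioo (-η) η ⊆ U) {t : ℝ} (ht : |t| ≤ Real.pi) :
    |fejerKernel d t - U.indicator 1 t| ≤
      (Real.pi ^ 2 / 4 + Real.pi ^ 2 / (2 * η ^ 2 * d ^ 2)) * (1 - Real.cos (d * t)) := by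
  have hd' : (0 : ℝ) < d := by exact_mod_cast hd
  have hpi := Real.pi_pos
  have hcos : 0 ≤ 1 - Real.cos (d * t) := sub_nonneg.2 (Real.cos_le_one _)
  rw [add_mul]
  by_cases htU : t ∈ U
  · have h1 := Real.cos_le_one_sub_mul_cos_sq (x := d * t) (by
      have := abs_lt.2 (hUd htU)
      rw [abs_mul, Nat.abs_cast]
      rw [lt_div_iff₀ hd'] at this
      linarith [Real.pi_gt_three])
    have h2 := one_sub_fejerKernel_le hd t
    have h3 := fejerKernel_le_one hd t
    rw [Set.indicator_of_mem htU, Pi.one_apply, abs_sub_comm, abs_of_nonneg (by linarith)]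
    have h4 : 2 / Real.pi ^ 2 * (d * t) ^ 2 ≤ 1 - Real.cos (d * t) := by linarith
    have h5 : (d * t) ^ 2 / 2 = Real.pi ^ 2 / 4 * (2 / Real.pi ^ 2 * (d * t) ^ 2) := by
      field_simp
      norm_num
    have h6 : Real.pi ^ 2 / 4 * (2 / Real.pi ^ 2 * (d * t) ^ 2) ≤
        Real.pi ^ 2 / 4 * (1 - Real.cos (d * t)) := by gcongr
    have h7 : 0 ≤ Real.pi ^ 2 / (2 * η ^ 2 * d ^ 2) * (1 - Real.cos (d * t)) := by positivity
    linarith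
  · have htη : η ≤ |t| := by
      by_contra h
      exact htU (hηU (abs_lt.1 (not_le.1 h)))
    rw [Set.indicator_of_notMem htU, sub_zero, abs_of_nonneg (fejerKernel_nonneg d t)]
    have h1 := Real.cos_le_one_sub_mul_cos_sq ht
    have h2 : η ^ 2 ≤ t ^ 2 := by
      rw [← sq_abs t]
      gcongr
    have h3 : 2 / Real.pi ^ 2 * η ^ 2 ≤ 1 - Real.cos t := by
      have : 2 / Real.pi ^ 2 * η ^ 2 ≤ 2 / Real.pi ^ 2 * t ^ 2 := by gcongr
      linarith
    have h4 := fejerKernel_mul_one_sub_cos hd t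
    have h5 : fejerKernel d t = Real.pi ^ 2 / (2 * η ^ 2 * d ^ 2) *
        (fejerKernel d t * (d ^ 2 * (2 / Real.pi ^ 2 * η ^ 2))) := by
      field_simp
    have h6 : Real.pi ^ 2 / (2 * η ^ 2 * d ^ 2) *
        (fejerKernel d t * (d ^ 2 * (2 / Real.pi ^ 2 * η ^ 2))) ≤
        Real.pi ^ 2 / (2 * η ^ 2 * d ^ 2) * (1 - Real.cos (d * t)) := by
      rw [← h4]
      have := fejerKernel_nonneg d t
      gcongr
    have h7 : 0 ≤ Real.pi ^ 2 / 4 * (1 - Real.cos (d * t)) := by positivity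
    linarith

section

variable (ν ρ : Measure ℤ) [IsProbabilityMeasure ν] [IsProbabilityMeasure ρ]

/-- The weight of the `n`-th power in the kernel method, for the Fejér kernel: up to normalisation,
the probability that the walk is at the difference of two independent uniform points of
`{0, …, d - 1}`. -/
noncomputable def fejerWeight (d n : ℕ) : ℝ :=
  (∑ j ∈ Finset.range d, ∑ l ∈ Finset.range d,
    Real.pi * ((walkLaw ν n).real {(j : ℤ) - l} + (walkLaw ν n).real {-((j : ℤ) - l)})) / d ^ 2

omit [IsProbabilityMeasure ν] in
theorem fejerWeight_nonneg (d n : ℕ) : 0 ≤ fejerWeight ν d n := by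
  have := Real.pi_pos
  unfold fejerWeight
  positivity

theorem integral_fejerKernel_mul (d n : ℕ) :
    ∫ t, fejerKernel d t * (latticeCharFun ν t ^ n).re ∂periodMeasure = fejerWeight ν d n := by
  have hc := continuous_latticeCharFun ν
  have hint : ∀ m : ℤ, Integrable (fun t : ℝ => latticeCharFun ν t ^ n *
      (Real.cos (m * t) : ℂ)) periodMeasure := by
    intro m
    refine (integrable_const (1 : ℝ)).mono' (Continuous.aestronglyMeasurable (by fun_prop))
      (ae_of_all _ fun t => ?_)
    rw [norm_mul, norm_pow, Complex.norm_real, Real.norm_eq_abs]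
    exact mul_le_one₀ (pow_le_one₀ (norm_nonneg _) (norm_latticeCharFun_le_one ν t))
      (abs_nonneg _) (Real.abs_cos_le_one _)
  have hre : ∀ (m : ℤ) (t : ℝ), (latticeCharFun ν t ^ n * (Real.cos (m * t) : ℂ)).re =
      Real.cos (m * t) * (latticeCharFun ν t ^ n).re := by
    intro m t
    rw [Complex.re_mul_ofReal, mul_comm]
  have hint' : ∀ m : ℤ, Integrable (fun t : ℝ => Real.cos (m * t) * (latticeCharFun ν t ^ n).re)
      periodMeasure := by
    intro m
    have := (hint m).re
    simpa only [RCLike.re_eq_complex_re, hre] using this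
  have hval : ∀ m : ℤ, ∫ t, Real.cos (m * t) * (latticeCharFun ν t ^ n).re ∂periodMeasure =
      Real.pi * ((walkLaw ν n).real {m} + (walkLaw ν n).real {-m}) := by
    intro m
    have h := integral_latticeCharFun_mul_cos (walkLaw ν n) m
    simp_rw [latticeCharFun_walkLaw] at h
    have h2 := integral_re (hint m)
    simp only [RCLike.re_eq_complex_re, hre] at h2
    rw [h2, h, Complex.ofReal_re]
  simp only [fejerKernel, fejerWeight, div_mul_eq_mul_div, Finset.sum_mul]
  rw [integral_div, integral_finsetSum _ fun j _ => integrable_finsetSum _ fun l _ => hint' _]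
  congr 1
  refine Finset.sum_congr rfl fun j _ => ?_
  rw [integral_finsetSum _ fun l _ => hint' _]
  exact Finset.sum_congr rfl fun l _ => hval _

omit [IsProbabilityMeasure ν] in
theorem summable_fejerWeight_mul {w : ℕ → ℝ}
    (hw : ∀ x, Summable fun n => (walkLaw ν n).real {x} * w n) (d : ℕ) :
    Summable fun n => fejerWeight ν d n * w n := by
  simp only [fejerWeight, div_mul_eq_mul_div, Finset.sum_mul]
  refine Summable.div_const (summable_sum fun j _ => summable_sum fun l _ => ?_) _
  simp only [mul_assoc, add_mul]
  exact ((hw _).add (hw _)).mul_left _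

/-- The Fejér weights may be replaced by the return probabilities. -/
theorem tsum_fejerWeight_mul_eq_top_iff {d : ℕ} (hd : 0 < d) {w : ℕ → ℝ≥0∞} {C : ℝ≥0∞}
    (hC : C ≠ ∞) (hw : ∀ m n, m ≤ n → w n ≤ C * w m) :
    ∑' n, ENNReal.ofReal (fejerWeight ν d n) * w n = ∞ ↔ ∑' n, walkLaw ν n {0} * w n = ∞ := by
  have hpi := Real.pi_pos
  have hd' : (1 : ℝ) ≤ d := by exact_mod_cast hd
  constructor
  · intro h
    by_contra hfin
    have hx : ∀ x, ∑' n, walkLaw ν n {x} * w n ≠ ∞ := fun x =>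
      ne_top_of_le_ne_top (ENNReal.mul_ne_top hC hfin) (tsum_walkLaw_mul_le ν w C hw x)
    refine absurd h (ne_top_of_le_ne_top (b := ∑ j ∈ Finset.range d, ∑ l ∈ Finset.range d,
      ENNReal.ofReal Real.pi * (∑' n, walkLaw ν n {(j : ℤ) - l} * w n +
        ∑' n, walkLaw ν n {-((j : ℤ) - l)} * w n)) ?_ ?_)
    · refine ENNReal.sum_ne_top.2 fun j _ => ENNReal.sum_ne_top.2 fun l _ => ?_
      exact ENNReal.mul_ne_top ENNReal.ofReal_ne_top (ENNReal.add_ne_top.2 ⟨hx _, hx _⟩)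
    · simp_rw [← ENNReal.tsum_add, ← ENNReal.tsum_mul_left]
      simp_rw [← Summable.tsum_finsetSum fun _ _ => ENNReal.summable]
      refine ENNReal.tsum_le_tsum fun n => ?_
      simp_rw [← add_mul, ← mul_assoc, ← Finset.sum_mul]
      gcongr
      refine (ENNReal.ofReal_le_ofReal (div_le_self (by positivity) (one_le_pow₀ hd'))).trans ?_
      rw [ENNReal.ofReal_sum_of_nonneg fun j _ => by positivity]
      refine Finset.sum_le_sum fun j _ => ?_
      rw [ENNReal.ofReal_sum_of_nonneg fun j _ => by positivity]
      refine Finset.sum_le_sum fun l _ => ?_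
      rw [ENNReal.ofReal_mul hpi.le, ENNReal.ofReal_add measureReal_nonneg measureReal_nonneg,
        ofReal_measureReal, ofReal_measureReal]
  · refine ENNReal.tsum_eq_top_of_le_mul (C := ENNReal.ofReal (d ^ 2))
      ENNReal.ofReal_ne_top fun n => ?_
    rw [← mul_assoc, ← ENNReal.ofReal_mul (by positivity), ← ofReal_measureReal (s := {0})]
    gcongr
    rw [fejerWeight, mul_div_cancel₀ _ (by positivity)]
    have h0 : (0 : ℕ) ∈ Finset.range d := Finset.mem_range.2 hd
    calc (walkLaw ν n).real {0} ≤ Real.pi * ((walkLaw ν n).real {((0 : ℕ) : ℤ) - (0 : ℕ)} +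
          (walkLaw ν n).real {-(((0 : ℕ) : ℤ) - (0 : ℕ))}) := by
          simp only [Nat.cast_zero, sub_zero, neg_zero]
          have : 0 ≤ (walkLaw ν n).real {0} := measureReal_nonneg
          nlinarith [Real.pi_gt_three]
      _ ≤ ∑ l ∈ Finset.range d, Real.pi * ((walkLaw ν n).real {((0 : ℕ) : ℤ) - l} +
          (walkLaw ν n).real {-(((0 : ℕ) : ℤ) - l)}) :=
          Finset.single_le_sum (f := fun l : ℕ => Real.pi * ((walkLaw ν n).real
            {((0 : ℕ) : ℤ) - l} + (walkLaw ν n).real {-(((0 : ℕ) : ℤ) - l)}))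
            (fun l _ => by positivity) h0
      _ ≤ _ := Finset.single_le_sum (f := fun j : ℕ => ∑ l ∈ Finset.range d, Real.pi *
            ((walkLaw ν n).real {(j : ℤ) - l} + (walkLaw ν n).real {-((j : ℤ) - l)}))
            (fun j _ => by positivity) h0

/-- The Fourier criterion, under the assumption that the integral in the second variable is
`O(1 / (1 - cos (d t)))` uniformly in `r`. -/
theorem tendsto_integral_iff_of_mul_le (hρ : ρ.map (fun x => -x) = ρ)
    (hψ : Integrable (fun p : ℝ × ℝ => resolventRe (latticeCharFun ν p.1 * latticeCharFun ρ p.2))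
      (periodMeasure.prod periodMeasure))
    (hlt : ∀ᵐ s ∂periodMeasure, ‖latticeCharFun ρ s‖ < 1) {y₀ : ℕ}
    (hy₀ : ρ {x | |x| ≤ y₀} ≠ 0)
    (hG : ∑' n, walkLaw ν n {0} * walkLaw ρ n {x | |x| ≤ y₀} ≠ ∞) {d : ℕ} (hd : 0 < d) {M : ℝ}
    (hM : ∀ r ∈ Set.Ioo (0 : ℝ) 1, ∀ᵐ t ∂periodMeasure,
      (1 - Real.cos (d * t)) * |∫ s, lawIntegrand ν ρ r t s ∂periodMeasure| ≤ M)
    {U : Set ℝ} (hU : MeasurableSet U) (hUd : U ⊆ Set.Ioo (-(1 / d)) (1 / d : ℝ)) {η : ℝ}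
    (hη : 0 < η) (hηU : Set.Ioo (-η) η ⊆ U) :
    Tendsto (fun r => ∫ t in U, ∫ s in U, lawIntegrand ν ρ r t s) (𝓝[<] 1) atTop ↔
      ∑' n, walkLaw ν n {0} * overlap ρ n = ∞ := by
  obtain ⟨C, hC, hCle⟩ := exists_overlap_shift_le hρ
  rw [← tsum_fejerWeight_mul_eq_top_iff ν hd hC fun m n hmn => by
    simpa only [add_zero, overlap] using hCle m n hmn 0]
  have hpi := Real.pi_gt_three
  have hUpi : U ⊆ Set.Ioc (-Real.pi) Real.pi := by
    have h1 : (1 / d : ℝ) ≤ 1 := by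
      rw [div_le_one (by positivity)]
      exact_mod_cast hd
    exact fun t ht => ⟨by linarith [(hUd ht).1], by linarith [(hUd ht).2]⟩
  refine tendsto_integral_iff_of_kernel ν ρ hρ hψ hlt (measurable_fejerKernel d) (K := 1)
    (fun t => by
      rw [abs_of_nonneg (fejerKernel_nonneg d t)]
      exact fejerKernel_le_one hd t)
    (fejerWeight_nonneg ν d) (integral_fejerKernel_mul ν d)
    (summable_fejerWeight_mul ν (summable_walkLaw_mul_integral ν ρ hρ hy₀ hG) d) hU hUpi hη hηU
    (B := (Real.pi ^ 2 / 4 + Real.pi ^ 2 / (2 * η ^ 2 * d ^ 2)) * M * (2 * Real.pi))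
    fun r hr => ?_
  rw [← Real.norm_eq_abs, ← periodMeasure_real_univ]
  refine norm_integral_le_of_norm_le_const ?_
  filter_upwards [hM r hr, ae_abs_le_pi] with t ht htpi
  rw [norm_mul, Real.norm_eq_abs, Real.norm_eq_abs]
  calc |fejerKernel d t - U.indicator 1 t| * |∫ s, lawIntegrand ν ρ r t s ∂periodMeasure|
      ≤ (Real.pi ^ 2 / 4 + Real.pi ^ 2 / (2 * η ^ 2 * d ^ 2)) * (1 - Real.cos (d * t)) *
        |∫ s, lawIntegrand ν ρ r t s ∂periodMeasure| := by
        have := abs_fejerKernel_sub_indicator_le hd hUd hη hηU htpi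
        gcongr
    _ ≤ (Real.pi ^ 2 / 4 + Real.pi ^ 2 / (2 * η ^ 2 * d ^ 2)) * M := by
        rw [mul_assoc]
        gcongr

end

/-! ### Bounds on the integral in the second variable -/

section

variable (ρ : Measure ℤ) [IsProbabilityMeasure ρ]

/-- The Fourier coefficients of the tail series are at most `1`, so its pairing with an absolutely
convergent Fourier series is bounded uniformly in `r`. -/
theorem norm_integral_lawTailSeries_mul_charFun_le {r : ℝ} (hr0 : 0 ≤ r) (hr1 : r < 1)
    (σ : Measure ℤ) [IsProbabilityMeasure σ] :
    ‖∫ s, (lawTailSeries ρ r s : ℂ) * latticeCharFun σ s ∂periodMeasure‖ ≤ 2 * Real.pi := by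
  have hpi := Real.pi_pos
  have hneg : ∀ m : ℕ, (σ.map (fun x => -x)).real {(m : ℤ)} = σ.real {-(m : ℤ)} := by
    intro m
    rw [map_measureReal_apply Measurable.of_discrete MeasurableSet.of_discrete]
    congr 1
    ext x
    simp
  have : IsProbabilityMeasure (σ.map (fun x => -x)) :=
    Measure.isProbabilityMeasure_map Measurable.of_discrete.aemeasurable
  have hs1 := summable_real_natCast σ
  have hs2 := summable_real_natCast (σ.map (fun x => -x))
  have ht1 := tsum_real_natCast_le_one σ
  have ht2 := tsum_real_natCast_le_one (σ.map (fun x => -x))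
  simp_rw [hneg] at hs2 ht2
  have hnn : ∀ m : ℕ, 0 ≤ Real.pi * (σ.real {(m : ℤ)} + σ.real {-(m : ℤ)}) := fun m => by
    positivity
  have hs3 := (hs1.add hs2).mul_left Real.pi
  have hle : ∀ m : ℕ, r ^ m * lawTail ρ m * (Real.pi * (σ.real {(m : ℤ)} + σ.real {-(m : ℤ)})) ≤
      Real.pi * (σ.real {(m : ℤ)} + σ.real {-(m : ℤ)}) := fun m =>
    mul_le_of_le_one_left (hnn m) (pow_mul_lawTail_le_one ρ hr0 hr1 m)
  have hnn2 : ∀ m : ℕ, 0 ≤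
      r ^ m * lawTail ρ m * (Real.pi * (σ.real {(m : ℤ)} + σ.real {-(m : ℤ)})) := fun m =>
    mul_nonneg (pow_mul_lawTail_nonneg ρ hr0 m) (hnn m)
  rw [integral_lawTailSeries_mul_charFun ρ hr0 hr1, Complex.norm_real,
    Real.norm_of_nonneg (tsum_nonneg hnn2)]
  refine ((Summable.of_nonneg_of_le hnn2 hle hs3).tsum_le_tsum hle hs3).trans ?_
  rw [tsum_mul_left, hs1.tsum_add hs2]
  nlinarith

/-- Splitting off the atom at the origin. -/
theorem exists_latticeCharFun_eq_add (h : ρ.real {0} < 1) :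
    ∃ q : Measure ℤ, IsProbabilityMeasure q ∧ ∀ t, latticeCharFun ρ t =
      (ρ.real {0} : ℂ) + (1 - ρ.real {0} : ℂ) * latticeCharFun q t := by
  have hc : ρ.real {0}ᶜ = 1 - ρ.real {0} := probReal_compl_eq_one_sub MeasurableSet.of_discrete
  have hne : ρ {0}ᶜ ≠ 0 := by
    intro h0
    rw [measureReal_def, h0, ENNReal.toReal_zero] at hc
    linarith
  refine ⟨cond ρ {0}ᶜ, cond_isProbabilityMeasure hne, fun t => ?_⟩
  have hr : ρ.real {0}ᶜ ≠ 0 := by rw [hc]; linarith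
  rw [latticeCharFun, ← integral_add_compl (MeasurableSet.of_discrete (s := {(0 : ℤ)}))
    (integrable_exp_int ρ t), integral_singleton, latticeCharFun,
    ProbabilityTheory.cond, integral_smul_measure]
  have h1 : (1 - ρ.real {0} : ℂ) = ((ρ.real {0}ᶜ : ℝ) : ℂ) := by rw [hc]; push_cast; rfl
  rw [h1, ENNReal.toReal_inv, ← measureReal_def, Complex.real_smul, Complex.real_smul, ← mul_assoc,
    ← Complex.ofReal_mul, mul_inv_cancel₀ hr]
  simp

theorem mul_le_walkLaw_two (x y : ℤ) :
    ρ.real {x} * ρ.real {y} ≤ (walkLaw ρ 2).real {x + y} := by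
  have h : (ρ.prod ρ) {(x, y)} ≤ walkLaw ρ 2 {x + y} := by
    rw [walkLaw_succ, walkLaw_one, Measure.conv,
      Measure.map_apply Measurable.of_discrete MeasurableSet.of_discrete]
    refine measure_mono fun p hp => ?_
    rw [Set.mem_singleton_iff] at hp
    simp [hp]
  rw [← Set.singleton_prod_singleton, Measure.prod_prod] at h
  have h2 := ENNReal.toReal_mono (measure_ne_top _ _) h
  rwa [ENNReal.toReal_mul] at h2

/-- Two steps of a symmetric nondegenerate walk may lead back to the origin, but need not. -/
theorem walkLaw_two_zero_mem_Ioo (hρ : ρ.map (fun x => -x) = ρ) {a b : ℤ} (hab : a ≠ b)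
    (ha : ρ {a} ≠ 0) (hb : ρ {b} ≠ 0) : (walkLaw ρ 2).real {0} ∈ Set.Ioo (0 : ℝ) 1 := by
  have hpos : ∀ x, ρ {x} ≠ 0 → 0 < ρ.real {x} := fun x hx =>
    ENNReal.toReal_pos hx (measure_ne_top _ _)
  constructor
  · have h1 : ρ {-a} = ρ {a} := by
      rw [← measure_neg_eq hρ {-a}]
      congr 1
      ext z
      simp
    have h2 := mul_le_walkLaw_two ρ a (-a)
    rw [add_neg_cancel] at h2
    exact (mul_pos (hpos a ha) (hpos (-a) (by rwa [h1]))).trans_le h2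
  · have hlt : ∀ x, x ≠ 0 → ρ {x} ≠ 0 → (walkLaw ρ 2).real {0} < 1 := by
      intro x hx hx2
      have h2 := (mul_pos (hpos x hx2) (hpos x hx2)).trans_le (mul_le_walkLaw_two ρ x x)
      have hdisj : Disjoint ({0} : Set ℤ) {x + x} := by
        rw [Set.disjoint_singleton]
        omega
      have h3 : (walkLaw ρ 2).real ({0} ∪ {x + x}) ≤ 1 := measureReal_le_one
      rw [measureReal_union hdisj MeasurableSet.of_discrete] at h3
      linarith
    rcases eq_or_ne a 0 with rfl | h
    · exact hlt b hab.symm hb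
    · exact hlt a h ha

/-- The pairing of the tail series with `1 / (1 - e ψ)` for a unimodular number `e`, bounded
uniformly in `r`. Here `ψ ^ 2 = c + (1 - c) h`, where `c` is the probability to be back at the
origin after two steps and `h` is a characteristic function, whence
`1 / (1 - e ψ) = (1 + e ψ) ∑ ((1 - c) e ^ 2 h) ^ j / (1 - c e ^ 2) ^ (j + 1)`. -/
theorem norm_integral_lawTailSeries_mul_inv_le {r : ℝ} (hr0 : 0 ≤ r) (hr1 : r < 1) {c : ℝ}
    (hc : (walkLaw ρ 2).real {0} = c) (hc1 : c < 1) {e : ℂ} (he : ‖e‖ = 1)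
    (hlt : 1 - c < ‖1 - c * e ^ 2‖) :
    Integrable (fun s => (lawTailSeries ρ r s : ℂ) * (1 - e * latticeCharFun ρ s)⁻¹)
      periodMeasure ∧
    ‖∫ s, (lawTailSeries ρ r s : ℂ) * (1 - e * latticeCharFun ρ s)⁻¹ ∂periodMeasure‖ ≤
      4 * Real.pi / (‖1 - c * e ^ 2‖ - (1 - c)) := by
  obtain ⟨q, hq, hsplit⟩ := exists_latticeCharFun_eq_add (walkLaw ρ 2) (by rwa [hc])
  simp_rw [latticeCharFun_walkLaw, hc] at hsplit
  set A : ℂ := 1 - c * e ^ 2 with hA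
  set b : ℂ := (1 - c) * e ^ 2 with hb
  have hb1 : ‖b‖ = 1 - c := by
    rw [hb, norm_mul, norm_pow, he, one_pow, mul_one, ← Complex.ofReal_one, ← Complex.ofReal_sub,
      Complex.norm_real, Real.norm_of_nonneg (by linarith)]
  have hApos : 0 < ‖A‖ := by linarith
  have hA0 : A ≠ 0 := norm_pos_iff.1 hApos
  set M := ∑' m, r ^ m * lawTail ρ m with hM
  have hM0 : 0 ≤ M := tsum_nonneg fun m => pow_mul_lawTail_nonneg ρ hr0 m
  have hcρ := continuous_latticeCharFun ρ
  have hcq := continuous_latticeCharFun q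
  have hct := continuous_lawTailSeries ρ hr0 hr1
  have hβ0 : 0 ≤ ‖b / A‖ := norm_nonneg _
  have hβ1 : ‖b / A‖ < 1 := by
    rw [norm_div, hb1, div_lt_one hApos]
    exact hlt
  have hgeo := summable_geometric_of_lt_one hβ0 hβ1
  set F : ℕ → ℝ → ℂ := fun j s => (lawTailSeries ρ r s : ℂ) *
    (A⁻¹ * (b / A) ^ j *
      (latticeCharFun q s ^ j + e * (latticeCharFun ρ s * latticeCharFun q s ^ j)))
    with hF
  have hpow : ∀ j s, ‖latticeCharFun q s ^ j‖ ≤ 1 := fun j s => by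
    rw [norm_pow]
    exact pow_le_one₀ (norm_nonneg _) (norm_latticeCharFun_le_one q s)
  have hFbound : ∀ j s, ‖F j s‖ ≤ M * (‖A‖⁻¹ * ‖b / A‖ ^ j * 2) := by
    intro j s
    simp only [hF]
    rw [norm_mul, norm_mul _ (_ + _), norm_mul, norm_inv, norm_pow, Complex.norm_real,
      Real.norm_eq_abs]
    have h1 := abs_lawTailSeries_le ρ hr0 hr1 s
    have h2 : ‖latticeCharFun q s ^ j + e * (latticeCharFun ρ s * latticeCharFun q s ^ j)‖ ≤ 2 := by
      refine (norm_add_le _ _).trans ?_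
      rw [norm_mul e, he, one_mul, norm_mul]
      have := mul_le_one₀ (norm_latticeCharFun_le_one ρ s) (norm_nonneg _) (hpow j s)
      linarith [hpow j s]
    gcongr
  have hFint : ∀ j, Integrable (F j) periodMeasure := fun j =>
    (integrable_const (M * (‖A‖⁻¹ * ‖b / A‖ ^ j * 2))).mono'
      (Continuous.aestronglyMeasurable (by fun_prop)) (ae_of_all _ (hFbound j))
  have hFsum : Summable fun j => ∫ s, ‖F j s‖ ∂periodMeasure := by
    refine Summable.of_nonneg_of_le (fun j => integral_nonneg fun s => norm_nonneg _)
      (fun j => integral_mono (hFint j).norm (integrable_const _) (hFbound j)) ?_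
    simp_rw [integral_const]
    exact (((hgeo.mul_left _).mul_right _).mul_left _).const_smul _
  have hpt : ∀ s, HasSum (fun j => F j s)
      ((lawTailSeries ρ r s : ℂ) * (1 - e * latticeCharFun ρ s)⁻¹) := by
    intro s
    have h1 : ‖b / A * latticeCharFun q s‖ < 1 := by
      rw [norm_mul]
      exact (mul_le_of_le_one_right hβ0 (norm_latticeCharFun_le_one q s)).trans_lt hβ1
    have hne : 1 - b / A * latticeCharFun q s ≠ 0 := by
      intro h0
      rw [← sub_eq_zero.1 h0, norm_one] at h1
      exact lt_irrefl _ h1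
    have hprod : A * (1 - b / A * latticeCharFun q s) =
        (1 - e * latticeCharFun ρ s) * (1 + e * latticeCharFun ρ s) := by
      rw [mul_sub, mul_one, ← mul_assoc, mul_div_cancel₀ _ hA0, hA, hb]
      linear_combination e ^ 2 * hsplit s
    have hne2 := hprod ▸ mul_ne_zero hA0 hne
    have h2 := ((hasSum_geometric_of_norm_lt_one h1).mul_left ((lawTailSeries ρ r s : ℂ) *
      (A⁻¹ * (1 + e * latticeCharFun ρ s))))
    have h3 : (lawTailSeries ρ r s : ℂ) * (A⁻¹ * (1 + e * latticeCharFun ρ s)) *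
        (1 - b / A * latticeCharFun q s)⁻¹ =
        (lawTailSeries ρ r s : ℂ) * (1 - e * latticeCharFun ρ s)⁻¹ := by
      have h4 : (1 - e * latticeCharFun ρ s)⁻¹ =
          (1 + e * latticeCharFun ρ s) * (A * (1 - b / A * latticeCharFun q s))⁻¹ := by
        rw [hprod, mul_inv, mul_left_comm, mul_inv_cancel₀ (right_ne_zero_of_mul hne2), mul_one]
      rw [h4, mul_inv]
      ring
    rw [h3] at h2
    refine h2.congr_fun fun j => ?_
    simp only [hF, mul_pow]
    ring
  have hsum := hasSum_integral_of_summable_integral_norm hFint hFsum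
  simp_rw [(hpt _).tsum_eq] at hsum
  constructor
  · refine (integrable_const (∑' j, M * (‖A‖⁻¹ * ‖b / A‖ ^ j * 2))).mono'
      ?_ (ae_of_all _ fun s => ?_)
    · exact (hct.measurable.complex_ofReal.mul
        (measurable_const.sub (measurable_const.mul hcρ.measurable)).inv).aestronglyMeasurable
    · rw [← (hpt s).tsum_eq]
      exact tsum_of_norm_bounded (((hgeo.mul_left _).mul_right _).mul_left _).hasSum
        fun j => hFbound j s
  · have hterm : ∀ j, ‖∫ s, F j s ∂periodMeasure‖ ≤ ‖A‖⁻¹ * ‖b / A‖ ^ j * (4 * Real.pi) := by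
      intro j
      have h1 := norm_integral_lawTailSeries_mul_charFun_le ρ hr0 hr1 (walkLaw q j)
      have h2 := norm_integral_lawTailSeries_mul_charFun_le ρ hr0 hr1 (ρ.conv (walkLaw q j))
      have hi : ∀ σ : Measure ℤ, IsProbabilityMeasure σ → Integrable
          (fun s => (lawTailSeries ρ r s : ℂ) * latticeCharFun σ s) periodMeasure := by
        intro σ hσ
        have := continuous_latticeCharFun σ
        refine (integrable_const M).mono' (Continuous.aestronglyMeasurable (by fun_prop))
          (ae_of_all _ fun s => ?_)
        rw [norm_mul, Complex.norm_real, Real.norm_eq_abs]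
        exact (mul_le_of_le_one_right (abs_nonneg _) (norm_latticeCharFun_le_one σ s)).trans
          (abs_lawTailSeries_le ρ hr0 hr1 s)
      have h3 : ∀ s, F j s = A⁻¹ * (b / A) ^ j *
          ((lawTailSeries ρ r s : ℂ) * latticeCharFun (walkLaw q j) s +
            e * ((lawTailSeries ρ r s : ℂ) * latticeCharFun (ρ.conv (walkLaw q j)) s)) := by
        intro s
        rw [latticeCharFun_conv, latticeCharFun_walkLaw]
        simp only [hF]
        ring
      simp_rw [h3]
      rw [integral_const_mul, integral_add (hi _ inferInstance) ((hi _ inferInstance).const_mul e),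
        integral_const_mul, norm_mul, norm_mul, norm_inv, norm_pow]
      gcongr
      refine (norm_add_le _ _).trans ?_
      rw [norm_mul, he, one_mul]
      linarith
    have hbd := tsum_of_norm_bounded ((hgeo.mul_left ‖A‖⁻¹).mul_right (4 * Real.pi)).hasSum hterm
    rw [hsum.tsum_eq, tsum_mul_right, tsum_mul_left, tsum_geometric_of_lt_one hβ0 hβ1] at hbd
    refine hbd.trans (le_of_eq ?_)
    have h5 : ‖A‖ - (1 - c) ≠ 0 := by linarith
    have h6 : 1 - ‖b / A‖ = (‖A‖ - (1 - c)) / ‖A‖ := by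
      rw [norm_div, hb1, sub_div ‖A‖, div_self hApos.ne']
    rw [h6]
    field_simp

/-- The bound on the integral in the second variable for a walk with deterministic steps. -/
theorem mul_abs_integral_lawIntegrand_dirac_le {c : ℝ}
    (hc : (walkLaw ρ 2).real {0} = c) (hc01 : c ∈ Set.Ioo (0 : ℝ) 1) (a : ℤ) {r : ℝ}
    (hr0 : 0 ≤ r) (hr1 : r < 1) (t : ℝ) :
    (1 - Real.cos ((2 * a.natAbs : ℕ) * t)) *
      |∫ s, lawIntegrand (Measure.dirac a) ρ r t s ∂periodMeasure| ≤ 6 * Real.pi / c := by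
  obtain ⟨hc0, hc1⟩ := hc01
  have hpi := Real.pi_pos
  set θ : ℝ := t * a with hθ
  have hcos : Real.cos ((2 * a.natAbs : ℕ) * t) = Real.cos (2 * θ) := by
    rw [hθ]
    push_cast
    rw [Nat.cast_natAbs, Int.cast_abs]
    rcases abs_choice (a : ℝ) with h | h
    · rw [h]
      ring_nf
    · rw [h, ← Real.cos_neg]
      ring_nf
  rw [hcos]
  set x := 1 - Real.cos (2 * θ) with hx
  rcases (sub_nonneg.2 (Real.cos_le_one (2 * θ))).eq_or_lt with h0 | h0
  · rw [hx, ← h0, zero_mul]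
    positivity
  set e : ℂ := Complex.exp (θ * Complex.I) with he
  have he1 : ‖e‖ = 1 := Complex.norm_exp_ofReal_mul_I θ
  have he2 : e ^ 2 = Complex.exp (((2 * θ : ℝ) : ℂ) * Complex.I) := by
    rw [he, ← Complex.exp_nat_mul]
    push_cast
    ring_nf
  have hAsq : ‖(1 : ℂ) - c * e ^ 2‖ ^ 2 = (1 - c) ^ 2 + 2 * c * x := by
    rw [← Complex.normSq_eq_norm_sq, he2, Complex.normSq_apply, Complex.sub_re, Complex.sub_im,
      Complex.re_ofReal_mul, Complex.im_ofReal_mul, Complex.exp_ofReal_mul_I_re,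
      Complex.exp_ofReal_mul_I_im, Complex.one_re, Complex.one_im, hx]
    linear_combination c ^ 2 * Real.sin_sq_add_cos_sq (2 * θ)
  have hAle : ‖(1 : ℂ) - c * e ^ 2‖ ≤ 1 + c := by
    refine (norm_sub_le _ _).trans ?_
    rw [norm_one, norm_mul, norm_pow, he1, one_pow, mul_one, Complex.norm_real,
      Real.norm_of_nonneg hc0.le]
  have hlt : 1 - c < ‖(1 : ℂ) - c * e ^ 2‖ := by
    refine lt_of_pow_lt_pow_left₀ 2 (norm_nonneg _) ?_
    rw [hAsq]
    have : 0 < 2 * c * x := by positivity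
    linarith
  obtain ⟨hint, hle⟩ := norm_integral_lawTailSeries_mul_inv_le ρ hr0 hr1 hc hc1 he1 hlt
  have hI : ∫ s, lawIntegrand (Measure.dirac a) ρ r t s ∂periodMeasure =
      (∫ s, (lawTailSeries ρ r s : ℂ) * (1 - e * latticeCharFun ρ s)⁻¹ ∂periodMeasure).re := by
    have h := integral_re hint
    simp only [RCLike.re_eq_complex_re, Complex.re_ofReal_mul] at h
    rw [← h]
    refine integral_congr_ae (ae_of_all _ fun s => ?_)
    simp only [lawIntegrand, resolventRe, latticeCharFun_dirac, he, hθ]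
    push_cast
    rfl
  have hI2 := (Complex.abs_re_le_norm _).trans hle
  rw [← hI, le_div_iff₀ (by linarith)] at hI2
  set I := |∫ s, lawIntegrand (Measure.dirac a) ρ r t s ∂periodMeasure| with hIdef
  have hIn : 0 ≤ I := abs_nonneg _
  rw [le_div_iff₀ hc0]
  have h3 : 2 * c * x ≤ 3 * (‖(1 : ℂ) - c * e ^ 2‖ - (1 - c)) := by nlinarith
  have h4 := mul_le_mul_of_nonneg_left h3 hIn
  linarith

/-- The bound on the integral in the second variable for a walk with random steps. -/
theorem ae_mul_abs_integral_lawIntegrand_le (ν : Measure ℤ) [IsProbabilityMeasure ν]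
    (hρ : ρ.map (fun x => -x) = ρ) {a b : ℤ} (hab : a < b) (ha : ν {a} ≠ 0) (hb : ν {b} ≠ 0)
    {r : ℝ} (hr0 : 0 ≤ r) (hr1 : r < 1) : ∀ᵐ t ∂periodMeasure,
    (1 - Real.cos ((b - a).toNat * t)) *
      |∫ s, lawIntegrand ν ρ r t s ∂periodMeasure| ≤ 2 * Real.pi / (ν.real {a} * ν.real {b}) := by
  have hp : 0 < ν.real {a} := ENNReal.toReal_pos ha (measure_ne_top _ _)
  have hq : 0 < ν.real {b} := ENNReal.toReal_pos hb (measure_ne_top _ _)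
  filter_upwards [ae_norm_latticeCharFun_lt_one ν hab.ne ha hb] with t ht
  have h1 := abs_integral_lawIntegrand_le ν ρ hr0 hr1 hρ ht
  have h2 := norm_latticeCharFun_le ν hab.ne t
  have hcast : (((b - a).toNat : ℕ) : ℝ) = ((b - a : ℤ) : ℝ) := by
    rw [← Int.cast_natCast, Int.toNat_of_nonneg (by omega)]
  rw [le_div_iff₀ (by linarith)] at h1
  rw [hcast, le_div_iff₀ (by positivity)]
  have h3 := mul_le_mul_of_nonneg_left h2
    (abs_nonneg (∫ s, lawIntegrand ν ρ r t s ∂periodMeasure))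
  linarith

end

/-! ### The criterion for the laws of the jumps -/

section

variable (ν ρ : Measure ℤ) [IsProbabilityMeasure ν] [IsProbabilityMeasure ρ]

theorem walkLaw_dirac_zero (n : ℕ) : walkLaw (Measure.dirac 0) n = Measure.dirac 0 := by
  induction n with
  | zero => rfl
  | succ n ih => rw [walkLaw_succ, ih, Measure.dirac_zero_conv]

/-- If the first walk does not move, the integral over `t` only produces the factor `|U|`. -/
theorem tendsto_integral_iff_of_dirac_zero (hρ : ρ.map (fun x => -x) = ρ)
    (hψ : Integrable (fun p : ℝ × ℝ =>
      resolventRe (latticeCharFun (Measure.dirac 0) p.1 * latticeCharFun ρ p.2))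
      (periodMeasure.prod periodMeasure))
    (hlt : ∀ᵐ s ∂periodMeasure, ‖latticeCharFun ρ s‖ < 1) {y₀ : ℕ}
    (hy₀ : ρ {x | |x| ≤ y₀} ≠ 0)
    (hG : ∑' n, walkLaw (Measure.dirac 0) n {0} * walkLaw ρ n {x | |x| ≤ y₀} ≠ ∞)
    {U : Set ℝ} (hU : MeasurableSet U) (hUpi : U ⊆ Set.Ioc (-Real.pi) Real.pi) {η : ℝ}
    (hη : 0 < η) (hηU : Set.Ioo (-η) η ⊆ U) :
    Tendsto (fun r => ∫ t in U, ∫ s in U, lawIntegrand (Measure.dirac 0) ρ r t s) (𝓝[<] 1) atTop ↔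
      ∑' n, walkLaw (Measure.dirac 0) n {0} * overlap ρ n = ∞ := by
  set v := periodMeasure.real U with hv
  have hone : ∀ n, (walkLaw (Measure.dirac 0) n).real {0} = 1 := fun n => by
    rw [walkLaw_dirac_zero, measureReal_def]
    simp
  have hvpos : 0 < v := by
    have h1 : Set.Ioo (-η) η ⊆ Set.Ioc (-Real.pi) Real.pi := hηU.trans hUpi
    have h2 : periodMeasure.real (Set.Ioo (-η) η) ≤ v := measureReal_mono hηU
    rw [periodMeasure, measureReal_restrict_apply measurableSet_Ioo, Set.inter_eq_left.2 h1,
      Real.volume_real_Ioo_of_le (by linarith)] at h2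
    linarith
  have hsum := summable_walkLaw_mul_integral (Measure.dirac 0) ρ hρ hy₀ hG 0
  simp_rw [hone, one_mul] at hsum
  rw [tendsto_integral_iff_of_kernel (Measure.dirac 0) ρ hρ hψ hlt (k := U.indicator 1) (K := 1)
    (measurable_one.indicator hU) (fun t => by by_cases ht : t ∈ U <;> simp [ht])
    (u := fun _ => v) (fun _ => hvpos.le) (fun n => ?_) (hsum.mul_left v) hU hUpi hη hηU (B := 0)
    (fun r _ => by simp)]
  · have h1 : ∀ n, walkLaw (Measure.dirac 0) n {0} = 1 := fun n => by
      rw [walkLaw_dirac_zero]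
      simp
    simp_rw [h1, one_mul]
    rw [ENNReal.tsum_mul_left, ENNReal.mul_eq_top]
    simp [hvpos]
  · simp only [latticeCharFun_dirac, Int.cast_zero, mul_zero, zero_mul, Complex.exp_zero, one_pow,
      Complex.one_re, mul_one]
    rw [integral_indicator_one hU]

theorem lawTailSeries_dirac_zero (r s : ℝ) : lawTailSeries (Measure.dirac 0) r s = 1 := by
  have h : ∀ m : ℕ, m ≠ 0 → r ^ m * lawTail (Measure.dirac 0) m * Real.cos (m * s) = 0 := by
    intro m hm
    have : lawTail (Measure.dirac 0) m = 0 := by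
      rw [lawTail, measureReal_def]
      simp [hm]
    rw [this]
    ring
  rw [lawTailSeries, tsum_eq_single 0 h, lawTail, measureReal_def]
  simp

/-- The Fourier criterion in terms of the step laws. -/
theorem exists_fourier_criterion (hρ : ρ.map (fun x => -x) = ρ) {y₀ : ℕ}
    (hy₀ : ρ {x | |x| ≤ y₀} ≠ 0)
    (hG : ∑' n, walkLaw ν n {0} * walkLaw ρ n {x | |x| ≤ y₀} ≠ ∞) :
    ∃ δ > 0, ∀ U : Set ℝ, MeasurableSet U → U ∈ 𝓝 0 → U ⊆ Set.Ioo (-δ) δ →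
      (∀ r ∈ Set.Ioo (0 : ℝ) 1,
        IntegrableOn (fun p : ℝ × ℝ => lawIntegrand ν ρ r p.1 p.2) (U ×ˢ U)) ∧
      (∑' n, walkLaw ν n {0} * overlap ρ n = ∞ ↔
        Tendsto (fun r => ∫ t in U, ∫ s in U, lawIntegrand ν ρ r t s) (𝓝[<] 1) atTop) := by
  have hpi := Real.pi_gt_three
  have hψ := integrable_resolventRe ν ρ (ne_top_of_le_ne_top hG (ENNReal.tsum_le_tsum fun n =>
    mul_le_mul_right (measure_mono (by intro x hx; rw [Set.mem_singleton_iff] at hx; simp [hx])) _))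
  suffices h : ∃ δ > 0, δ ≤ 1 ∧ ∀ U : Set ℝ, MeasurableSet U →
      U ⊆ Set.Ioc (-Real.pi) Real.pi → ∀ η > 0, Set.Ioo (-η) η ⊆ U → U ⊆ Set.Ioo (-δ) δ →
      (Tendsto (fun r => ∫ t in U, ∫ s in U, lawIntegrand ν ρ r t s) (𝓝[<] 1) atTop ↔
        ∑' n, walkLaw ν n {0} * overlap ρ n = ∞) by
    obtain ⟨δ, hδ, hδ1, h⟩ := h
    refine ⟨δ, hδ, fun U hU hU0 hUδ => ?_⟩
    have hUpi : U ⊆ Set.Ioc (-Real.pi) Real.pi := fun t ht =>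
      ⟨by linarith [(hUδ ht).1], by linarith [(hUδ ht).2]⟩
    obtain ⟨η, hη, hηU⟩ := Metric.mem_nhds_iff.1 hU0
    rw [Real.ball_eq_Ioo, zero_sub, zero_add] at hηU
    refine ⟨fun r hr => ?_, (h U hU hUpi η hη hηU hUδ).symm⟩
    have h1 := (integrable_lawIntegrand ν ρ hr.1.le hr.2 hψ).integrableOn (s := U ×ˢ U)
    have hres : periodMeasure.restrict U = volume.restrict U := by
      rw [periodMeasure, Measure.restrict_restrict hU, Set.inter_eq_left.2 hUpi]
    rw [IntegrableOn, ← Measure.prod_restrict, hres, Measure.prod_restrict] at h1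
    exact h1
  rcases eq_dirac_or_exists_two_atoms ρ with ⟨v, hv⟩ | ⟨x, y, hxy, hx, hy⟩
  · -- By symmetry the second walk stays at the origin, and both conditions fail.
    have hv0 : v = 0 := by
      have h1 := measure_neg_eq hρ {v}
      rw [hv] at h1
      by_contra hne
      have h2 : -v ≠ v := by omega
      simp [h2] at h1
    subst hv0
    have hfin : ∑' n, walkLaw ν n {0} * overlap ρ n ≠ ∞ := by
      refine ne_top_of_le_ne_top hG (ENNReal.tsum_le_tsum fun n => mul_le_mul_right ?_ _)
      rw [hv, walkLaw_dirac_zero]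
      refine (prob_le_one (μ := (walkLaw (Measure.dirac 0) n).prod (Measure.dirac 0))).trans ?_
      simp
    refine ⟨1, one_pos, le_rfl, fun U _ _ η _ _ _ => iff_of_false (fun h => ?_) hfin⟩
    simp only [lawIntegrand, hv, lawTailSeries_dirac_zero] at h
    exact not_tendsto_const_atTop _ _ h
  have hlt := ae_norm_latticeCharFun_lt_one ρ hxy.ne hx hy
  rcases eq_dirac_or_exists_two_atoms ν with ⟨a, rfl⟩ | ⟨a, b, hab, ha, hb⟩
  · rcases eq_or_ne a 0 with rfl | ha
    · exact ⟨1, one_pos, le_rfl, fun U hU hUpi η hη hηU _ =>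
        tendsto_integral_iff_of_dirac_zero ρ hρ hψ hlt hy₀ hG hU hUpi hη hηU⟩
    · have hd : 0 < 2 * a.natAbs := by omega
      refine ⟨1 / (2 * a.natAbs : ℕ), by positivity, ?_, fun U hU _ η hη hηU hUδ =>
        tendsto_integral_iff_of_mul_le (Measure.dirac a) ρ hρ hψ hlt hy₀ hG hd
        (fun r hr => ae_of_all _ fun t => mul_abs_integral_lawIntegrand_dirac_le ρ rfl
          (walkLaw_two_zero_mem_Ioo ρ hρ hxy.ne hx hy) a hr.1.le hr.2 t) hU hUδ hη hηU⟩
      rw [div_le_one (by positivity)]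
      exact_mod_cast hd
  · have hd : 0 < (b - a).toNat := by omega
    refine ⟨1 / (b - a).toNat, by positivity, ?_, fun U hU _ η hη hηU hUδ =>
      tendsto_integral_iff_of_mul_le ν ρ hρ hψ hlt hy₀ hG hd
      (fun r hr => ae_mul_abs_integral_lawIntegrand_le ρ ν hρ hab ha hb hr.1.le hr.2)
      hU hUδ hη hηU⟩
    rw [div_le_one (by positivity)]
    exact_mod_cast hd

end

/-! ### The criterion for the walks -/

section

variable {Ω : Type*} [MeasurableSpace Ω] {μ : Measure Ω} {S : ℕ → Ω → ℤ}

theorem IsRandomWalk.jumpCharFun_eq (hS : IsRandomWalk S μ) (t : ℝ) :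
    jumpCharFun S μ t = latticeCharFun (jumpLaw S μ) t := by
  have hm := hS.measurable_jump 0
  have hmr : Measurable fun ω => ((S 1 ω - S 0 ω : ℤ) : ℝ) := Measurable.of_discrete.comp hm
  rw [jumpCharFun, charFun_apply_real, integral_map hmr.aemeasurable (by fun_prop),
    latticeCharFun, jumpLaw, integral_map hm.aemeasurable
      (Measurable.of_discrete.aestronglyMeasurable)]
  simp

theorem IsRandomWalk.jumpTail_eq (hS : IsRandomWalk S μ) (n : ℕ) :
    jumpTail S μ n = lawTail (jumpLaw S μ) n := by
  rw [jumpTail, lawTail, jumpLaw, map_measureReal_apply (hS.measurable_jump 0)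
    MeasurableSet.of_discrete]
  rfl

theorem fourierIntegrand_eq {H V : ℕ → Ω → ℤ} (hH : IsRandomWalk H μ) (hV : IsRandomWalk V μ)
    (r t s : ℝ) :
    fourierIntegrand H V μ r t s = lawIntegrand (jumpLaw H μ) (jumpLaw V μ) r t s := by
  have h : tailSeries V μ r s = lawTailSeries (jumpLaw V μ) r s := by
    simp only [tailSeries, lawTailSeries, hV.jumpTail_eq]
  rw [fourierIntegrand, lawIntegrand, resolventRe, h, hH.jumpCharFun_eq, hV.jumpCharFun_eq,
    div_eq_mul_inv, Complex.re_ofReal_mul]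

end

theorem theorem3 {Ω : Type*} [MeasurableSpace Ω] (μ : Measure Ω) [IsProbabilityMeasure μ]
    (H V : ℕ → Ω → ℤ) (hH : IsRandomWalk H μ) (hV : IsRandomWalk V μ)
    (hVsymm : HasSymmetricJumps V μ)
    (hindep : IndepFun (fun ω n => H n ω) (fun ω n => V n ω) μ) :
    (μ {ω | ∃ᶠ n in atTop, H (n + 1) ω = 0 ∧ V n ω * V (n + 1) ω ≤ 0} = 1 ↔
      ∑' n : ℕ, μ {ω | H (n + 1) ω = 0} *
        μ {ω | 0 ≤ V n ω ∧ V n ω ≤ V (n + 1) ω - V n ω} = ⊤) ∧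
    (IsTransientPair H V μ →
      ∃ δ > 0, ∀ U : Set ℝ, MeasurableSet U → U ∈ 𝓝 0 → U ⊆ Set.Ioo (-δ) δ →
        (∀ r ∈ Set.Ioo (0 : ℝ) 1,
          IntegrableOn (fun p : ℝ × ℝ => fourierIntegrand H V μ r p.1 p.2) (U ×ˢ U)) ∧
        (∑' n : ℕ, μ {ω | H (n + 1) ω = 0} *
            μ {ω | 0 ≤ V n ω ∧ V n ω ≤ V (n + 1) ω - V n ω} = ⊤ ↔
          Tendsto (fun r : ℝ => ∫ t in U, ∫ s in U, fourierIntegrand H V μ r t s)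
            (𝓝[<] 1) atTop)) := by
  refine ⟨measure_frequently_crossing_eq_one_iff hH hV hVsymm hindep, fun htr => ?_⟩
  have hprobH := hH.isProbabilityMeasure_jumpLaw
  have hprobV := hV.isProbabilityMeasure_jumpLaw
  obtain ⟨y₀, hy₀, -⟩ := exists_minimal_step (jumpLaw V μ)
  simp_rw [tsum_cone_eq_top_iff hH hV hVsymm, fourierIntegrand_eq hH hV]
  exact exists_fourier_criterion (jumpLaw H μ) (jumpLaw V μ) (hVsymm.map_neg_jumpLaw hV) hy₀
    (tsum_walkLaw_mul_window_ne_top hH hV hVsymm hindep htr hy₀)
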